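/- **Setting.** Let $d\ge 1$, let $\Theta\subseteq\mathbb R^d$, let $\mathcal Z$ be a data space and let $\ell_\theta:\mathcal Z\cup\{\bot\}\to[0,\infty)$ $(\theta\in\Theta)$ be losses with $\ell_\theta(\bot)=0$. For a tuple $S\in(\mathcal Z\cup\{\bot\})^n$ put $L_\theta(S)=\frac1n\sum_{i=1}^n\ell_\theta(s_i)$, $L(S)=\inf_{\theta\in\Theta}L_\theta(S)$, and $L^{(\pi)}(S)=\inf\{L_\theta(S):\theta\in\Theta,\ \theta_1\in\pi\}$ for an interval $\pi$ (with $\inf\emptyset=\infty$), $L^{(w)}=L^{(\{w\})}$. Let $S_{-i}$ be $S$ with $s_i$ replaced by $\bot$, and let $\mathcal S_p(Z)$ be the random tuple that keeps each entry of $Z$ independently with probability $p$ and replaces it by $\bot$ otherwise. For a probability distribution $\mathcal D$ on $\mathcal Z$ let $\theta(\mathcal D)$ be a minimizer of $\theta\mapsto\mathbb E_{z\sim\mathcal D}[\ell_\theta(z)]$ over $\Theta$, and let $\theta(Z)$ be a minimizer of $L_\theta(Z)$ over $\Theta$. **Assumption 5.2.** There are a function $N:(0,\infty)\to[0,\infty)$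 and $M,K,\lambda,\mu,\sigma>0$ such that for all $\alpha,\beta>0$ and all integers $n\ge1$, with $Z\sim\mathcal D^n$: 1. if $n\ge N(\alpha)+K\log(1/\beta)/\alpha^2$, then $\Pr[|\theta(Z)_1-\theta(\mathcal D)_1|\ge\alpha\mu^{-1/2}]\le\beta$; 2. if $n\ge M+K\log(1/\beta)$, then with probability at least $1-\beta$, for all $w$ that are the first coordinate of some $\theta\in\Theta$, $\frac{\mu}{2}(w-\theta(Z)_1)^2\le L^{(w)}(Z)-L(Z)\le2\mu(w-\theta(Z)_1)^2$; 3. if $n\ge M+K\log(1/\beta)$ and $i\in[n]$, then $\Pr[|L(Z)-L(Z_{-i})|\ge\lambda\log(2/\beta)/n]\le\beta$; 4. $\Pr[L(Z)\ge\sigma^2(1+\log(1/\beta)/n)]\le\beta$. **Computational model.** A mechanism is a fixed program for a randomized real RAM. Unit-cost operations are: real arithmetic, $\exp$, $\log$, comparisons and memory accesses, drawing a uniform real in $[0,1]$, drawing a fresh subsample $S\sim\mathcal S_p(Z)$ of the dataset, and querying the value $\min\{L^{(\pi)}(S),b\}$ of a loss, clipped at a bound $b$, on the current subsample (initially the whole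 dataset), for $\pi$ one of the three intervals $(-t,t)$, $[t,\infty)$, $(-\infty,-t]$ at a threshold $t$ of the program's choice. The data are accessible only through such queries. The program receives $\varepsilon,\delta,\rho,t,\alpha,p$. It is $(\varepsilon,\delta)$-DP if $\Pr[\mathcal M(Z)\in E]\le e^\varepsilon\Pr[\mathcal M(Z')\in E]+\delta$ for all events $E$ and all datasets $Z,Z'$ of the same size that differ in exactly one position. **Theorem 5.3.** There are a single mechanism $\mathcal M$ with output in $\{-1,0,1\}$ and absolute constants $C>0$ and $k,m\in\mathbb N$ such that for all $d,\mathcal Z,\Theta,\ell$ as above, all $\varepsilon>0$, $\delta\in(0,1)$, $\alpha>0$, $\rho>0$, $t>0$ and $p\in(0,1/4)$: * (privacy) $\mathcal M$ is $(\varepsilon,\delta)$-DP on datasets of every size $n$, without any assumption on the task; * (running time) on every dataset and for every outcome of its random draws, $\mathcal M$ halts within time $C\exp\!\big(C\,\frac p\varepsilon\log\frac1\delta\big)\cdot\big(1+\frac{\log(1/\delta)}{p}\big)^m$; * (accuracy) if $(\Theta,\ell,\mathcal D)$ satisfies Assumption 5.2 with $N,M,K,\lambda,\mu,\sigma$, if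 $\rho\ge2\sigma^2+\alpha^2$ and $t>20\alpha\mu^{-1/2}$, and if $$n\ \ge\ C\left[\frac{N(\alpha/2)+M}{p}+\left(\frac{K(1+\alpha^2)}{\alpha^2}+\frac{\rho^2+\lambda^2}{\alpha^4}\right)\left(\frac1p+\frac{p^2}{\varepsilon^3}\right)\left(\log\frac{n\,\max\{1,\rho/\alpha\}\,\max\{1,1/\varepsilon\}}{\delta}\right)^k\right],$$ then, over $Z\sim\mathcal D^n$ and the randomness of $\mathcal M$: if $|\theta(\mathcal D)_1|>2t$, then $\mathcal M(Z)=\operatorname{sign}(\theta(\mathcal D)_1)$ with probability at least $1-\delta$; and if $|\theta(\mathcal D)_1|<t/2$, then $\mathcal M(Z)=0$ with probability at least $1-\delta$. -/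

import Mathlib

open MeasureTheory
open scoped ENNReal NNReal

noncomputable section

namespace ParamTest

/-! ### Datasets and learning tasks -/

/-- A tuple of `n` entries, each a data point or the blank symbol `⊥` (here `none`). -/
abbrev Dataset (n : ℕ) (𝒵 : Type*) : Type _ := Fin n → Option 𝒵

/-- A dataset without blanks, seen as a tuple over `𝒵 ∪ {⊥}`. -/
def full {n : ℕ} {𝒵 : Type*} (Z : Fin n → 𝒵) : Dataset n 𝒵 := fun i => some (Z i)

/-- `S₋ᵢ`: the dataset `S` with the `i`-th entry replaced by `⊥`. -/
def remove {n : ℕ} {𝒵 : Type*} (S : Dataset n 𝒵) (i : Fin n) : Dataset n 𝒵 :=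
  Function.update S i none

/-- Two datasets of the same size are neighbors if they differ in exactly one position. -/
def Neighbors {n : ℕ} {𝒵 : Type*} (Z Z' : Fin n → 𝒵) : Prop := ∃! i, Z i ≠ Z' i

/-- The data-independent part `(Θ, ℓ)` of a learning task: a set of parameters in `ℝᵈ` and a
family of nonnegative losses (only the values `ℓ θ` with `θ ∈ Θ` matter). -/
structure Task (d : ℕ) (𝒵 : Type*) where
  /-- the parameter set -/
  Θ : Set (Fin d → ℝ)
  /-- the losses on data points; the loss of `⊥` is `0`, see `Task.lossAt` -/
  loss : (Fin d → ℝ) → 𝒵 → ℝ≥0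

namespace Task

variable {d : ℕ} {𝒵 : Type*} (𝒯 : Task d 𝒵)

/-- `L_θ(S) = (1/n) ∑ᵢ ℓ_θ(sᵢ)`, with `ℓ_θ(⊥) = 0`; the normalization is by the length `n` of the
tuple, blanks included. -/
def lossAt {n : ℕ} (θ : Fin d → ℝ) (S : Dataset n 𝒵) : ℝ≥0 :=
  (∑ i, (S i).elim 0 (𝒯.loss θ)) / n

/-- `L^(π)(S)`: the least empirical loss among the parameters whose first coordinate lies in `π`
(it is `∞` if there is no such parameter). -/
def constrainedLoss [NeZero d] {n : ℕ} (π : Set ℝ) (S : Dataset n 𝒵) : ℝ≥0∞ :=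
  ⨅ θ ∈ {θ | θ ∈ 𝒯.Θ ∧ θ 0 ∈ π}, (𝒯.lossAt θ S : ℝ≥0∞)

/-- `L(S)`: the least empirical loss. -/
def minLoss [NeZero d] {n : ℕ} (S : Dataset n 𝒵) : ℝ≥0∞ := 𝒯.constrainedLoss Set.univ S

/-- `θ` is a minimizer of the empirical loss over `Θ`. -/
def IsEmpiricalMinimizer {n : ℕ} (Z : Fin n → 𝒵) (θ : Fin d → ℝ) : Prop :=
  θ ∈ 𝒯.Θ ∧ ∀ θ' ∈ 𝒯.Θ, 𝒯.lossAt θ (full Z) ≤ 𝒯.lossAt θ' (full Z)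

/-- `θ` is a minimizer of the population loss `𝔼_{z ∼ D} ℓ_θ(z)` over `Θ`. -/
def IsPopulationMinimizer [MeasurableSpace 𝒵] (D : Measure 𝒵) (θ : Fin d → ℝ) : Prop :=
  θ ∈ 𝒯.Θ ∧ ∀ θ' ∈ 𝒯.Θ, ∫⁻ z, (𝒯.loss θ z : ℝ≥0∞) ∂D ≤ ∫⁻ z, (𝒯.loss θ' z : ℝ≥0∞) ∂D

/-- `θhat` selects an empirical minimizer `θ(Z)` for every dataset `Z` that has one. -/
def IsArgminSelection (θhat : ∀ n : ℕ, (Fin n → 𝒵) → Fin d → ℝ) : Prop :=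
  ∀ (n : ℕ) (Z : Fin n → 𝒵),
    (∃ θ, 𝒯.IsEmpiricalMinimizer Z θ) → 𝒯.IsEmpiricalMinimizer Z (θhat n Z)

/-- Measurability of the losses and of the (constrained) least empirical losses. -/
structure IsMeasurable [NeZero d] [MeasurableSpace 𝒵] : Prop where
  loss : ∀ θ ∈ 𝒯.Θ, Measurable (𝒯.loss θ)
  constrainedLoss : ∀ (n : ℕ) (π : Set ℝ), π.OrdConnected →
    Measurable fun Z : Fin n → 𝒵 => 𝒯.constrainedLoss π (full Z)

/-- Identifiability, concentration and stability of the learning task `(Θ, ℓ, D)`, with `θhat`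
the empirical minimizer, `θD` the population minimizer, and constants `N, M, K, lam, μ, σ`.
All four clauses bound the probability of the bad event under `D^n`. -/
structure IdConcStable [NeZero d] [MeasurableSpace 𝒵] (D : Measure 𝒵)
    (θhat : ∀ n : ℕ, (Fin n → 𝒵) → Fin d → ℝ) (θD : Fin d → ℝ)
    (N : ℝ → ℝ) (M K lam μ σ : ℝ) : Prop where
  N_nonneg : ∀ α, 0 < α → 0 ≤ N α
  M_pos : 0 < M
  K_pos : 0 < K
  lam_pos : 0 < lam
  μ_pos : 0 < μ
  σ_pos : 0 < σ
  /-- concentration of the first coordinate of the minimizer -/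
  param_concentration : ∀ α β : ℝ, 0 < α → 0 < β → ∀ n : ℕ, 1 ≤ n →
    N α + K * Real.log (1 / β) / α ^ 2 ≤ n →
    Measure.pi (fun _ : Fin n => D)
      {Z | α / √μ ≤ |θhat n Z 0 - θD 0|} ≤ ENNReal.ofReal β
  /-- typical smoothness and strong convexity in the first coordinate;
  `constrainedLoss {w}` is the loss `L^(w)`, for `w` a first coordinate of some parameter -/
  smooth_convex : ∀ β : ℝ, 0 < β → ∀ n : ℕ, 1 ≤ n →
    M + K * Real.log (1 / β) ≤ n →
    Measure.pi (fun _ : Fin n => D)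
      {Z | ¬ ∀ w ∈ (fun θ : Fin d → ℝ => θ 0) '' 𝒯.Θ,
        𝒯.minLoss (full Z) + ENNReal.ofReal (μ * (w - θhat n Z 0) ^ 2 / 2)
            ≤ 𝒯.constrainedLoss {w} (full Z) ∧
        𝒯.constrainedLoss {w} (full Z)
            ≤ 𝒯.minLoss (full Z) + ENNReal.ofReal (2 * μ * (w - θhat n Z 0) ^ 2)}
      ≤ ENNReal.ofReal β
  /-- stability under the removal of one data point -/
  leave_one_out : ∀ β : ℝ, 0 < β → ∀ n : ℕ, 1 ≤ n →
    M + K * Real.log (1 / β) ≤ n → ∀ i : Fin n,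
    Measure.pi (fun _ : Fin n => D)
      {Z | lam * Real.log (2 / β) / n ≤
        |(𝒯.minLoss (full Z)).toReal - (𝒯.minLoss (remove (full Z) i)).toReal|}
      ≤ ENNReal.ofReal β
  /-- upper tail of the least empirical loss -/
  tail_bound : ∀ β : ℝ, 0 < β → ∀ n : ℕ, 1 ≤ n →
    Measure.pi (fun _ : Fin n => D)
      {Z | σ ^ 2 * (1 + Real.log (1 / β) / n) ≤ (𝒯.minLoss (full Z)).toReal}
      ≤ ENNReal.ofReal β

end Task

/-- The three intervals that are compared at threshold `t`:
`π₀ = (-t, t)`, `π₁ = [t, ∞)`, `π₋₁ = (-∞, -t]`. -/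
def region (t : ℝ) : SignType → Set ℝ
  | .zero => Set.Ioo (-t) t
  | .pos => Set.Ici t
  | .neg => Set.Iic (-t)

/-! ### Randomized real-RAM programs with query access to the loss, and their running time -/

/-- Arithmetic expressions over a memory of real-valued cells. -/
inductive Expr where
  | const (q : ℚ)
  /-- the content of the cell whose address is given by the argument -/
  | load (a : Expr)
  | add (a b : Expr)
  | sub (a b : Expr)
  | mul (a b : Expr)
  | div (a b : Expr)
  | exp (a : Expr)
  | log (a : Expr)

namespace Expr

/-- The value of an expression; the address meant by a real number is its integer part. -/
def eval (mem : ℕ → ℝ) : Expr → ℝ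
  | const q => q
  | load a => mem ⌊a.eval mem⌋₊
  | add a b => a.eval mem + b.eval mem
  | sub a b => a.eval mem - b.eval mem
  | mul a b => a.eval mem * b.eval mem
  | div a b => a.eval mem / b.eval mem
  | exp a => Real.exp (a.eval mem)
  | log a => Real.log (a.eval mem)

/-- The time to evaluate an expression: one unit per constant, memory access and operation. -/
def cost : Expr → ℕ
  | const _ => 1
  | load a => a.cost + 1
  | add a b => a.cost + b.cost + 1
  | sub a b => a.cost + b.cost + 1
  | mul a b => a.cost + b.cost + 1
  | div a b => a.cost + b.cost + 1
  | exp a => a.cost + 1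
  | log a => a.cost + 1

end Expr

/-- Programs. The dataset is accessible only through a register that holds a subsample of it, and
this register only through loss queries. -/
inductive Cmd where
  /-- `mem[a] ← e` -/
  | assign (a e : Expr)
  /-- `mem[a] ←` a fresh uniform sample from `[0,1]` -/
  | draw (a : Expr)
  /-- the subsample register receives a fresh subsample of the dataset, in which each entry is
  kept independently with probability `p` -/
  | subsample (p : Expr)
  /-- `mem[a] ← min {L^(π)(S), b}`, with `S` the subsample register and `π` the `j`-th region at
  threshold `t` -/
  | query (j : SignType) (a t b : Expr)
  | seq (c₁ c₂ : Cmd)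
  /-- if `a < b` then `c₁` else `c₂` -/
  | ite (a b : Expr) (c₁ c₂ : Cmd)
  /-- while `a < b` do `c` -/
  | loop (a b : Expr) (c : Cmd)

/-- The random bits of a run: uniform reals for the `draw` instructions, and one uniform real per
data point for each `subsample` instruction. -/
abbrev Tape (n : ℕ) : Type := (ℕ → unitInterval) × (ℕ → Fin n → unitInterval)

/-- All entries of the tape are independent and uniform on `[0,1]`. -/
def tapeMeasure (n : ℕ) : Measure (Tape n) :=
  (Measure.infinitePi fun _ : ℕ => (volume : Measure unitInterval)).prod
    (Measure.infinitePi fun _ : ℕ => Measure.pi fun _ : Fin n => (volume : Measure unitInterval))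

/-- What a run depends on besides the program: the dataset, the loss oracle and the random tape. -/
structure Env (n : ℕ) (𝒵 : Type*) where
  data : Fin n → 𝒵
  oracle : SignType → ℝ → Dataset n 𝒵 → ℝ≥0∞
  tape : Tape n

/-- The state of a run. -/
structure State (n : ℕ) (𝒵 : Type*) where
  mem : ℕ → ℝ
  sub : Dataset n 𝒵
  /-- number of `draw` instructions executed so far -/
  draws : ℕ
  /-- number of `subsample` instructions executed so far -/
  samples : ℕ

open Classical in
/-- The subsample that keeps the `i`-th entry if and only if `u i < p`. -/
def thin {n : ℕ} {𝒵 : Type*} (Z : Fin n → 𝒵) (p : ℝ) (u : Fin n → unitInterval) : Dataset n 𝒵 :=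
  fun i => if (u i : ℝ) < p then some (Z i) else none

/-- `Exec env c s T s'`: started in state `s`, the program `c` halts in state `s'` after `T` units
of time. Drawing a subsample, a loss query, a random draw and an assignment take one unit each,
besides the evaluation of the expressions that occur in them. -/
inductive Exec {n : ℕ} {𝒵 : Type*} (env : Env n 𝒵) :
    Cmd → State n 𝒵 → ℕ → State n 𝒵 → Prop where
  | assign (a e : Expr) (s : State n 𝒵) :
      Exec env (.assign a e) s (a.cost + e.cost + 1)
        { s with mem := Function.update s.mem ⌊a.eval s.mem⌋₊ (e.eval s.mem) }
  | draw (a : Expr) (s : State n 𝒵) :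
      Exec env (.draw a) s (a.cost + 1)
        { s with
          mem := Function.update s.mem ⌊a.eval s.mem⌋₊ (env.tape.1 s.draws : ℝ)
          draws := s.draws + 1 }
  | subsample (p : Expr) (s : State n 𝒵) :
      Exec env (.subsample p) s (p.cost + 1)
        { s with
          sub := thin env.data (p.eval s.mem) (env.tape.2 s.samples)
          samples := s.samples + 1 }
  | query (j : SignType) (a t b : Expr) (s : State n 𝒵) :
      Exec env (.query j a t b) s (a.cost + t.cost + b.cost + 1)
        { s with
          mem := Function.update s.mem ⌊a.eval s.mem⌋₊
            (min (env.oracle j (t.eval s.mem) s.sub) (ENNReal.ofReal (b.eval s.mem))).toReal }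
  | seq {c₁ c₂ : Cmd} {s s₁ s₂ : State n 𝒵} {T₁ T₂ : ℕ} :
      Exec env c₁ s T₁ s₁ → Exec env c₂ s₁ T₂ s₂ → Exec env (.seq c₁ c₂) s (T₁ + T₂) s₂
  | ite_true {a b : Expr} {c₁ c₂ : Cmd} {s s' : State n 𝒵} {T : ℕ} :
      a.eval s.mem < b.eval s.mem → Exec env c₁ s T s' →
      Exec env (.ite a b c₁ c₂) s (a.cost + b.cost + 1 + T) s'
  | ite_false {a b : Expr} {c₁ c₂ : Cmd} {s s' : State n 𝒵} {T : ℕ} :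
      ¬ a.eval s.mem < b.eval s.mem → Exec env c₂ s T s' →
      Exec env (.ite a b c₁ c₂) s (a.cost + b.cost + 1 + T) s'
  | loop_true {a b : Expr} {c : Cmd} {s s₁ s₂ : State n 𝒵} {T₁ T₂ : ℕ} :
      a.eval s.mem < b.eval s.mem → Exec env c s T₁ s₁ → Exec env (.loop a b c) s₁ T₂ s₂ →
      Exec env (.loop a b c) s (a.cost + b.cost + 1 + T₁ + T₂) s₂
  | loop_false {a b : Expr} {c : Cmd} {s : State n 𝒵} :
      ¬ a.eval s.mem < b.eval s.mem →
      Exec env (.loop a b c) s (a.cost + b.cost + 1) s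

/-- The numerical inputs of the mechanism. -/
structure Params where
  ε : ℝ
  δ : ℝ
  ρ : ℝ
  t : ℝ
  α : ℝ
  p : ℝ

/-- The admissible inputs. -/
structure Params.Valid (P : Params) : Prop where
  ε_pos : 0 < P.ε
  δ_pos : 0 < P.δ
  δ_lt_one : P.δ < 1
  ρ_pos : 0 < P.ρ
  t_pos : 0 < P.t
  α_pos : 0 < P.α
  p_pos : 0 < P.p
  p_lt : P.p < 1 / 4

/-- The initial memory: the six numerical inputs in cells `0, …, 5`, and `0` elsewhere. -/
def Params.mem (P : Params) : ℕ → ℝ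
  | 0 => P.ε
  | 1 => P.δ
  | 2 => P.ρ
  | 3 => P.t
  | 4 => P.α
  | 5 => P.p
  | _ => 0

/-- The environment of a run on dataset `Z` with query access to the losses of `𝒯`. -/
def Task.env {d n : ℕ} [NeZero d] {𝒵 : Type*} (𝒯 : Task d 𝒵) (Z : Fin n → 𝒵) (r : Tape n) :
    Env n 𝒵 where
  data := Z
  oracle := fun j t S => 𝒯.constrainedLoss (region t j) S
  tape := r

/-- The state in which a run starts. -/
def startState {n : ℕ} {𝒵 : Type*} (P : Params) (Z : Fin n → 𝒵) : State n 𝒵 where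
  mem := P.mem
  sub := full Z
  draws := 0
  samples := 0

section Mechanism

variable {d n : ℕ} [NeZero d] {𝒵 : Type*}

/-- On dataset `Z`, inputs `P` and random tape `r`, the mechanism halts within `T` time units. -/
def HaltsWithin (c : Cmd) (𝒯 : Task d 𝒵) (P : Params) (Z : Fin n → 𝒵) (r : Tape n) (T : ℝ) :
    Prop :=
  ∃ (T' : ℕ) (s : State n 𝒵), Exec (𝒯.env Z r) c (startState P Z) T' s ∧ (T' : ℝ) ≤ T

/-- On dataset `Z`, inputs `P` and random tape `r`, the mechanism halts with output `y`: the
output is read off as the sign of cell `0`. -/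
def Outputs (c : Cmd) (𝒯 : Task d 𝒵) (P : Params) (Z : Fin n → 𝒵) (r : Tape n) (y : SignType) :
    Prop :=
  ∃ (T' : ℕ) (s : State n 𝒵),
    Exec (𝒯.env Z r) c (startState P Z) T' s ∧ SignType.sign (s.mem 0) = y

/-- The probability, over the random tape, that the output on dataset `Z` lies in `E`. -/
def outputProb (c : Cmd) (𝒯 : Task d 𝒵) (P : Params) (Z : Fin n → 𝒵) (E : Set SignType) : ℝ≥0∞ :=
  tapeMeasure n {r | ∃ y ∈ E, Outputs c 𝒯 P Z r y}

/-- `(ε, δ)`-differential privacy on datasets of size `n`. -/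
def IsDP (n : ℕ) (c : Cmd) (𝒯 : Task d 𝒵) (P : Params) : Prop :=
  ∀ Z Z' : Fin n → 𝒵, Neighbors Z Z' → ∀ E : Set SignType,
    outputProb c 𝒯 P Z E ≤
      ENNReal.ofReal (Real.exp P.ε) * outputProb c 𝒯 P Z' E + ENNReal.ofReal P.δ

/-- The probability, over a dataset of `n` independent samples from `D` and the random tape, that
the mechanism fails to output `y`. -/
def errorProb [MeasurableSpace 𝒵] (n : ℕ) (c : Cmd) (𝒯 : Task d 𝒵) (P : Params) (D : Measure 𝒵)
    (y : SignType) : ℝ≥0∞ :=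
  ((Measure.pi fun _ : Fin n => D).prod (tapeMeasure n)) {x | ¬ Outputs c 𝒯 P x.1 x.2 y}

end Mechanism

end ParamTest

end

/-! The mechanism draws `N` subsamples and records for each the clipped least loss over the three
regions. A region is certified when some recorded value `v` of its own satisfies two conditions: at
least `hi` of its recorded losses are at most `v`, while each other region has at most `lo` such
losses. Here `hi = r₀ exp(2c + x)` and `lo = r₀ exp(2c - x)`, where `r₀` is `floorCount`, `c` is
`center`, and `x` is logistic noise of scale `4p/ε` around `c`. The answer is the sign of a
certified outer region, and `0` by default. If `δ ≥ 2/3`, a uniformly random answer, which uses no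
data, is good enough.

Privacy. Let `Z`, `Z'` differ at `i`, and let `b` be the losses recorded after deleting the `i`-th
point from every subsample. Losses are nonnegative, so `b` lies below both records, and it agrees
with each of them on the subsamples not hit by `i`. The bits that decide which subsamples are hit
are independent of `b`. Conditionally on `b`, Chernoff shows that every level set of `b` of size at
least `r₀` has at most a fraction `2p` of hit subsamples (`measure_dense_le`,
`measure_sparseBits_compl`). Passing from one record to the other therefore changes the relevant
counts by a factor of at most `1 - 2p ≥ exp(-4p)`, which lowering `x` by `4p` compensates: a nonzero
verdict for `Z` at `x` is the verdict for `Z'` at `x - 4p` (`Wins.transfer`, `verdictAt_transfer`).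
Shifting logistic noise by `4p` multiplies the odds of the underlying uniform variable by `exp ε`,
which distorts volume by at most `exp ε` (`volume_le_of_oddsShift`). Extreme noise and non-sparse
bits cost `δ/4` each.

Running time. The noise has to range over an interval of length of order `p + (p/ε) log(1/δ)`, so
`lo` and `hi` stay between `r₀` and `N` only if `N` is about `r₀ exp(4c)`. The program is quadratic
in `N`.

Accuracy. On a typical subsample, strong convexity puts the loss over the wrong regions above the
least loss by a margin of order `pα²` (`Task.gap_of_close`, `Task.separates_keep`). The clipped
least loss of a subsample concentrates around a constant at the same scale. This is a Bernstein-type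
bounded differences inequality that exploits that each point is kept only with probability `p` and
tolerates a small probability of large differences (`exists_truncated_martingale`,
`measure_deviation_le`). Hence one fixed level separates the true region from the others on all
subsamples at once, by a union bound, and such records force the verdict (`verdictAt_of_separated`).
The failure exponent must beat `log N`, of order `(1 + p/ε) log(n/δ)`; the variance condition then
involves the cube of this quantity, whence the term `p²/ε³`
(`Params.Valid.exists_failure_exponent`). -/

namespace ParamTest

/-! ### Total correctness of programs with time bounds -/

/-- Started in `s`, the program `c` halts within `B` time units in a state satisfying `Q`. -/
def Runs {n : ℕ} {𝒵 : Type*} (env : Env n 𝒵) (c : Cmd) (s : State n 𝒵) (B : ℕ)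
    (Q : State n 𝒵 → Prop) : Prop :=
  ∃ T s', Exec env c s T s' ∧ T ≤ B ∧ Q s'

section Semantics

variable {n : ℕ} {𝒵 : Type*} {env : Env n 𝒵}

/-- `Outputs` asserts only that some run exists. Determinism lets one exhibited run decide the
output. -/
theorem Exec.deterministic {c : Cmd} {s s₁ s₂ : State n 𝒵} {T₁ T₂ : ℕ}
    (h₁ : Exec env c s T₁ s₁) (h₂ : Exec env c s T₂ s₂) : s₁ = s₂ := by
  induction h₁ generalizing T₂ s₂ with
  | assign a e s => cases h₂; rfl
  | draw a s => cases h₂; rfl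
  | subsample p s => cases h₂; rfl
  | query j a t b s => cases h₂; rfl
  | seq _ _ ih₁ ih₂ =>
    cases h₂ with
    | seq k₁ k₂ => obtain rfl := ih₁ k₁; exact ih₂ k₂
  | ite_true h _ ih =>
    cases h₂ with
    | ite_true _ k => exact ih k
    | ite_false h' _ => exact absurd h h'
  | ite_false h _ ih =>
    cases h₂ with
    | ite_true h' _ => exact absurd h' h
    | ite_false _ k => exact ih k
  | loop_true h _ _ ih₁ ih₂ =>
    cases h₂ with
    | loop_true _ k₁ k₂ => obtain rfl := ih₁ k₁; exact ih₂ k₂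
    | loop_false h' => exact absurd h h'
  | loop_false h =>
    cases h₂ with
    | loop_true h' _ _ => exact absurd h' h
    | loop_false _ => rfl

theorem Runs.seq {c₁ c₂ : Cmd} {s : State n 𝒵} {B₁ B₂ B : ℕ} {P Q : State n 𝒵 → Prop}
    (h₁ : Runs env c₁ s B₁ P) (h₂ : ∀ s', P s' → Runs env c₂ s' B₂ Q) (hB : B₁ + B₂ ≤ B) :
    Runs env (.seq c₁ c₂) s B Q := by
  obtain ⟨T₁, s₁, e₁, l₁, p₁⟩ := h₁
  obtain ⟨T₂, s₂, e₂, l₂, p₂⟩ := h₂ s₁ p₁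
  exact ⟨_, _, .seq e₁ e₂, by omega, p₂⟩

theorem Runs.mono {c : Cmd} {s : State n 𝒵} {B B' : ℕ} {P Q : State n 𝒵 → Prop}
    (h : Runs env c s B P) (hB : B ≤ B') (hPQ : ∀ s', P s' → Q s') : Runs env c s B' Q := by
  obtain ⟨T, s', e, l, p⟩ := h
  exact ⟨T, s', e, l.trans hB, hPQ _ p⟩

theorem Runs.ite {a b : Expr} {c₁ c₂ : Cmd} {s : State n 𝒵} {B B' : ℕ} {Q : State n 𝒵 → Prop}
    (h₁ : a.eval s.mem < b.eval s.mem → Runs env c₁ s B Q)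
    (h₂ : ¬ a.eval s.mem < b.eval s.mem → Runs env c₂ s B Q)
    (hB : a.cost + b.cost + 1 + B ≤ B') : Runs env (.ite a b c₁ c₂) s B' Q := by
  by_cases h : a.eval s.mem < b.eval s.mem
  · obtain ⟨T, s', e, l, p⟩ := h₁ h
    exact ⟨_, _, .ite_true h e, by omega, p⟩
  · obtain ⟨T, s', e, l, p⟩ := h₂ h
    exact ⟨_, _, .ite_false h e, by omega, p⟩

/-- A loop with an invariant `I k` before the `k`-th of exactly `N` iterations. -/
theorem Runs.loop {a b : Expr} {c : Cmd} {B N : ℕ} (I : ℕ → State n 𝒵 → Prop)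
    (hbody : ∀ k < N, ∀ s, I k s → a.eval s.mem < b.eval s.mem ∧ Runs env c s B (I (k + 1)))
    (hend : ∀ s, I N s → ¬ a.eval s.mem < b.eval s.mem)
    {s : State n 𝒵} (hs : I 0 s) {B' : ℕ} (hB : (N + 1) * (a.cost + b.cost + 1 + B) ≤ B') :
    Runs env (.loop a b c) s B' (I N) := by
  -- Induction on the number `m` of remaining iterations; the extra unit in `m + 1` pays for the
  -- final failing test of the guard.
  suffices H : ∀ m k, k + m = N → ∀ s, I k s →
      Runs env (.loop a b c) s ((m + 1) * (a.cost + b.cost + 1 + B)) (I N) from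
    (H N 0 (by omega) s hs).mono hB fun _ h => h
  intro m
  induction m with
  | zero =>
    intro k hk s hs
    obtain rfl : k = N := by omega
    exact ⟨_, _, .loop_false (hend s hs), by omega, hs⟩
  | succ m ih =>
    intro k hk s hs
    obtain ⟨hlt, T₁, s₁, e₁, l₁, p₁⟩ := hbody k (by omega) s hs
    obtain ⟨T₂, s₂, e₂, l₂, p₂⟩ := ih (k + 1) (by omega) s₁ p₁
    refine ⟨_, _, .loop_true hlt e₁ e₂, ?_, p₂⟩
    rw [add_mul _ 1]; omega

end Semantics

/-! ### Building blocks of the mechanism -/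

/-- The content of the cell with a fixed address. -/
def cell (k : ℕ) : Expr := .load (.const k)

/-- Assign to the cell with a fixed address. -/
def put (k : ℕ) (e : Expr) : Cmd := .assign (.const k) e

@[simp] theorem eval_cell (mem : ℕ → ℝ) (k : ℕ) : (cell k).eval mem = mem k := by
  simp [cell, Expr.eval]

@[simp] theorem cost_cell (k : ℕ) : (cell k).cost = 2 := rfl

theorem runs_put {n : ℕ} {𝒵 : Type*} (env : Env n 𝒵) (k : ℕ) (e : Expr) (s : State n 𝒵) {B : ℕ}
    {Q : State n 𝒵 → Prop} (hB : e.cost + 2 ≤ B)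
    (hQ : Q { s with mem := Function.update s.mem k (e.eval s.mem) }) :
    Runs env (put k e) s B Q := by
  refine ⟨_, _, .assign _ _ s, ?_, ?_⟩
  · simp only [Expr.cost]; omega
  · simpa [Expr.eval] using hQ

/-- The position of a region in a block of three cells. -/
def slot : SignType → ℕ
  | .neg => 0
  | .zero => 1
  | .pos => 2

/-- The cell that stores the loss over region `j` of the `s`-th subsample. -/
def addr (j : SignType) (s : ℕ) : ℕ := 100 + 3 * s + slot j

theorem addr_injective {j j' : SignType} {s s' : ℕ} (h : addr j s = addr j' s') :
    j = j' ∧ s = s' := by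
  unfold addr slot at h
  cases j <;> cases j' <;> simp at h ⊢ <;> omega

theorem le_addr (j : SignType) (s : ℕ) : 100 ≤ addr j s := by unfold addr; omega

/-- An expression for the address `addr j s`, with `s` stored in cell `i`. -/
def addrExpr (j : SignType) (i : ℕ) : Expr :=
  .add (.const ((100 + slot j : ℕ) : ℚ)) (.mul (.const ((3 : ℕ) : ℚ)) (cell i))

theorem floor_addrExpr (mem : ℕ → ℝ) (j : SignType) (i s : ℕ) (h : mem i = s) :
    ⌊(addrExpr j i).eval mem⌋₊ = addr j s := by
  have : (addrExpr j i).eval mem = (addr j s : ℕ) := by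
    simp only [addrExpr, Expr.eval, eval_cell, h, addr]
    push_cast; ring
  rw [this, Nat.floor_natCast]

@[simp] theorem cost_addrExpr (j : SignType) (i : ℕ) : (addrExpr j i).cost = 6 := rfl

/-- The number of the first `N` values that are at most `v`. -/
noncomputable def countLE (N : ℕ) (b : ℕ → ℝ) (v : ℝ) : ℕ := by
  classical exact ((Finset.range N).filter fun s => b s ≤ v).card

theorem countLE_succ (N : ℕ) (b : ℕ → ℝ) (v : ℝ) :
    countLE (N + 1) b v = countLE N b v + if b N ≤ v then 1 else 0 := by
  classical
  unfold countLE
  rw [Finset.range_add_one, Finset.filter_insert]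
  split_ifs with h
  · rw [Finset.card_insert_of_notMem (by simp)]
  · simp

@[simp] theorem countLE_zero (b : ℕ → ℝ) (v : ℝ) : countLE 0 b v = 0 := by simp [countLE]

/-- Count into cell `dst` how many stored losses over region `j` are at most the value in cell 16. -/
def countCmd (j : SignType) (dst : ℕ) : Cmd :=
  .seq (put dst (.const 0)) <| .seq (put 20 (.const 0)) <|
    .loop (cell 20) (cell 10) <|
      -- Programs can test only strict inequalities, so `≤` is the false branch; the write to cell
      -- `21` is a no-op filling the true branch.
      .seq (.ite (cell 16) (.load (addrExpr j 20)) (put 21 (.const 0))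
        (put dst (.add (cell dst) (.const 1))))
      (put 20 (.add (cell 20) (.const 1)))

/-- Loop guards compare an integer counter with the real budget in cell `10`. The loop thus runs
exactly `⌈T⌉₊` times without the program ever computing a ceiling. -/
theorem lt_of_lt_ceil {T : ℝ} {N k : ℕ} (hN : N = ⌈T⌉₊) (hk : k < N) : (k : ℝ) < T := by
  subst hN; exact Nat.lt_ceil.1 hk

theorem not_lt_ceil {T : ℝ} {N : ℕ} (hN : N = ⌈T⌉₊) : ¬ (N : ℝ) < T := by
  subst hN; exact not_lt.2 (Nat.le_ceil T)

/-- Two memories agree except possibly at the scratch cells in `A`. -/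
def AgreeOff (A : Finset ℕ) (m m' : ℕ → ℝ) : Prop := ∀ k ∉ A, m' k = m k

theorem runs_countCmd {n : ℕ} {𝒵 : Type*} (env : Env n 𝒵) (j : SignType) (dst : ℕ)
    (hdst : 17 ≤ dst ∧ dst < 20) (s : State n 𝒵) {N : ℕ} (b : ℕ → ℝ) (hN : N = ⌈s.mem 10⌉₊)
    (hb : ∀ i < N, s.mem (addr j i) = b i) :
    Runs env (countCmd j dst) s (40 * (N + 1)) fun s' =>
      s'.mem dst = countLE N b (s.mem 16) ∧ AgreeOff {dst, 20, 21} s.mem s'.mem := by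
  have h1 : dst ≠ 20 := by omega
  have h2 : dst ≠ 21 := by omega
  have h3 : dst ≠ 16 := by omega
  have h4 : dst ≠ 10 := by omega
  have ha : ∀ i, addr j i ≠ dst ∧ addr j i ≠ 20 ∧ addr j i ≠ 21 := fun i => by
    have := le_addr j i; omega
  refine Runs.seq (runs_put (B := 3) _ _ _ _ (by simp [Expr.cost])
    (Q := fun s₁ => s₁.mem dst = 0 ∧ AgreeOff {dst, 20, 21} s.mem s₁.mem) ?_)
    (B₂ := 3 + 29 * (N + 1)) ?_ (by omega)
  · refine ⟨by simp [Expr.eval], fun k hk => ?_⟩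
    simp only [Finset.mem_insert, Finset.mem_singleton, not_or] at hk
    simp [hk.1]
  rintro s₁ ⟨hd, hs₁⟩
  refine Runs.seq (runs_put (B := 3) _ _ _ _ (by simp [Expr.cost])
    (Q := fun s₁ => s₁.mem dst = 0 ∧ s₁.mem 20 = 0 ∧ AgreeOff {dst, 20, 21} s.mem s₁.mem) ?_)
    (B₂ := 29 * (N + 1)) ?_ (by omega)
  · refine ⟨by simp [h1, hd], by simp [Expr.eval], fun k hk => ?_⟩
    have := hs₁ k hk
    simp only [Finset.mem_insert, Finset.mem_singleton, not_or] at hk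
    simp [hk, this]
  rintro s₂ ⟨hd2, h20, hs₂⟩
  refine (Runs.loop (N := N) (B := 24) (fun k s' => s'.mem dst = countLE k b (s.mem 16) ∧
    s'.mem 20 = k ∧ AgreeOff {dst, 20, 21} s.mem s'.mem) ?_ ?_ ?_ (B' := 29 * (N + 1)) ?_).mono
      le_rfl fun s' h => ⟨h.1, h.2.2⟩
  · rintro k hk s' ⟨hc, hk20, hag⟩
    have e10 : s'.mem 10 = s.mem 10 := hag 10 (by simp; omega)
    have e16 : s'.mem 16 = s.mem 16 := hag 16 (by simp; omega)
    have ea : s'.mem (addr j k) = b k := by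
      rw [hag _ (by simpa using ha k), hb k hk]
    refine ⟨by simpa [hk20, e10] using lt_of_lt_ceil hN hk, ?_⟩
    refine Runs.seq (B₁ := 17) (P := fun s' => s'.mem dst = countLE (k + 1) b (s.mem 16) ∧
      s'.mem 20 = k ∧ AgreeOff {dst, 20, 21} s.mem s'.mem) ?_ (B₂ := 6) ?_ (by omega)
    · have hev : (Expr.load (addrExpr j 20)).eval s'.mem = b k := by
        rw [Expr.eval, floor_addrExpr _ _ _ _ hk20, ea]
      refine Runs.ite (B := 6) (fun h => ?_) (fun h => ?_) (by simp [Expr.cost])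
      · rw [hev, eval_cell, e16] at h
        refine runs_put _ _ _ _ (by simp [Expr.cost]) ⟨?_, ?_, fun i hi => ?_⟩
        · simp [h2, hc, countLE_succ, not_le.2 h]
        · simp [hk20]
        · have := hag i hi
          simp only [Finset.mem_insert, Finset.mem_singleton, not_or] at hi
          simp [hi, this]
      · rw [hev, eval_cell, e16] at h
        refine runs_put _ _ _ _ (by simp [Expr.cost]) ⟨?_, ?_, fun i hi => ?_⟩
        · simp [hc, countLE_succ, not_lt.1 h, Expr.eval]
        · simp [h1.symm, hk20]
        · have := hag i hi
          simp only [Finset.mem_insert, Finset.mem_singleton, not_or] at hi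
          simp [hi, this]
    · rintro s'' ⟨hc, hk20, hag⟩
      refine runs_put _ _ _ _ (by simp [Expr.cost]) ⟨?_, ?_, fun i hi => ?_⟩
      · simp [h1, hc]
      · simp [hk20, Expr.eval]
      · have := hag i hi
        simp only [Finset.mem_insert, Finset.mem_singleton, not_or] at hi
        simp [hi, this]
  · rintro s' ⟨-, hk20, hag⟩
    have e10 : s'.mem 10 = s.mem 10 := hag 10 (by simp; omega)
    simpa [hk20, e10] using not_lt_ceil hN
  · exact ⟨by simp [hd2], by simp [h20], hs₂⟩
  · simp [mul_comm]

/-- The `s`-th of the first `N` subsamples certifies region `j` against `j₁` and `j₂`. -/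
def Certifies (N : ℕ) (a : SignType → ℕ → ℝ) (hi lo : ℝ) (j j₁ j₂ : SignType) (s : ℕ) : Prop :=
  hi ≤ countLE N (a j) (a j s) ∧ (countLE N (a j₁) (a j s) : ℝ) ≤ lo ∧
    (countLE N (a j₂) (a j s) : ℝ) ≤ lo

/-- Set cell `0` to `q` if some subsample certifies region `j`. -/
def passCmd (j j₁ j₂ : SignType) (q : ℚ) : Cmd :=
  .seq (put 15 (.const 0)) <| .loop (cell 15) (cell 10) <|
    .seq (put 16 (.load (addrExpr j 15))) <|
    .seq (countCmd j 17) <| .seq (countCmd j₁ 18) <| .seq (countCmd j₂ 19) <|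
    .seq (.ite (cell 17) (cell 12) (put 21 (.const 0)) <|
      .ite (cell 13) (cell 18) (put 21 (.const 0)) <|
      .ite (cell 13) (cell 19) (put 21 (.const 0)) (put 0 (.const q))) <|
    put 15 (.add (cell 15) (.const 1))

theorem AgreeOff.trans {A B C : Finset ℕ} {m m' m'' : ℕ → ℝ} (h : AgreeOff A m m')
    (h' : AgreeOff B m' m'') (hA : A ⊆ C) (hB : B ⊆ C) : AgreeOff C m m'' := fun k hk => by
  rw [h' k fun x => hk (hB x), h k fun x => hk (hA x)]

theorem agreeOff_update (m : ℕ → ℝ) (k : ℕ) (v : ℝ) : AgreeOff {k} m (Function.update m k v) :=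
  fun i hi => by simp only [Finset.mem_singleton] at hi; simp [hi]

open Classical in
theorem runs_passCmd {n : ℕ} {𝒵 : Type*} (env : Env n 𝒵) (j j₁ j₂ : SignType) (q : ℚ)
    (s : State n 𝒵) {N : ℕ} (a : SignType → ℕ → ℝ) (hN : N = ⌈s.mem 10⌉₊)
    (hb : ∀ j, ∀ i < N, s.mem (addr j i) = a j i) :
    Runs env (passCmd j j₁ j₂ q) s (400 * (N + 1) ^ 2) fun s' =>
      s'.mem 0 = (if ∃ i < N, Certifies N a (s.mem 12) (s.mem 13) j j₁ j₂ i then (q : ℝ)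
        else s.mem 0) ∧ AgreeOff {0, 15, 16, 17, 18, 19, 20, 21} s.mem s'.mem := by
  set A : Finset ℕ := {0, 15, 16, 17, 18, 19, 20, 21} with hA
  have hoff : ∀ j i, addr j i ∉ A := fun j i => by
    have := le_addr j i
    simp only [hA, Finset.mem_insert, Finset.mem_singleton]; omega
  refine Runs.seq (runs_put (B := 3) _ _ _ _ (by simp [Expr.cost])
    (Q := fun s₁ => s₁.mem 15 = 0 ∧ s₁.mem 0 = s.mem 0 ∧ AgreeOff A s.mem s₁.mem) ?_)
    (B₂ := (N + 1) * (5 + (34 + 120 * (N + 1)))) ?_ (by nlinarith)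
  · exact ⟨by simp [Expr.eval], by simp, fun k hk => by
      simp only [hA, Finset.mem_insert, Finset.mem_singleton, not_or] at hk; simp [hk]⟩
  rintro s₁ ⟨h15, h0, hs₁⟩
  refine (Runs.loop (N := N) (B := 34 + 120 * (N + 1)) (fun k s' => s'.mem 15 = k ∧
    s'.mem 0 = (if ∃ i < k, Certifies N a (s.mem 12) (s.mem 13) j j₁ j₂ i then (q : ℝ)
        else s.mem 0) ∧ AgreeOff A s.mem s'.mem) ?_ ?_ ?_
      (B' := (N + 1) * (5 + (34 + 120 * (N + 1)))) ?_).mono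
      le_rfl fun s' h => h.2
  · rintro k hk s' ⟨hk15, hk0, hag⟩
    refine ⟨by rw [eval_cell, eval_cell, hk15, hag 10 (by simp [hA])]; exact lt_of_lt_ceil hN hk, ?_⟩
    refine Runs.seq (B₁ := 10) (P := fun t => t.mem 16 = a j k ∧ AgreeOff {16} s'.mem t.mem)
      (runs_put _ _ _ _ (by simp [Expr.cost]) ⟨?_, agreeOff_update _ _ _⟩)
      (B₂ := 24 + 120 * (N + 1)) ?_ (by omega)
    · simp [Expr.eval, floor_addrExpr _ _ _ _ hk15, hag _ (hoff j k), hb j k hk]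
    rintro t ⟨ht16, ht⟩
    have count : ∀ (j' : SignType) (dst : ℕ), 17 ≤ dst ∧ dst < 20 → ∀ r : State n 𝒵,
        r.mem 16 = a j k → AgreeOff A s.mem r.mem →
        Runs env (countCmd j' dst) r (40 * (N + 1)) fun r' =>
          r'.mem dst = countLE N (a j') (a j k) ∧ AgreeOff {dst, 20, 21} r.mem r'.mem := by
      intro j' dst hdst r hr hAr
      have := runs_countCmd env j' dst hdst r (a j') (N := N) (by rw [hAr 10 (by simp [hA]), hN])
        (fun i hi => by rw [hAr _ (hoff j' i), hb j' i hi])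
      rwa [hr] at this
    have hAt : AgreeOff A s.mem t.mem := hag.trans ht (by simp) (by simp [hA])
    refine Runs.seq (count j 17 (by simp) t ht16 hAt) (B₂ := 24 + 80 * (N + 1)) ?_ (by omega)
    rintro t₁ ⟨ht17, ht₁⟩
    have hA₁ : AgreeOff A s.mem t₁.mem := hAt.trans ht₁ (by simp) (by rw [hA]; decide)
    have h16₁ : t₁.mem 16 = a j k := by rw [ht₁ 16 (by simp), ht16]
    refine Runs.seq (count j₁ 18 (by simp) t₁ h16₁ hA₁) (B₂ := 24 + 40 * (N + 1)) ?_ (by omega)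
    rintro t₂ ⟨ht18, ht₂⟩
    have hA₂ : AgreeOff A s.mem t₂.mem := hA₁.trans ht₂ (by simp) (by rw [hA]; decide)
    have h16₂ : t₂.mem 16 = a j k := by rw [ht₂ 16 (by simp), h16₁]
    refine Runs.seq (count j₂ 19 (by simp) t₂ h16₂ hA₂) (B₂ := 24) ?_ (by omega)
    rintro t₃ ⟨ht19, ht₃⟩
    have hA₃ : AgreeOff A s.mem t₃.mem := hA₂.trans ht₃ (by simp) (by rw [hA]; decide)
    have h17 : t₃.mem 17 = countLE N (a j) (a j k) := by
      rw [ht₃ 17 (by simp), ht₂ 17 (by simp), ht17]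
    have h18 : t₃.mem 18 = countLE N (a j₁) (a j k) := by rw [ht₃ 18 (by simp), ht18]
    have h12 : t₃.mem 12 = s.mem 12 := hA₃ 12 (by simp [hA])
    have h13 : t₃.mem 13 = s.mem 13 := hA₃ 13 (by simp [hA])
    have h15₃ : t₃.mem 15 = k := by
      rw [ht₃ 15 (by simp), ht₂ 15 (by simp), ht₁ 15 (by simp), ht 15 (by simp), hk15]
    have h0₃ : t₃.mem 0 = (if ∃ i < k, Certifies N a (s.mem 12) (s.mem 13) j j₁ j₂ i then (q : ℝ)
        else s.mem 0) := by
      rw [ht₃ 0 (by simp), ht₂ 0 (by simp), ht₁ 0 (by simp), ht 0 (by simp), hk0]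
    have hex : (∃ i < k + 1, Certifies N a (s.mem 12) (s.mem 13) j j₁ j₂ i) ↔
        (∃ i < k, Certifies N a (s.mem 12) (s.mem 13) j j₁ j₂ i) ∨
          Certifies N a (s.mem 12) (s.mem 13) j j₁ j₂ k := by
      simp only [Nat.lt_succ_iff_lt_or_eq, or_and_right, exists_or, exists_eq_left]
    refine Runs.seq (B₁ := 18) (P := fun r => r.mem 15 = k ∧
      r.mem 0 = (if ∃ i < k + 1, Certifies N a (s.mem 12) (s.mem 13) j j₁ j₂ i then (q : ℝ)
        else s.mem 0) ∧ AgreeOff A s.mem r.mem) ?_ (B₂ := 6) ?_ (by omega)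
    · have skip : ¬ Certifies N a (s.mem 12) (s.mem 13) j j₁ j₂ k → ∀ B, 3 ≤ B →
          Runs env (put 21 (.const 0)) t₃ B fun r => r.mem 15 = k ∧
          r.mem 0 = (if ∃ i < k + 1, Certifies N a (s.mem 12) (s.mem 13) j j₁ j₂ i then (q : ℝ)
            else s.mem 0) ∧ AgreeOff A s.mem r.mem := by
        intro hc B hB
        refine runs_put _ _ _ _ (by simpa [Expr.cost] using hB) ⟨by simp [h15₃], ?_,
          hA₃.trans (agreeOff_update _ _ _) (by simp) (by simp [hA])⟩
        simp only [hex, hc, or_false]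
        simpa using h0₃
      refine Runs.ite (B := 13) (fun h => skip (fun hc => ?_) _ (by simp)) (fun g₁ => ?_) (by simp)
      · rw [eval_cell, eval_cell, h17, h12] at h
        exact absurd hc.1 (not_le.2 h)
      refine Runs.ite (B := 8) (fun h => skip (fun hc => ?_) _ (by simp)) (fun g₂ => ?_) (by simp)
      · rw [eval_cell, eval_cell, h18, h13] at h
        exact absurd hc.2.1 (not_le.2 h)
      refine Runs.ite (B := 3) (fun h => skip (fun hc => ?_) _ (by simp)) (fun g₃ => ?_) (by simp)
      · rw [eval_cell, eval_cell, ht19, h13] at h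
        exact absurd hc.2.2 (not_le.2 h)
      have hc : Certifies N a (s.mem 12) (s.mem 13) j j₁ j₂ k := by
        simp only [eval_cell, h17, h18, ht19, h12, h13, not_lt] at g₁ g₂ g₃
        exact ⟨g₁, g₂, g₃⟩
      refine runs_put _ _ _ _ (by simp [Expr.cost]) ⟨by simp [h15₃], ?_,
          hA₃.trans (agreeOff_update _ _ _) (by simp) (by simp [hA])⟩
      rw [if_pos (hex.2 (Or.inr hc))]; simp [Expr.eval]
    · rintro r ⟨r15, r0, rA⟩
      refine runs_put _ _ _ _ (by simp [Expr.cost]) ⟨?_, ?_,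
        rA.trans (agreeOff_update _ _ _) (by simp) (by simp [hA])⟩
      · simp [r15, Expr.eval]
      · simpa using r0
  · rintro s' ⟨hk15, -, hag⟩
    rw [eval_cell, eval_cell, hk15, hag 10 (by simp [hA])]
    exact not_lt_ceil hN
  · exact ⟨by simp [h15], by simp [h0], hs₁⟩
  · simp

end ParamTest

namespace ParamTest

/-! ### The mechanism -/

namespace Params

variable (P : Params)

/-- The centre of the logistic noise on the logarithmic threshold. -/
noncomputable def center : ℝ := 8 * P.p + 4 * P.p / P.ε * Real.log (8 / P.δ)

/-- The logarithmic accuracy that the smallest relevant count has to support. -/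
noncomputable def depth : ℝ := 4 * P.center + Real.log (24 / P.δ)

/-- The smallest relevant count. -/
noncomputable def floorCount : ℝ := (10 * P.depth / P.p) * (10 * P.depth / P.p)

/-- The (real) number of subsamples. -/
noncomputable def budget : ℝ := P.floorCount * Real.exp (4 * P.center)

/-- The number of subsamples. -/
noncomputable def numSamples : ℕ := ⌈P.budget⌉₊

/-- The noisy logarithmic threshold obtained from a uniform variable `u`. -/
noncomputable def noise (u : ℝ) : ℝ := P.center + 4 * P.p / P.ε * Real.log (u / (1 - u))

/-- The upper count threshold at noise level `x`. -/
noncomputable def hi (x : ℝ) : ℝ := P.floorCount * Real.exp (2 * P.center + x)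

/-- The lower count threshold at noise level `x`. -/
noncomputable def lo (x : ℝ) : ℝ := P.floorCount * Real.exp (2 * P.center - x)

end Params

/-- Compute the parameters and draw the noise. -/
def setupCmd : Cmd :=
  -- Memory layout: cell 6 the uniform variable, 7 the centre, 8 the depth, 9 the floor count, 10
  -- the budget, 11 the noise, 12 and 13 the thresholds `hi` and `lo`.
  .seq (.draw (.const (6 : ℕ))) <|
  .seq (put 7 (.add (.mul (.const 8) (cell 5))
    (.mul (.div (.mul (.const 4) (cell 5)) (cell 0)) (.log (.div (.const 8) (cell 1)))))) <|
  .seq (put 8 (.add (.mul (.const 4) (cell 7)) (.log (.div (.const 24) (cell 1))))) <|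
  .seq (put 9 (.mul (.div (.mul (.const 10) (cell 8)) (cell 5))
    (.div (.mul (.const 10) (cell 8)) (cell 5)))) <|
  .seq (put 10 (.mul (cell 9) (.exp (.mul (.const 4) (cell 7))))) <|
  .seq (put 11 (.add (cell 7) (.mul (.div (.mul (.const 4) (cell 5)) (cell 0))
    (.log (.div (cell 6) (.sub (.const 1) (cell 6))))))) <|
  .seq (put 12 (.mul (cell 9) (.exp (.add (.mul (.const 2) (cell 7)) (cell 11))))) <|
  put 13 (.mul (cell 9) (.exp (.sub (.mul (.const 2) (cell 7)) (cell 11))))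

/-- Draw the subsamples and store their losses over the three regions. -/
def sampleCmd : Cmd :=
  .seq (put 14 (.const 0)) <| .loop (cell 14) (cell 10) <|
    .seq (.subsample (cell 5)) <|
    .seq (.query .neg (addrExpr .neg 14) (cell 3) (cell 2)) <|
    .seq (.query .zero (addrExpr .zero 14) (cell 3) (cell 2)) <|
    .seq (.query .pos (addrExpr .pos 14) (cell 3) (cell 2)) <|
    put 14 (.add (cell 14) (.const 1))

/-- Output a uniformly random answer. -/
def coinCmd : Cmd :=
  .seq (.draw (.const (6 : ℕ))) <|
    .ite (cell 6) (.const (1 / 3)) (put 0 (.const (-1))) <|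
      .ite (cell 6) (.const (2 / 3)) (put 0 (.const 0)) (put 0 (.const 1))

/-- The mechanism. -/
def mechanism : Cmd :=
  -- For `δ ≥ 2/3` a uniform guess errs with probability at most `2/3 ≤ δ`. Excluding this case
  -- keeps `log(1/δ)` away from `0`, without which the running time bound could not absorb terms
  -- such as `exp((p/ε) log 8)`.
  .ite (cell 1) (.const (2 / 3))
    (.seq setupCmd <| .seq sampleCmd <| .seq (put 0 (.const 0)) <|
      .seq (passCmd .neg .zero .pos (-1)) (passCmd .pos .zero .neg 1))
    coinCmd

open Classical in
/-- The answer from the recorded losses `a` at the given count thresholds. -/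
noncomputable def verdict (N : ℕ) (a : SignType → ℕ → ℝ) (hi lo : ℝ) : SignType :=
  if ∃ i < N, Certifies N a hi lo .pos .zero .neg i then 1
  else if ∃ i < N, Certifies N a hi lo .neg .zero .pos i then -1 else 0

open Classical in
/-- The uniformly random answer. -/
noncomputable def coin (u : ℝ) : SignType := if u < 1 / 3 then -1 else if u < 2 / 3 then 0 else 1

/-- The clipped loss of a dataset over the `j`-th region. -/
noncomputable def Task.clipped {d n : ℕ} [NeZero d] {𝒵 : Type*} (𝒯 : Task d 𝒵) (P : Params)
    (j : SignType) (S : Dataset n 𝒵) : ℝ :=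
  (min (𝒯.constrainedLoss (region P.t j) S) (ENNReal.ofReal P.ρ)).toReal

/-- The answer of the main branch on given subsamples and a given uniform variable. -/
noncomputable def Task.answer {d n : ℕ} [NeZero d] {𝒵 : Type*} (𝒯 : Task d 𝒵) (P : Params)
    (S : ℕ → Dataset n 𝒵) (u : ℝ) : SignType :=
  verdict P.numSamples (fun j i => 𝒯.clipped P j (S i)) (P.hi (P.noise u)) (P.lo (P.noise u))

open Classical in
/-- The output of the mechanism. -/
noncomputable def Task.output {d n : ℕ} [NeZero d] {𝒵 : Type*} (𝒯 : Task d 𝒵) (P : Params)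
    (Z : Fin n → 𝒵) (r : Tape n) : SignType :=
  if P.δ < 2 / 3 then 𝒯.answer P (fun i => thin Z P.p (r.2 i)) (r.1 0) else coin (r.1 0)

/-! ### Symbolic execution of the mechanism. -/

section Run

variable {n : ℕ} {𝒵 : Type*} {env : Env n 𝒵}

theorem runs_draw (env : Env n 𝒵) (k : ℕ) (s : State n 𝒵) {B : ℕ}
    {Q : State n 𝒵 → Prop} (hB : 2 ≤ B)
    (hQ : Q { s with
      mem := Function.update s.mem k (env.tape.1 s.draws)
      draws := s.draws + 1 }) :
    Runs env (.draw (.const k)) s B Q := by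
  refine ⟨_, _, .draw _ s, ?_, ?_⟩
  · simp only [Expr.cost]; omega
  · simpa [Expr.eval] using hQ

theorem runs_setupCmd (P : Params) (s : State n 𝒵) (hs : s.mem = P.mem) (hd : s.draws = 0) :
    Runs env setupCmd s 150 fun s' =>
      (∀ k < 6, s'.mem k = P.mem k) ∧ s'.mem 10 = P.budget ∧
      s'.mem 12 = P.hi (P.noise (env.tape.1 0)) ∧ s'.mem 13 = P.lo (P.noise (env.tape.1 0)) ∧
      s'.samples = s.samples := by
  have e0 : P.mem 0 = P.ε := rfl
  have e1 : P.mem 1 = P.δ := rfl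
  have e5 : P.mem 5 = P.p := rfl
  unfold setupCmd
  refine Runs.seq (runs_draw _ _ _ (B := 2) le_rfl rfl) (B₂ := 148) ?_ (by omega)
  rintro s₁ rfl
  refine Runs.seq (runs_put _ _ _ _ (B := 30) (by simp [Expr.cost]) rfl) (B₂ := 118) ?_ (by omega)
  rintro s₁ rfl
  refine Runs.seq (runs_put _ _ _ _ (B := 15) (by simp [Expr.cost]) rfl) (B₂ := 103) ?_ (by omega)
  rintro s₁ rfl
  refine Runs.seq (runs_put _ _ _ _ (B := 20) (by simp [Expr.cost]) rfl) (B₂ := 83) ?_ (by omega)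
  rintro s₁ rfl
  refine Runs.seq (runs_put _ _ _ _ (B := 15) (by simp [Expr.cost]) rfl) (B₂ := 68) ?_ (by omega)
  rintro s₁ rfl
  refine Runs.seq (runs_put _ _ _ _ (B := 30) (by simp [Expr.cost]) rfl) (B₂ := 38) ?_ (by omega)
  rintro s₁ rfl
  refine Runs.seq (runs_put _ _ _ _ (B := 18) (by simp [Expr.cost]) rfl) (B₂ := 18) ?_ (by omega)
  rintro s₁ rfl
  refine runs_put _ _ _ _ (by simp [Expr.cost]) ?_
  refine ⟨fun k hk => ?_, ?_, ?_, ?_, ?_⟩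
  · simp [hs, (show k ≠ 6 by omega), (show k ≠ 7 by omega), (show k ≠ 8 by omega),
      (show k ≠ 9 by omega), (show k ≠ 10 by omega), (show k ≠ 11 by omega),
      (show k ≠ 12 by omega), (show k ≠ 13 by omega)]
  all_goals simp [Expr.eval, hs, hd, e0, e1, e5, Params.budget, Params.floorCount, Params.depth,
    Params.center, Params.hi, Params.lo, Params.noise]

theorem runs_query (env : Env n 𝒵) (j : SignType) (s : State n 𝒵) (k : ℕ)
    (h14 : s.mem 14 = k) {B : ℕ} {Q : State n 𝒵 → Prop} (hB : 11 ≤ B)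
    (hQ : Q { s with
      mem := Function.update s.mem (addr j k)
        (min (env.oracle j (s.mem 3) s.sub) (ENNReal.ofReal (s.mem 2))).toReal }) :
    Runs env (.query j (addrExpr j 14) (cell 3) (cell 2)) s B Q := by
  refine ⟨_, _, .query j _ _ _ s, ?_, ?_⟩
  · simp; omega
  · rw [floor_addrExpr _ _ _ _ h14]
    simpa using hQ

theorem runs_sampleCmd (s : State n 𝒵) (hs : s.samples = 0) {N : ℕ} (hN : N = ⌈s.mem 10⌉₊) :
    Runs env sampleCmd s (60 * (N + 1)) fun s' =>
      (∀ j, ∀ i < N, s'.mem (addr j i) = (min (env.oracle j (s.mem 3)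
        (thin env.data (s.mem 5) (env.tape.2 i))) (ENNReal.ofReal (s.mem 2))).toReal) ∧
      ∀ k < 100, k ≠ 14 → s'.mem k = s.mem k := by
  refine Runs.seq (runs_put (B := 3) _ _ _ _ (by simp [Expr.cost])
    (Q := fun s₁ => s₁.mem 14 = 0 ∧ s₁.samples = 0 ∧ ∀ k < 100, k ≠ 14 → s₁.mem k = s.mem k) ?_)
    (B₂ := 50 * (N + 1)) ?_ (by omega)
  · exact ⟨by simp [Expr.eval], hs, fun k _ hk => by simp [hk]⟩
  rintro s₁ ⟨h14, hsm, hs₁⟩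
  refine (Runs.loop (N := N) (B := 45) (fun k s' => s'.mem 14 = k ∧ s'.samples = k ∧
    (∀ j, ∀ i < k, s'.mem (addr j i) = (min (env.oracle j (s.mem 3)
        (thin env.data (s.mem 5) (env.tape.2 i))) (ENNReal.ofReal (s.mem 2))).toReal) ∧
    ∀ k < 100, k ≠ 14 → s'.mem k = s.mem k) ?_ ?_ ?_ (B' := 50 * (N + 1)) ?_).mono
      le_rfl fun s' h => h.2.2
  · rintro k hk s' ⟨hk14, hsk, ha, hk100⟩
    refine ⟨?_, ?_⟩
    · rw [eval_cell, eval_cell, hk14, hk100 10 (by simp) (by simp)]; exact lt_of_lt_ceil hN hk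
    have hne : ∀ (j : SignType) (i c : ℕ), c < 100 → c ≠ addr j i := fun j i c hc => by
      have := le_addr j i; omega
    refine Runs.seq (B₁ := 3) (P := fun t => t = { s' with
        sub := thin env.data (s.mem 5) (env.tape.2 k)
        samples := k + 1 }) ⟨_, _, .subsample _ _, by simp, ?_⟩ (B₂ := 40) ?_ (by omega)
    · simp [hsk, hk100 5 (by simp) (by simp)]
    rintro _ rfl
    refine Runs.seq (runs_query _ _ _ k (by exact hk14) (B := 11) le_rfl rfl) (B₁ := 11) (B₂ := 29) ?_ (by omega)
    rintro _ rfl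
    refine Runs.seq (runs_query _ _ _ k (by simp [hne, hk14]) (B := 11) le_rfl rfl) (B₁ := 11) (B₂ := 18) ?_
      (by omega)
    rintro _ rfl
    refine Runs.seq (runs_query _ _ _ k (by simp [hne, hk14]) (B := 11) le_rfl rfl) (B₁ := 11) (B₂ := 7) ?_
      (by omega)
    rintro _ rfl
    refine runs_put _ _ _ _ (by simp [Expr.cost]) ⟨?_, rfl, ?_, ?_⟩
    · simp [hne, hk14, Expr.eval]
    · intro j i hi
      -- Injectivity of the addresses: the three new writes hit the block of the `k`-th subsample
      -- and leave earlier blocks intact.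
      have hj : ∀ j', addr j i = addr j' k ↔ j = j' ∧ i = k := fun j' =>
        ⟨addr_injective, fun h => by rw [h.1, h.2]⟩
      have h3 := hk100 3 (by simp) (by simp)
      have h2 := hk100 2 (by simp) (by simp)
      simp only [Function.update_apply, hj, hne _ _ 2 (by simp), hne _ _ 3 (by simp), if_false, h2,
        h3, if_neg (hne j i 14 (by simp)).symm]
      by_cases hik : i = k
      · subst hik
        cases j <;> simp
      · simp [hik, ha j i (by omega)]
    · intro c hc hc'
      simp [hc', hne _ _ c hc, hk100 c hc hc']
  · rintro s' ⟨hk14, -, -, hk100⟩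
    rw [eval_cell, eval_cell, hk14, hk100 10 (by simp) (by simp)]
    exact not_lt_ceil hN
  · exact ⟨by simp [h14], hsm, by simp, hs₁⟩
  · simp [mul_comm]

end Run

variable {d n : ℕ} [NeZero d] {𝒵 : Type*}

open Classical in
theorem runs_mechanism (𝒯 : Task d 𝒵) (P : Params) (Z : Fin n → 𝒵) (r : Tape n) :
    Runs (𝒯.env Z r) mechanism (startState P Z)
      (if P.δ < 2 / 3 then 1100 * (P.numSamples + 1) ^ 2 else 40) fun s' =>
        SignType.sign (s'.mem 0) = 𝒯.output P Z r := by
  have e1 : (startState P Z).mem 1 = P.δ := rfl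
  have hcond : (cell 1).eval (startState P Z).mem <
      (Expr.const (2 / 3)).eval (startState P Z).mem ↔ P.δ < 2 / 3 := by
    rw [eval_cell, e1]; simp [Expr.eval]
  split_ifs with hδ
  swap
  · refine Runs.ite (B := 30) (fun h => absurd (hcond.1 h) hδ) (fun _ => ?_) (by simp [Expr.cost])
    refine Runs.seq (runs_draw _ _ _ (B := 2) le_rfl rfl) (B₂ := 28) ?_ (by omega)
    rintro _ rfl
    simp only [Task.output, hδ, if_false, coin]
    refine Runs.ite (B := 20) (fun h => ?_) (fun h => ?_) (by simp [Expr.cost])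
    · refine runs_put _ _ _ _ (by simp [Expr.cost]) ?_
      have h' : ((r.1 0 : unitInterval) : ℝ) < 1 / 3 := by
        simpa [Expr.eval, Task.env, startState] using h
      rw [if_pos h']; simp [Expr.eval]
    have h' : ¬ ((r.1 0 : unitInterval) : ℝ) < 1 / 3 := by
      simpa [Expr.eval, Task.env, startState] using h
    refine Runs.ite (B := 10) (fun g => ?_) (fun g => ?_) (by simp [Expr.cost])
    · refine runs_put _ _ _ _ (by simp [Expr.cost]) ?_
      have g' : ((r.1 0 : unitInterval) : ℝ) < 2 / 3 := by
        simpa [Expr.eval, Task.env, startState] using g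
      rw [if_neg h', if_pos g']; simp [Expr.eval]
    · refine runs_put _ _ _ _ (by simp [Expr.cost]) ?_
      have g' : ¬ ((r.1 0 : unitInterval) : ℝ) < 2 / 3 := by
        simpa [Expr.eval, Task.env, startState] using g
      rw [if_neg h', if_neg g']; simp [Expr.eval]
  set N := P.numSamples with hNdef
  refine Runs.ite (B := 153 + 60 * (N + 1) + 800 * (N + 1) ^ 2) (fun _ => ?_)
    (fun h => absurd (hcond.2 hδ) h) ?_
  swap
  · have h1 : N + 1 ≤ (N + 1) ^ 2 := by nlinarith
    have h2 : 1 ≤ N + 1 := by omega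
    simp only [cost_cell, Expr.cost]
    omega
  refine Runs.seq (runs_setupCmd P _ rfl rfl) (B₂ := 3 + 60 * (N + 1) + 800 * (N + 1) ^ 2) ?_
    (by omega)
  rintro s₁ ⟨hk, h10, h12, h13, hsm⟩
  have hN : N = ⌈s₁.mem 10⌉₊ := by rw [h10]; rfl
  refine Runs.seq (runs_sampleCmd s₁ hsm hN) (B₂ := 3 + 800 * (N + 1) ^ 2) ?_ (by omega)
  rintro s₂ ⟨ha, hs₂⟩
  set a : SignType → ℕ → ℝ := fun j i => 𝒯.clipped P j (thin Z P.p (r.2 i)) with hadef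
  have ha' : ∀ j, ∀ i < N, s₂.mem (addr j i) = a j i := by
    intro j i hi
    rw [ha j i hi, hk 3 (by simp), hk 5 (by simp), hk 2 (by simp)]
    rfl
  refine Runs.seq (runs_put (B := 3) _ _ _ _ (by simp [Expr.cost])
    (Q := fun t => t.mem 0 = 0 ∧ AgreeOff {0} s₂.mem t.mem)
      ⟨by simp [Expr.eval], agreeOff_update _ _ _⟩) (B₂ := 800 * (N + 1) ^ 2) ?_ (by omega)
  rintro s₃ ⟨hz, hs₃⟩
  have nadd : ∀ (j : SignType) (i k : ℕ), k < 100 → addr j i ≠ k := fun j i k hk => by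
    have := le_addr j i; omega
  have c3 : ∀ k < 100, k ≠ 14 → k ≠ 0 → s₃.mem k = s₁.mem k := fun k hk h14 h0 => by
    rw [hs₃ k (by simpa using h0), hs₂ k hk h14]
  refine Runs.seq (runs_passCmd _ .neg .zero .pos (-1) s₃ a (N := N)
    (by rw [c3 10 (by simp) (by simp) (by simp), ← hN])
    fun j i hi => by rw [hs₃ _ (by simpa using nadd j i 0 (by simp)), ha' j i hi])
    (B₂ := 400 * (N + 1) ^ 2) ?_ (by omega)
  rintro s₄ ⟨h40, hs₄⟩
  refine (runs_passCmd _ .pos .zero .neg 1 s₄ a (N := N)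
    (by rw [hs₄ 10 (by decide), c3 10 (by simp) (by simp) (by simp), ← hN])
    fun j i hi => by
      rw [hs₄ _ ?_, hs₃ _ (by simpa using nadd j i 0 (by simp)), ha' j i hi]
      simp only [Finset.mem_insert, Finset.mem_singleton, not_or]
      exact ⟨nadd _ _ _ (by simp), nadd _ _ _ (by simp), nadd _ _ _ (by simp),
        nadd _ _ _ (by simp), nadd _ _ _ (by simp), nadd _ _ _ (by simp), nadd _ _ _ (by simp),
        nadd _ _ _ (by simp)⟩).mono le_rfl ?_
  rintro s₅ ⟨h50, -⟩
  rw [hs₄ 12 (by decide), hs₄ 13 (by decide), c3 12 (by simp) (by simp) (by simp),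
    c3 13 (by simp) (by simp) (by simp), h12, h13] at h50
  rw [c3 12 (by simp) (by simp) (by simp),
    c3 13 (by simp) (by simp) (by simp), h12, h13, hz] at h40
  simp only [Task.output, hδ, if_true, Task.answer, verdict]
  rw [h50, h40]
  change SignType.sign (ite (∃ i < N, Certifies N a (P.hi (P.noise (r.1 0)))
    (P.lo (P.noise (r.1 0))) .pos .zero .neg i) _ (ite (∃ i < N, Certifies N a
    (P.hi (P.noise (r.1 0))) (P.lo (P.noise (r.1 0))) .neg .zero .pos i) _ _)) = _
  rw [← hNdef]
  split_ifs <;> simp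

/-- The operational semantics can be dropped from the probabilistic analysis, which concerns only
the function `Task.output` of data and tape. -/
theorem outputs_iff (𝒯 : Task d 𝒵) (P : Params) (Z : Fin n → 𝒵) (r : Tape n) (y : SignType) :
    Outputs mechanism 𝒯 P Z r y ↔ 𝒯.output P Z r = y := by
  obtain ⟨T, s, e, -, hs⟩ := runs_mechanism 𝒯 P Z r
  constructor
  · rintro ⟨T', s', e', rfl⟩
    rw [← hs, e.deterministic e']
  · rintro rfl
    exact ⟨T, s, e, hs⟩

theorem outputProb_eq (𝒯 : Task d 𝒵) (P : Params) (Z : Fin n → 𝒵) (E : Set SignType) :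
    outputProb mechanism 𝒯 P Z E = tapeMeasure n {r | 𝒯.output P Z r ∈ E} := by
  simp [outputProb, outputs_iff]

end ParamTest

namespace ParamTest

/-! ### Comparison of the verdicts on neighboring data -/

theorem countLE_mono (N : ℕ) (b : ℕ → ℝ) {v w : ℝ} (h : v ≤ w) :
    countLE N b v ≤ countLE N b w := by
  classical
  refine Finset.card_le_card fun s hs => ?_
  simp only [Finset.mem_filter] at hs ⊢
  exact ⟨hs.1, hs.2.trans h⟩

theorem countLE_le_of_le (N : ℕ) {b b' : ℕ → ℝ} (v : ℝ) (h : ∀ s, b' s ≤ b s) :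
    countLE N b v ≤ countLE N b' v := by
  classical
  refine Finset.card_le_card fun s hs => ?_
  simp only [Finset.mem_filter] at hs ⊢
  exact ⟨hs.1, (h s).trans hs.2⟩

/-- A positive count is attained at one of the counted values. -/
theorem exists_countLE_eq {N : ℕ} {b : ℕ → ℝ} {v : ℝ} (h : 0 < countLE N b v) :
    ∃ s < N, b s ≤ v ∧ countLE N b (b s) = countLE N b v := by
  classical
  obtain ⟨s, hs, hmax⟩ := Finset.exists_max_image ((Finset.range N).filter fun s => b s ≤ v) b
    (Finset.card_pos.1 h)
  simp only [Finset.mem_filter, Finset.mem_range] at hs hmax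
  refine ⟨s, hs.1, hs.2, le_antisymm (countLE_mono N b hs.2) ?_⟩
  refine Finset.card_le_card fun i hi => ?_
  simp only [Finset.mem_filter, Finset.mem_range] at hi ⊢
  exact ⟨hi.1, hmax i hi⟩

/-- Among the samples whose value `b s` is small, few lie in `K`, for all sufficiently large
level sets of `b`. -/
def Sparse (N : ℕ) (b : ℕ → ℝ) (K : Set ℕ) (p r₀ : ℝ) : Prop := by
  classical
  exact ∀ s₀ < N, r₀ ≤ countLE N b (b s₀) →
    (((Finset.range N).filter fun s => b s ≤ b s₀ ∧ s ∈ K).card : ℝ) ≤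
      2 * p * countLE N b (b s₀)

/-- At most a fraction `2p` of the level set of `b` can leave it when the values on `K` change.
Sparsity is known only at recorded levels, so `v` is first lowered to the largest recorded value
below it, with the same count. -/
theorem Sparse.count_ge {N : ℕ} {b b' : ℕ → ℝ} {K : Set ℕ} {p r₀ : ℝ}
    (hb : Sparse N b K p r₀) (hr₀ : 0 < r₀) (heq : ∀ s ∉ K, b' s = b s) {v : ℝ}
    (hv : r₀ ≤ countLE N b v) : (1 - 2 * p) * countLE N b v ≤ countLE N b' v := by
  classical
  have hpos : 0 < countLE N b v := by exact_mod_cast hr₀.trans_le hv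
  obtain ⟨s₀, hs₀, hle, heq₀⟩ := exists_countLE_eq hpos
  have h := hb s₀ hs₀ (by rwa [heq₀])
  have hsub : countLE N b (b s₀) ≤
      ((Finset.range N).filter fun s => b s ≤ b s₀ ∧ s ∈ K).card + countLE N b' v := by
    refine (Finset.card_le_card fun s hs => ?_).trans (Finset.card_union_le _ _)
    simp only [Finset.mem_filter, Finset.mem_range, Finset.mem_union] at hs ⊢
    by_cases hK : s ∈ K
    · exact Or.inl ⟨hs.1, hs.2, hK⟩
    · exact Or.inr ⟨hs.1, by rw [heq s hK]; exact hs.2.trans hle⟩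
  rw [heq₀] at h hsub
  have hsub' : (countLE N b v : ℝ) ≤
      ((Finset.range N).filter fun s => b s ≤ b s₀ ∧ s ∈ K).card + countLE N b' v := by
    exact_mod_cast hsub
  linarith

/-- From `exp(4p) ≥ 1 + 4p` and `(1 + 4p)(1 - 2p) ≥ 1`, where the latter needs `p ≤ 1/4`. It fixes
`4p` as the noise shift that compensates one data point. -/
theorem exp_neg_le_one_sub {p : ℝ} (hp : 0 < p) (hp' : p < 1 / 4) :
    Real.exp (-(4 * p)) ≤ 1 - 2 * p := by
  rw [Real.exp_neg, inv_le_comm₀ (Real.exp_pos _) (by linarith)]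
  refine le_trans ?_ (Real.add_one_le_exp _)
  rw [inv_le_iff_one_le_mul₀ (by linarith)]
  nlinarith

/-- The recorded losses certify region `j` at noise level `x`. -/
def Wins (P : Params) (a : SignType → ℕ → ℝ) (x : ℝ) (j j₁ j₂ : SignType) : Prop :=
  ∃ i < P.numSamples, Certifies P.numSamples a (P.hi x) (P.lo x) j j₁ j₂ i

/-- Lowering the noise by `4p` divides `hi` and multiplies `lo` by `exp(4p)`. The winner's count
loses at most that factor on the way from `a` through `b` to `a'`. A rival count above the new `lo`
would, going back through `b`, exceed the old `lo` for `a`. The bounds on `x` keep the thresholds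
above `floorCount`, where sparsity applies. -/
theorem Wins.transfer {P : Params} (hp : 0 < P.p) (hp' : P.p < 1 / 4) (hr : 0 < P.floorCount)
    {a a' b : SignType → ℕ → ℝ} {K : Set ℕ}
    (hb : ∀ j, Sparse P.numSamples (b j) K P.p P.floorCount)
    (hab : ∀ j s, b j s ≤ a j s) (hab' : ∀ j s, b j s ≤ a' j s)
    (heq : ∀ j, ∀ s ∉ K, a j s = b j s) (heq' : ∀ j, ∀ s ∉ K, a' j s = b j s)
    {x : ℝ} {j j₁ j₂ : SignType} (hx : 0 ≤ 2 * P.center + x)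
    (hx' : 0 ≤ 2 * P.center - x + 4 * P.p)
    (h : Wins P a x j j₁ j₂) : Wins P a' (x - 4 * P.p) j j₁ j₂ := by
  obtain ⟨i, hi, h0, h1, h2⟩ := h
  set N := P.numSamples
  set v := a j i
  have e1 : P.hi (x - 4 * P.p) = Real.exp (-(4 * P.p)) * P.hi x := by
    simp only [Params.hi]
    rw [mul_left_comm, ← Real.exp_add]; ring_nf
  have e2 : P.lo x = Real.exp (-(4 * P.p)) * P.lo (x - 4 * P.p) := by
    simp only [Params.lo]
    rw [mul_left_comm, ← Real.exp_add]; ring_nf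
  have key := exp_neg_le_one_sub hp hp'
  have hpos : 0 < P.hi (x - 4 * P.p) := mul_pos hr (Real.exp_pos _)
  have hhi : P.floorCount ≤ P.hi x := le_mul_of_one_le_right hr.le (Real.one_le_exp hx)
  have hlo : P.floorCount ≤ P.lo (x - 4 * P.p) :=
    le_mul_of_one_le_right hr.le (Real.one_le_exp (by linarith))
  have hcount : P.hi (x - 4 * P.p) ≤ countLE N (a' j) v := by
    have c1 : P.hi x ≤ countLE N (b j) v :=
      h0.trans (by exact_mod_cast countLE_le_of_le N v (hab j))
    have c2 := (hb j).count_ge hr (heq' j) (v := v) (hhi.trans c1)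
    rw [e1]
    refine le_trans ?_ c2
    exact mul_le_mul key c1 (hr.le.trans hhi) (by linarith)
  -- The level `v` is recorded in `a`, but the new certificate must sit at a value recorded in `a'`.
  -- The largest one below `v` keeps the winner's count and cannot raise the rivals'.
  obtain ⟨i', hi', hle, hceq⟩ := exists_countLE_eq (N := N) (b := a' j) (v := v)
    (by exact_mod_cast hpos.trans_le hcount)
  have other : ∀ j', (countLE N (a j') v : ℝ) ≤ P.lo x →
      (countLE N (a' j') (a' j i') : ℝ) ≤ P.lo (x - 4 * P.p) := by
    intro j' hj'
    have d1 : (countLE N (a' j') (a' j i') : ℝ) ≤ countLE N (b j') v := by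
      exact_mod_cast (countLE_mono N _ hle).trans (countLE_le_of_le N v (hab' j'))
    by_contra! hcon
    have d2 := hcon.trans_le d1
    have d3 := (hb j').count_ge hr (heq j') (v := v) (hlo.trans d2.le)
    have d4 : P.lo x < countLE N (a j') v := by
      rw [e2]
      refine lt_of_lt_of_le ?_ d3
      exact mul_lt_mul' key d2 (hr.le.trans hlo) (by linarith)
    exact absurd hj' (not_le.2 d4)
  exact ⟨i', hi', by rw [hceq]; exact hcount, other _ h1, other _ h2⟩

/-- At the higher of the two certifying levels, the region certified at the lower level already has
at least `hi > lo` losses, contradicting the certificate there. -/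
theorem Wins.not_both {P : Params} (hr : 0 < P.floorCount) {a : SignType → ℕ → ℝ} {x : ℝ}
    (hx : 0 < x) {j j' k k' : SignType} (h : Wins P a x j k j') (h' : Wins P a x j' k' j) :
    False := by
  obtain ⟨i, -, hi1, -, hi2⟩ := h
  obtain ⟨i', -, hi1', -, hi2'⟩ := h'
  have hlt : P.lo x < P.hi x :=
    mul_lt_mul_of_pos_left (Real.exp_lt_exp.2 (by linarith)) hr
  rcases le_total (a j i) (a j' i') with hle | hle
  · have : (countLE P.numSamples (a j) (a j i) : ℝ) ≤ countLE P.numSamples (a j) (a j' i') := by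
      exact_mod_cast countLE_mono _ _ hle
    linarith
  · have : (countLE P.numSamples (a j') (a j' i') : ℝ) ≤ countLE P.numSamples (a j') (a j i) := by
      exact_mod_cast countLE_mono _ _ hle
    linarith

/-- The verdict at noise level `x`. -/
noncomputable def verdictAt (P : Params) (a : SignType → ℕ → ℝ) (x : ℝ) : SignType :=
  verdict P.numSamples a (P.hi x) (P.lo x)

theorem verdictAt_eq_one_iff {P : Params} {a : SignType → ℕ → ℝ} {x : ℝ} :
    verdictAt P a x = 1 ↔ Wins P a x .pos .zero .neg := by
  unfold verdictAt verdict Wins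
  split_ifs <;> simp_all

theorem verdictAt_eq_neg_one_iff {P : Params} (hr : 0 < P.floorCount) {a : SignType → ℕ → ℝ}
    {x : ℝ} (hx : 0 < x) : verdictAt P a x = -1 ↔ Wins P a x .neg .zero .pos := by
  have := @Wins.not_both P hr a x hx .neg .pos .zero .zero
  unfold verdictAt verdict
  unfold Wins at this ⊢
  split_ifs with h1 h2
  · exact ⟨fun h => absurd h (by decide), fun h => (this h h1).elim⟩
  · exact ⟨fun _ => h2, fun _ => rfl⟩
  · exact ⟨fun h => absurd h (by decide), fun h => absurd h h2⟩

/-- Only nonzero verdicts are carried over, and only towards smaller noise; the verdict `0` is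
handled in `volume_answer_le` by exchanging the roles of the datasets. -/
theorem verdictAt_transfer {P : Params} (hp : 0 < P.p) (hp' : P.p < 1 / 4)
    (hr : 0 < P.floorCount)
    {a a' b : SignType → ℕ → ℝ} {K : Set ℕ}
    (hb : ∀ j, Sparse P.numSamples (b j) K P.p P.floorCount)
    (hab : ∀ j s, b j s ≤ a j s) (hab' : ∀ j s, b j s ≤ a' j s)
    (heq : ∀ j, ∀ s ∉ K, a j s = b j s) (heq' : ∀ j, ∀ s ∉ K, a' j s = b j s)
    {x : ℝ} (hx : 4 * P.p < x) (hx' : x ≤ 2 * P.center + 4 * P.p)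
    (h : verdictAt P a x ≠ 0) : verdictAt P a' (x - 4 * P.p) = verdictAt P a x := by
  rcases hv : verdictAt P a x with _ | _ | _
  · exact absurd hv h
  · change _ = (-1 : SignType) at hv
    change _ = (-1 : SignType)
    rw [verdictAt_eq_neg_one_iff hr (by linarith)] at hv ⊢
    exact hv.transfer hp hp' hr hb hab hab' heq heq' (by linarith) (by linarith)
  · change _ = (1 : SignType) at hv
    change _ = (1 : SignType)
    rw [verdictAt_eq_one_iff] at hv ⊢
    exact hv.transfer hp hp' hr hb hab hab' heq heq' (by linarith) (by linarith)

/-! ### Logistic noise -/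

/-- Multiply the odds of `u` by `κ`. -/
noncomputable def oddsShift (κ u : ℝ) : ℝ := κ * u / (1 - u + κ * u)

section Odds

variable {κ u : ℝ}

theorem oddsShift_denom_pos (hκ : 0 < κ) (h0 : 0 ≤ u) (h1 : u ≤ 1) : 0 < 1 - u + κ * u := by
  rcases h0.eq_or_lt with rfl | h
  · simp
  · have := mul_pos hκ h; linarith

theorem oddsShift_mem (hκ : 0 < κ) (h0 : 0 ≤ u) (h1 : u ≤ 1) :
    oddsShift κ u ∈ Set.Icc (0 : ℝ) 1 := by
  have hd := oddsShift_denom_pos hκ h0 h1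
  have := mul_nonneg hκ.le h0
  exact ⟨div_nonneg this hd.le, (div_le_one hd).2 (by linarith)⟩

theorem one_sub_oddsShift (hκ : 0 < κ) (h0 : 0 ≤ u) (h1 : u ≤ 1) :
    1 - oddsShift κ u = (1 - u) / (1 - u + κ * u) := by
  have hd := (oddsShift_denom_pos hκ h0 h1).ne'
  unfold oddsShift; field_simp; ring

theorem odds_oddsShift (hκ : 0 < κ) (h0 : 0 ≤ u) (h1 : u ≤ 1) :
    oddsShift κ u / (1 - oddsShift κ u) = κ * (u / (1 - u)) := by
  have hd := (oddsShift_denom_pos hκ h0 h1).ne'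
  rw [one_sub_oddsShift hκ h0 h1, oddsShift, div_div_div_cancel_right₀ hd, mul_div_assoc]

theorem oddsShift_inv (hκ : 0 < κ) (h0 : 0 ≤ u) (h1 : u ≤ 1) :
    oddsShift κ⁻¹ (oddsShift κ u) = u := by
  have hd := (oddsShift_denom_pos hκ h0 h1).ne'
  have h : 1 - oddsShift κ u + κ⁻¹ * oddsShift κ u = (1 - u + κ * u)⁻¹ := by
    rw [one_sub_oddsShift hκ h0 h1, oddsShift]
    field_simp; ring
  rw [oddsShift, h, oddsShift]
  field_simp

/-- The difference of two values is `κ (x - y)` over the product of the two denominators, and each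
denominator is at least `min 1 κ`. -/
theorem lipschitzOn_oddsShift (hκ : 0 < κ) {L : ℝ≥0} (h1 : κ ≤ L) (h2 : κ⁻¹ ≤ L) :
    LipschitzOnWith L (oddsShift κ) (Set.Icc 0 1) := by
  refine LipschitzOnWith.of_dist_le_mul fun x hx y hy => ?_
  have dx := oddsShift_denom_pos hκ hx.1 hx.2
  have dy := oddsShift_denom_pos hκ hy.1 hy.2
  have e : oddsShift κ x - oddsShift κ y =
      κ / ((1 - x + κ * x) * (1 - y + κ * y)) * (x - y) := by
    unfold oddsShift
    rw [div_sub_div _ _ dx.ne' dy.ne', div_mul_eq_mul_div]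
    congr 1; ring
  rw [Real.dist_eq, Real.dist_eq, e, abs_mul]
  refine mul_le_mul_of_nonneg_right ?_ (abs_nonneg _)
  rw [abs_of_pos (by positivity), div_le_iff₀ (by positivity)]
  rcases le_total κ 1 with hk | hk
  · have hx' : κ ≤ 1 - x + κ * x := by nlinarith [hx.1, hx.2]
    have hy' : κ ≤ 1 - y + κ * y := by nlinarith [hy.1, hy.2]
    have hm : κ * κ ≤ (1 - x + κ * x) * (1 - y + κ * y) :=
      mul_le_mul hx' hy' hκ.le dx.le
    calc κ = κ⁻¹ * (κ * κ) := by field_simp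
      _ ≤ L * ((1 - x + κ * x) * (1 - y + κ * y)) :=
        mul_le_mul h2 hm (by positivity) (by positivity)
  · have hx' : 1 ≤ 1 - x + κ * x := by nlinarith [hx.1, hx.2]
    have hy' : 1 ≤ 1 - y + κ * y := by nlinarith [hy.1, hy.2]
    have hm : 1 ≤ (1 - x + κ * x) * (1 - y + κ * y) := one_le_mul_of_one_le_of_one_le hx' hy'
    calc κ ≤ L * 1 := by linarith
      _ ≤ _ := mul_le_mul_of_nonneg_left hm (by positivity)

end Odds

theorem volume_unitInterval (A : Set unitInterval) :
    volume A = volume (Subtype.val '' A : Set ℝ) := by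
  have : (volume : Measure unitInterval) = Measure.comap Subtype.val volume := rfl
  rw [this, (MeasurableEmbedding.subtype_coe measurableSet_Icc).comap_apply]

/-- If multiplication of the odds by `κ` maps `A` into `A'`, then the volume of `A` is at most
`max κ κ⁻¹` times that of `A'`. -/
theorem volume_le_of_oddsShift {κ : ℝ} (hκ : 0 < κ) {L : ℝ≥0} (h1 : κ ≤ L) (h2 : κ⁻¹ ≤ L)
    {A A' : Set unitInterval}
    (h : ∀ u ∈ A, ∃ u' ∈ A', (u' : ℝ) = oddsShift κ u) :
    volume A ≤ L * volume A' := by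
  rw [volume_unitInterval, volume_unitInterval]
  -- The inverse shift is Lipschitz with the same constant. Bounding one-dimensional Hausdorff
  -- measure of its image needs no measurability of `A` or `A'`.
  have hsub : (Subtype.val '' A : Set ℝ) ⊆ oddsShift κ⁻¹ '' (Subtype.val '' A') := by
    rintro _ ⟨u, hu, rfl⟩
    obtain ⟨u', hu', e⟩ := h u hu
    exact ⟨u', ⟨u', hu', rfl⟩, by rw [e, oddsShift_inv hκ u.2.1 u.2.2]⟩
  have hL := ((lipschitzOn_oddsShift (inv_pos.2 hκ) h2 (by rwa [inv_inv])).mono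
    (s := Subtype.val '' A') (by rintro _ ⟨u, -, rfl⟩; exact u.2)).hausdorffMeasure_image_le
      zero_le_one
  rw [hausdorffMeasure_real, ENNReal.rpow_one] at hL
  exact (measure_mono hsub).trans hL

theorem volume_lt (p : ℝ) (hp' : p ≤ 1) :
    volume {u : unitInterval | (u : ℝ) < p} = ENNReal.ofReal p := by
  rw [volume_unitInterval]
  have : (Subtype.val '' {u : unitInterval | (u : ℝ) < p} : Set ℝ) = Set.Ico 0 p := by
    ext x
    constructor
    · rintro ⟨u, hu, rfl⟩; exact ⟨u.2.1, hu⟩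
    · rintro ⟨h0, h1⟩; exact ⟨⟨x, h0, by linarith⟩, h1, rfl⟩
  rw [this, Real.volume_Ico, sub_zero]

theorem volume_gt (p : ℝ) (hp' : p ≤ 1) :
    volume {u : unitInterval | 1 - p < (u : ℝ)} = ENNReal.ofReal p := by
  rw [volume_unitInterval]
  have : (Subtype.val '' {u : unitInterval | 1 - p < (u : ℝ)} : Set ℝ) = Set.Ioc (1 - p) 1 := by
    ext x
    constructor
    · rintro ⟨u, hu, rfl⟩; exact ⟨hu, u.2.2⟩
    · rintro ⟨h0, h1⟩; exact ⟨⟨x, by linarith, h1⟩, h0, rfl⟩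
  rw [this, Real.volume_Ioc]; congr 1; ring

/-- The uniform variables whose odds are within a factor `8 / δ` of `1`. -/
def goodNoise (P : Params) : Set unitInterval := {u | P.δ / 8 ≤ u ∧ (u : ℝ) ≤ 1 - P.δ / 8}

theorem volume_goodNoise_compl {P : Params} (hP : P.Valid) :
    volume (goodNoise P)ᶜ ≤ ENNReal.ofReal (P.δ / 4) := by
  have h0 := hP.δ_pos
  have h1 := hP.δ_lt_one
  have : (goodNoise P)ᶜ ⊆ {u | (u : ℝ) < P.δ / 8} ∪ {u | 1 - P.δ / 8 < (u : ℝ)} := by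
    intro u hu
    by_contra hcon
    simp only [Set.mem_union, Set.mem_ofPred_eq, not_or, not_lt] at hcon
    exact hu hcon
  refine (measure_mono this).trans ((measure_union_le _ _).trans ?_)
  rw [volume_lt _ (by linarith), volume_gt _ (by linarith),
    ← ENNReal.ofReal_add (by linarith) (by linarith)]
  exact ENNReal.ofReal_le_ofReal (by linarith)

theorem abs_log_odds_le {P : Params} (hP : P.Valid) {u : unitInterval} (hu : u ∈ goodNoise P) :
    |Real.log ((u : ℝ) / (1 - u))| ≤ Real.log (8 / P.δ) := by
  have h0 := hP.δ_pos
  have h1 := hP.δ_lt_one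
  obtain ⟨hl, hr⟩ := hu
  have hu0 : 0 < (u : ℝ) := by linarith
  have hu1 : 0 < 1 - (u : ℝ) := by linarith
  rw [abs_le]
  constructor
  · rw [← Real.log_inv, inv_div]
    refine Real.log_le_log (by positivity) ?_
    rw [le_div_iff₀ hu1]
    nlinarith
  · refine Real.log_le_log (by positivity) ?_
    rw [div_le_div_iff₀ hu1 h0]
    nlinarith

/-- The centre is `8p` plus the largest log-odds deviation allowed by `goodNoise`. The margin `8p`
at both ends leaves room for a shift by `4p`. -/
theorem noise_bounds {P : Params} (hP : P.Valid) {u : unitInterval} (hu : u ∈ goodNoise P) :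
    8 * P.p ≤ P.noise u ∧ P.noise u ≤ 2 * P.center - 8 * P.p := by
  have hk : 0 ≤ 4 * P.p / P.ε := by have := hP.p_pos; have := hP.ε_pos; positivity
  have := abs_le.1 (abs_log_odds_le hP hu)
  have h1 := mul_le_mul_of_nonneg_left this.1 hk
  have h2 := mul_le_mul_of_nonneg_left this.2 hk
  unfold Params.noise Params.center
  constructor <;> linarith

/-- The noise is the log-odds scaled by `4p/ε`, so multiplying the odds by `exp(cε)` is a
translation by `4pc`; this calibrates the noise to `ε`. -/
theorem noise_oddsShift {P : Params} (hP : P.Valid) {u : unitInterval} (hu : u ∈ goodNoise P)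
    (c : ℝ) : P.noise (oddsShift (Real.exp (c * P.ε)) u) = P.noise u + c * (4 * P.p) := by
  have h0 := hP.δ_pos
  have hu0 : 0 < (u : ℝ) := by linarith [hu.1]
  have hu1 : 0 < 1 - (u : ℝ) := by linarith [hu.2]
  unfold Params.noise
  rw [odds_oddsShift (Real.exp_pos _) u.2.1 u.2.2, Real.log_mul (Real.exp_pos _).ne'
    (by positivity), Real.log_exp]
  have := hP.ε_pos.ne'
  field_simp; ring

end ParamTest

namespace ParamTest

/-! ### Chernoff bounds -/

section Chernoff

variable {ι : Type*}

-- Markov's inequality for `2` to the power of the count, whose expectation is `(1 + q)` to the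
-- power `F.card` by independence.
open Classical in
theorem measure_count_ge (F : Finset ι) {B : Set unitInterval} (hB : MeasurableSet B) {q : ℝ}
    (hq : 0 ≤ q) (hBq : volume B = ENNReal.ofReal q) (x : ℝ) :
    (Measure.infinitePi fun _ : ι => (volume : Measure unitInterval))
      {v | x ≤ ((F.filter fun s => v s ∈ B).card : ℝ)} ≤
      ENNReal.ofReal ((1 + q) ^ F.card / (2 : ℝ) ^ x) := by
  set V := Measure.infinitePi fun _ : ι => (volume : Measure unitInterval)
  set f : unitInterval → ℝ≥0∞ := fun u => if u ∈ B then 2 else 1 with hf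
  have hfm : Measurable f := Measurable.ite hB measurable_const measurable_const
  have hone : ∀ u, 1 ≤ f u := fun u => by simp only [hf]; split_ifs <;> norm_num
  have hint : ∫⁻ u, f u = ENNReal.ofReal (1 + q) := by
    have : f = fun u => 1 + B.indicator 1 u := by
      funext u; by_cases hu : u ∈ B <;> simp [hf, hu]; norm_num
    rw [this, lintegral_add_left measurable_const, lintegral_indicator_one hB, lintegral_one,
      measure_univ, hBq, ENNReal.ofReal_add zero_le_one hq, ENNReal.ofReal_one]
  have hprod : ∫⁻ v, ∏ s ∈ F, f (v s) ∂V = ENNReal.ofReal ((1 + q) ^ F.card) := by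
    rw [ProbabilityTheory.lintegral_prod_eq_prod_lintegral_of_indepFun F
      (fun s (v : ι → unitInterval) => f (v s))
      (ProbabilityTheory.iIndepFun_infinitePi (fun _ => hfm))
      (fun s => hfm.comp (measurable_pi_apply s))]
    have : ∀ s : ι, ∫⁻ v, f (v s) ∂V = ENNReal.ofReal (1 + q) := fun s => by
      rw [← hint, ← (measurePreserving_eval_infinitePi
        (fun _ : ι => (volume : Measure unitInterval)) s).lintegral_comp hfm]
    rw [Finset.prod_congr rfl fun s _ => this s, Finset.prod_const,
      ENNReal.ofReal_pow (by linarith)]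
  have hval : ∀ v : ι → unitInterval,
      ∏ s ∈ F, f (v s) = 2 ^ (F.filter fun s => v s ∈ B).card := fun v => by
    simp only [hf]
    rw [Finset.prod_ite]; simp
  have h2 : (0 : ℝ) < 2 ^ x := by positivity
  have hsub : {v : ι → unitInterval | x ≤ ((F.filter fun s => v s ∈ B).card : ℝ)} ⊆
      {v | ENNReal.ofReal ((2 : ℝ) ^ x) ≤ ∏ s ∈ F, f (v s)} := by
    intro v hv
    rw [Set.mem_ofPred_eq] at hv ⊢
    rw [hval, show (2 : ℝ≥0∞) = ENNReal.ofReal 2 by simp, ← ENNReal.ofReal_pow (by norm_num),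
      ← Real.rpow_natCast]
    exact ENNReal.ofReal_le_ofReal (Real.rpow_le_rpow_of_exponent_le (by norm_num) hv)
  refine (measure_mono hsub).trans ((meas_ge_le_lintegral_div
    (Finset.measurable_prod _ fun s _ => hfm.comp (measurable_pi_apply s)).aemeasurable
    (by simpa using h2) ENNReal.ofReal_ne_top).trans ?_)
  change (∫⁻ v, ∏ s ∈ F, f (v s) ∂V) / _ ≤ _
  rw [hprod, ENNReal.ofReal_div_of_pos h2]

open Classical in
/-- Upper tail of a binomial variable. -/
theorem measure_binomial_upper (F : Finset ι) {p : ℝ} (hp : 0 ≤ p) (hp' : p ≤ 1) :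
    (Measure.infinitePi fun _ : ι => (volume : Measure unitInterval))
      {v | 2 * p * F.card ≤ ((F.filter fun s => (v s : ℝ) < p).card : ℝ)} ≤
      ENNReal.ofReal (Real.exp (-(p * F.card / 3))) := by
  refine (measure_count_ge F (B := {u | (u : ℝ) < p})
    (measurableSet_lt measurable_subtype_coe measurable_const) hp
    (volume_lt p hp') _).trans (ENNReal.ofReal_le_ofReal ?_)
  -- With `1 + p ≤ exp p`, the exponent per unit of `p * F.card` is `1 - 2 log 2`, which is below
  -- `-1/3`.
  rw [div_le_iff₀ (by positivity), Real.rpow_def_of_pos (by norm_num), ← Real.exp_add]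
  have h1 : (1 + p) ^ F.card ≤ Real.exp (F.card * p) := by
    rw [Real.exp_nat_mul]
    exact pow_le_pow_left₀ (by linarith) (by linarith [Real.add_one_le_exp p]) _
  refine h1.trans (Real.exp_le_exp.2 ?_)
  have := Real.log_two_gt_d9
  have hm : 0 ≤ p * F.card := by positivity
  nlinarith

open Classical in
/-- Lower tail of a binomial variable. -/
theorem measure_binomial_lower (F : Finset ι) {p : ℝ} (hp : 0 ≤ p) (hp' : p ≤ 1) :
    (Measure.infinitePi fun _ : ι => (volume : Measure unitInterval))
      {v | ((F.filter fun s => (v s : ℝ) < p).card : ℝ) ≤ p * F.card / 2} ≤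
      ENNReal.ofReal (Real.exp (-(p * F.card / 8))) := by
  have hBm : MeasurableSet {u : unitInterval | (u : ℝ) < p} :=
    measurableSet_lt measurable_subtype_coe measurable_const
  have hvol : volume {u : unitInterval | (u : ℝ) < p}ᶜ = ENNReal.ofReal (1 - p) := by
    rw [measure_compl hBm (measure_ne_top _ _), volume_lt p hp', measure_univ,
      ENNReal.ofReal_sub _ hp, ENNReal.ofReal_one]
  -- Few entries below `p` means many in the complement, of probability `1 - p`. As `2 - p ≤ 2
  -- exp(-p/2)`, the exponent per unit of `p * F.card` is `-(1 - log 2)/2`, below `-1/8`.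
  refine (measure_mono fun v hv => ?_).trans ((measure_count_ge F hBm.compl (sub_nonneg.2 hp')
    hvol (F.card - p * F.card / 2)).trans (ENNReal.ofReal_le_ofReal ?_))
  · rw [Set.mem_ofPred_eq] at hv ⊢
    have := Finset.card_filter_add_card_filter_not (s := F) (fun s => (v s : ℝ) < p)
    have h2 : ((F.filter fun s => (v s : ℝ) < p).card : ℝ) +
      (F.filter fun s => ¬ (v s : ℝ) < p).card = F.card := by exact_mod_cast this
    simp only [Set.mem_compl_iff, Set.mem_ofPred_eq]
    linarith
  rw [div_le_iff₀ (by positivity), Real.rpow_def_of_pos (by norm_num), ← Real.exp_add]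
  have h1 : (1 + (1 - p)) ^ F.card ≤ Real.exp (F.card * (Real.log 2 - p / 2)) := by
    rw [Real.exp_nat_mul]
    refine pow_le_pow_left₀ (by linarith) ?_ _
    rw [Real.exp_sub, Real.exp_log (by norm_num), le_div_iff₀ (Real.exp_pos _)]
    have e1 : Real.exp (p / 2) ≤ (1 - p / 2)⁻¹ := by
      rw [le_inv_comm₀ (Real.exp_pos _) (by linarith), ← Real.exp_neg]
      linarith [Real.add_one_le_exp (-(p / 2))]
    calc (1 + (1 - p)) * Real.exp (p / 2) ≤ (1 + (1 - p)) * (1 - p / 2)⁻¹ :=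
          mul_le_mul_of_nonneg_left e1 (by linarith)
      _ = 2 := by
          have : 1 - p / 2 ≠ 0 := by linarith
          have h' : 2 - p ≠ 0 := by linarith
          field_simp
          ring
  refine h1.trans (Real.exp_le_exp.2 ?_)
  have := Real.log_two_lt_d9
  have hm : 0 ≤ p * F.card := by positivity
  nlinarith

end Chernoff

/-! ### Resampling one coordinate of the tape -/

/-- The law of the random bits for the subsamples. -/
noncomputable def bitsMeasure (n : ℕ) : Measure (ℕ → Fin n → unitInterval) :=
  Measure.infinitePi fun _ : ℕ => Measure.pi fun _ : Fin n => (volume : Measure unitInterval)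

instance (n : ℕ) : IsProbabilityMeasure (bitsMeasure n) := by unfold bitsMeasure; infer_instance

instance (n : ℕ) : IsProbabilityMeasure (tapeMeasure n) := by unfold tapeMeasure; infer_instance

theorem bitsMeasure_eq (n : ℕ) : bitsMeasure n =
    (Measure.infinitePi fun _ : ℕ × Fin n => (volume : Measure unitInterval)).map
      (MeasurableEquiv.curry ℕ (Fin n) unitInterval) := by
  rw [Measure.infinitePi_map_curry (fun (_ : ℕ) (_ : Fin n) => (volume : Measure unitInterval))]
  simp [bitsMeasure, Measure.infinitePi_eq_pi]

/-- The probability that finitely many bits lie in given sets. -/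
theorem bitsMeasure_box {n : ℕ} (F : Finset (ℕ × Fin n)) (t : ℕ × Fin n → Set unitInterval)
    (ht : ∀ q, MeasurableSet (t q)) :
    bitsMeasure n {r | ∀ q ∈ F, r q.1 q.2 ∈ t q} = ∏ q ∈ F, volume (t q) := by
  rw [bitsMeasure_eq, MeasurableEquiv.map_apply,
    ← Measure.infinitePi_pi (μ := fun _ : ℕ × Fin n => (volume : Measure unitInterval))
      (s := F) (t := t) fun q _ => ht q]
  rfl

/-- Overwrite the bits of the `i`-th data point. -/
def overwrite {n : ℕ} (i : Fin n) (q : (ℕ → unitInterval) × (ℕ → Fin n → unitInterval)) :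
    ℕ → Fin n → unitInterval := fun s => Function.update (q.2 s) i (q.1 s)

theorem measurable_overwrite {n : ℕ} (i : Fin n) : Measurable (overwrite i) := by
  refine measurable_pi_lambda _ fun s => measurable_pi_lambda _ fun k => ?_
  by_cases hk : k = i
  · subst hk
    simp only [overwrite, Function.update_self]
    fun_prop
  · simp only [overwrite, Function.update_of_ne hk]
    fun_prop

/-- Redrawing all bits of one data point does not change the joint law. This expresses the
independence of those bits from all others in a form suited to Fubini. -/
theorem map_overwrite {n : ℕ} (i : Fin n) :
    ((Measure.infinitePi fun _ : ℕ => (volume : Measure unitInterval)).prod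
      (bitsMeasure n)).map (overwrite i) = bitsMeasure n := by
  classical
  set V := Measure.infinitePi fun _ : ℕ => (volume : Measure unitInterval) with hV
  have key : (V.prod (bitsMeasure n)).map
      ((MeasurableEquiv.curry ℕ (Fin n) unitInterval).symm ∘ overwrite i) =
      Measure.infinitePi fun _ : ℕ × Fin n => (volume : Measure unitInterval) := by
    refine Measure.eq_infinitePi _ fun F t ht => ?_
    rw [Measure.map_apply ((MeasurableEquiv.measurable _).comp (measurable_overwrite i))
      (MeasurableSet.pi F.countable_toSet fun q _ => ht q)]
    set F₁ := F.filter fun q => q.2 = i with hF₁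
    set F₂ := F.filter fun q => ¬ q.2 = i with hF₂
    -- A cylinder splits into a rectangle: its constraints on column `i` concern the fresh bits
    -- only, the remaining ones the old bits only.
    have hset : ((MeasurableEquiv.curry ℕ (Fin n) unitInterval).symm ∘ overwrite i) ⁻¹'
        (Set.pi (F : Set (ℕ × Fin n)) t) =
        (Set.pi ((F₁.image Prod.fst : Finset ℕ) : Set ℕ) fun s => t (s, i)) ×ˢ
          {r | ∀ q ∈ F₂, r q.1 q.2 ∈ t q} := by
      ext ⟨v, r⟩
      simp only [Set.mem_preimage, Set.mem_pi, Set.mem_prod, Function.comp_apply,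
        Set.mem_ofPred_eq, Finset.mem_coe, MeasurableEquiv.coe_curry_symm, Function.uncurry]
      constructor
      · intro h
        refine ⟨fun s hs => ?_, fun q hq => ?_⟩
        · obtain ⟨q, hq, rfl⟩ := Finset.mem_image.1 hs
          obtain ⟨hqF, rfl⟩ := Finset.mem_filter.1 hq
          simpa [overwrite] using h q hqF
        · obtain ⟨hqF, hne⟩ := Finset.mem_filter.1 hq
          simpa [overwrite, Function.update_of_ne hne] using h q hqF
      · rintro ⟨h₁, h₂⟩ q hq
        by_cases hqi : q.2 = i
        · have := h₁ q.1 (Finset.mem_image_of_mem _ (Finset.mem_filter.2 ⟨hq, hqi⟩))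
          rw [← hqi] at this
          simpa [overwrite, ← hqi] using this
        · simpa [overwrite, Function.update_of_ne hqi] using
            h₂ q (Finset.mem_filter.2 ⟨hq, hqi⟩)
    rw [hset, Measure.prod_prod, hV, Measure.infinitePi_pi _ (fun s _ => ht _),
      bitsMeasure_box F₂ t ht, Finset.prod_image]
    · rw [← Finset.prod_filter_mul_prod_filter_not F (fun q => q.2 = i)]
      congr 1
      refine Finset.prod_congr rfl fun q hq => ?_
      rw [← (Finset.mem_filter.1 hq).2]
    · intro q hq q' hq' h
      have h1 := (Finset.mem_filter.1 hq).2
      have h2 := (Finset.mem_filter.1 hq').2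
      exact Prod.ext h (h1.trans h2.symm)
  conv_rhs => rw [bitsMeasure_eq, ← key, Measure.map_map (MeasurableEquiv.measurable _)
    ((MeasurableEquiv.measurable _).comp (measurable_overwrite i))]
  rfl

end ParamTest

namespace ParamTest

/-! ### Measurability of the output in the random tape -/

theorem measurable_card_filter {ι Ω : Type*} [MeasurableSpace Ω] (F : Finset ι)
    {q : ι → Ω → Prop} [∀ s ω, Decidable (q s ω)] (h : ∀ s, MeasurableSet {ω | q s ω}) :
    Measurable fun ω => ((F.filter fun s => q s ω).card : ℝ) := by
  simp only [Finset.card_filter, Nat.cast_sum]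
  refine Finset.measurable_sum _ fun s _ => ?_
  have : (fun ω => (((if q s ω then 1 else 0 : ℕ)) : ℝ)) = fun ω => if q s ω then (1 : ℝ) else 0 := by
    funext ω; split_ifs <;> simp
  rw [this]
  exact Measurable.ite (h s) measurable_const measurable_const

/-- Any function of a random subsample of a fixed dataset is measurable in the random bits. -/
theorem measurable_thin {n : ℕ} {𝒵 : Type*} (F : Dataset n 𝒵 → ℝ) (Z : Fin n → 𝒵) (p : ℝ) :
    Measurable fun u : Fin n → unitInterval => F (thin Z p u) := by
  classical
  have hdec : Measurable fun (u : Fin n → unitInterval) (k : Fin n) => decide ((u k : ℝ) < p) := by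
    refine measurable_pi_lambda _ fun k => ?_
    have hm : MeasurableSet {u : Fin n → unitInterval | (u k : ℝ) < p} :=
      measurableSet_lt (measurable_subtype_coe.comp (measurable_pi_apply k)) measurable_const
    simpa using Measurable.ite (β := Bool) hm (measurable_const (a := true))
      (measurable_const (a := false))
  have : (fun u : Fin n → unitInterval => F (thin Z p u)) =
      (fun b : Fin n → Bool => F fun i => if b i then some (Z i) else none) ∘
        fun u k => decide ((u k : ℝ) < p) := by
    funext u
    change F _ = F _
    congr 1
    funext i
    by_cases h : (u i : ℝ) < p <;> simp [thin, h]
  rw [this]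
  exact (Measurable.of_discrete).comp hdec

section

variable {Ω : Type*} [MeasurableSpace Ω]

theorem measurable_countLE {N : ℕ} {b : Ω → ℕ → ℝ} {v : Ω → ℝ} (hb : ∀ s, Measurable fun ω => b ω s)
    (hv : Measurable v) : Measurable fun ω => (countLE N (b ω) (v ω) : ℝ) := by
  classical
  exact measurable_card_filter _ fun s => measurableSet_le (hb s) hv

theorem measurableSet_certifies {N : ℕ} {a : Ω → SignType → ℕ → ℝ} {hi lo : Ω → ℝ}
    (ha : ∀ j s, Measurable fun ω => a ω j s) (hhi : Measurable hi) (hlo : Measurable lo)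
    (j j₁ j₂ : SignType) :
    MeasurableSet {ω | ∃ i < N, Certifies N (a ω) (hi ω) (lo ω) j j₁ j₂ i} := by
  have : {ω | ∃ i < N, Certifies N (a ω) (hi ω) (lo ω) j j₁ j₂ i} =
      ⋃ i ∈ Finset.range N, {ω | Certifies N (a ω) (hi ω) (lo ω) j j₁ j₂ i} := by
    ext ω; simp
  rw [this]
  refine Finset.measurableSet_biUnion _ fun i _ => ?_
  exact (measurableSet_le hhi (measurable_countLE (ha j) (ha j i))).inter
    ((measurableSet_le (measurable_countLE (ha j₁) (ha j i)) hlo).inter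
      (measurableSet_le (measurable_countLE (ha j₂) (ha j i)) hlo))

theorem measurable_verdict {N : ℕ} {a : Ω → SignType → ℕ → ℝ} {hi lo : Ω → ℝ}
    (ha : ∀ j s, Measurable fun ω => a ω j s) (hhi : Measurable hi) (hlo : Measurable lo)
    (E : Set SignType) : MeasurableSet {ω | verdict N (a ω) (hi ω) (lo ω) ∈ E} := by
  classical
  let _ : MeasurableSpace SignType := ⊤
  have : Measurable fun ω => verdict N (a ω) (hi ω) (lo ω) := by
    unfold verdict
    exact Measurable.ite (measurableSet_certifies ha hhi hlo _ _ _) measurable_const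
      (Measurable.ite (measurableSet_certifies ha hhi hlo _ _ _) measurable_const measurable_const)
  exact this (MeasurableSpace.measurableSet_top)

end

theorem measurable_noise (P : Params) : Measurable P.noise := by
  unfold Params.noise; fun_prop

theorem measurable_hi (P : Params) : Measurable P.hi := by
  unfold Params.hi; fun_prop

theorem measurable_lo (P : Params) : Measurable P.lo := by
  unfold Params.lo; fun_prop

variable {d n : ℕ} [NeZero d] {𝒵 : Type*}

/-- The losses recorded on dataset `Z` with random bits `q`. -/
noncomputable def Task.recorded (𝒯 : Task d 𝒵) (P : Params) (Z : Fin n → 𝒵)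
    (q : ℕ → Fin n → unitInterval) : SignType → ℕ → ℝ :=
  fun j s => 𝒯.clipped P j (thin Z P.p (q s))

/-- With the dataset fixed, the losses depend on the tape only through finitely many possible
subsamples, so no measurability of the task is needed for privacy. -/
theorem Task.measurableSet_answer (𝒯 : Task d 𝒵) (P : Params) (Z : Fin n → 𝒵) (E : Set SignType) :
    MeasurableSet {r : unitInterval × (ℕ → Fin n → unitInterval) |
      verdictAt P (𝒯.recorded P Z r.2) (P.noise r.1) ∈ E} := by
  have hn : Measurable fun r : unitInterval × (ℕ → Fin n → unitInterval) => P.noise r.1 :=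
    (measurable_noise P).comp (measurable_subtype_coe.comp measurable_fst)
  refine measurable_verdict (fun j s => ?_) ((measurable_hi P).comp hn) ((measurable_lo P).comp hn) E
  exact (measurable_thin _ Z P.p).comp ((measurable_pi_apply s).comp measurable_snd)

/-! ### Sparsity of the affected subsamples -/

/-- The losses recorded on dataset `Z` with random bits `q` if the `i`-th point is removed. -/
noncomputable def Task.recordedWithout (𝒯 : Task d 𝒵) (P : Params) (Z : Fin n → 𝒵) (i : Fin n)
    (q : ℕ → Fin n → unitInterval) : SignType → ℕ → ℝ :=
  fun j s => 𝒯.clipped P j (remove (thin Z P.p (q s)) i)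

/-- The subsamples that contain the `i`-th point. -/
def hitBy (P : Params) (i : Fin n) (q : ℕ → Fin n → unitInterval) : Set ℕ :=
  {s | (q s i : ℝ) < P.p}

/-- The `i`-th entry is blanked in any case, so its bits do not matter: the reference losses are
independent of which subsamples are hit. -/
theorem recordedWithout_overwrite (𝒯 : Task d 𝒵) (P : Params) (Z : Fin n → 𝒵) (i : Fin n)
    (v : ℕ → unitInterval) (q : ℕ → Fin n → unitInterval) :
    𝒯.recordedWithout P Z i (overwrite i (v, q)) = 𝒯.recordedWithout P Z i q := by
  funext j s
  have : remove (thin Z P.p (overwrite i (v, q) s)) i = remove (thin Z P.p (q s)) i := by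
    funext k
    by_cases hk : k = i
    · subst hk; simp [remove]
    · simp [remove, thin, overwrite, hk]
  unfold Task.recordedWithout
  rw [this]

-- Resample the bits of the `i`-th point and condition on the rest. The level set is then fixed with
-- at least `r₀` elements, and each of them is hit independently with probability `p`.
open Classical in
theorem measure_dense_le (𝒯 : Task d 𝒵) {P : Params} (hP : P.Valid) (Z : Fin n → 𝒵) (i : Fin n)
    (N : ℕ) (r₀ : ℝ) (j : SignType) (s₀ : ℕ) :
    bitsMeasure n {q | r₀ ≤ countLE N (𝒯.recordedWithout P Z i q j) (𝒯.recordedWithout P Z i q j s₀) ∧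
      2 * P.p * countLE N (𝒯.recordedWithout P Z i q j) (𝒯.recordedWithout P Z i q j s₀) ≤
      (((Finset.range N).filter fun s => 𝒯.recordedWithout P Z i q j s ≤
        𝒯.recordedWithout P Z i q j s₀ ∧ s ∈ hitBy P i q).card : ℝ)} ≤
      ENNReal.ofReal (Real.exp (-(P.p * r₀ / 3))) := by
  set A := {q | r₀ ≤ countLE N (𝒯.recordedWithout P Z i q j) (𝒯.recordedWithout P Z i q j s₀) ∧
      2 * P.p * countLE N (𝒯.recordedWithout P Z i q j) (𝒯.recordedWithout P Z i q j s₀) ≤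
      (((Finset.range N).filter fun s => 𝒯.recordedWithout P Z i q j s ≤
        𝒯.recordedWithout P Z i q j s₀ ∧ s ∈ hitBy P i q).card : ℝ)} with hA
  have hrec : ∀ s, Measurable fun q : ℕ → Fin n → unitInterval => 𝒯.recordedWithout P Z i q j s :=
    fun s => (measurable_thin (fun S => 𝒯.clipped P j (remove S i)) Z P.p).comp
      (measurable_pi_apply s)
  have hAm : MeasurableSet A := by
    have hc := measurable_countLE (N := N) hrec (hrec s₀)
    have hK : ∀ s, MeasurableSet {q : ℕ → Fin n → unitInterval | 𝒯.recordedWithout P Z i q j s ≤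
        𝒯.recordedWithout P Z i q j s₀ ∧ s ∈ hitBy P i q} := fun s => by
      have hbit : Measurable fun q : ℕ → Fin n → unitInterval => (q s i : ℝ) := by fun_prop
      exact (measurableSet_le (hrec s) (hrec s₀)).inter (measurableSet_lt hbit measurable_const)
    have hcard := measurable_card_filter (Finset.range N) hK
    exact (measurableSet_le measurable_const hc).inter
      (measurableSet_le (hc.const_mul (2 * P.p)) hcard)
  have hmem : ∀ q, q ∈ A → r₀ ≤ countLE N (𝒯.recordedWithout P Z i q j)
      (𝒯.recordedWithout P Z i q j s₀) ∧
      2 * P.p * countLE N (𝒯.recordedWithout P Z i q j) (𝒯.recordedWithout P Z i q j s₀) ≤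
      (((Finset.range N).filter fun s => 𝒯.recordedWithout P Z i q j s ≤
        𝒯.recordedWithout P Z i q j s₀ ∧ s ∈ hitBy P i q).card : ℝ) := fun q hq => hq
  clear_value A
  clear hrec
  rw [← map_overwrite i, Measure.map_apply (measurable_overwrite i) hAm,
    Measure.prod_apply_symm (measurable_overwrite i hAm)]
  refine (lintegral_mono (g := fun _ => ENNReal.ofReal (Real.exp (-(P.p * r₀ / 3)))) fun q => ?_).trans
    (by simp)
  set b := 𝒯.recordedWithout P Z i q j with hb
  -- Deterministic once `q` is fixed; only the fresh bits `v` are still random.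
  set X := (Finset.range N).filter fun s => b s ≤ b s₀ with hX
  have hcard : countLE N b (b s₀) = X.card := by unfold countLE; congr
  by_cases hr : r₀ ≤ (X.card : ℝ)
  · refine (measure_mono fun v hv => ?_).trans ((measure_binomial_upper X hP.p_pos.le
      (by linarith [hP.p_lt])).trans (ENNReal.ofReal_le_ofReal (Real.exp_le_exp.2 ?_)))
    · have hv2 := (hmem _ hv).2
      rw [recordedWithout_overwrite, ← hb, hcard] at hv2
      refine hv2.trans (le_of_eq ?_)
      rw [hX, Finset.filter_filter]
      congr
      funext s
      simp [hitBy, overwrite]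
    · have := mul_le_mul_of_nonneg_left hr hP.p_pos.le
      linarith
  · refine (measure_mono_null (t := ∅) (fun v hv => ?_) (by simp)).le.trans (zero_le)
    have hv1 := (hmem _ hv).1
    rw [recordedWithout_overwrite, ← hb, hcard] at hv1
    exact absurd hv1 hr

/-- The random bits for which the subsamples hit by the `i`-th point are sparse. -/
def sparseBits (𝒯 : Task d 𝒵) (P : Params) (Z : Fin n → 𝒵) (i : Fin n) :
    Set (ℕ → Fin n → unitInterval) :=
  {q | ∀ j, Sparse P.numSamples (𝒯.recordedWithout P Z i q j) (hitBy P i q) P.p P.floorCount}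

/-! ### Bounds on the parameters -/

namespace Params

variable {P : Params}

theorem Valid.center_nonneg (hP : P.Valid) : 0 ≤ P.center := by
  have h1 := hP.p_pos; have h2 := hP.ε_pos; have h3 := hP.δ_pos; have h4 := hP.δ_lt_one
  have : 0 ≤ Real.log (8 / P.δ) := Real.log_nonneg (by rw [le_div_iff₀ h3]; linarith)
  unfold center; positivity

theorem Valid.one_le_depth (hP : P.Valid) : 1 ≤ P.depth := by
  have h3 := hP.δ_pos; have h4 := hP.δ_lt_one
  have : 1 ≤ Real.log (24 / P.δ) := by
    rw [Real.le_log_iff_exp_le (by positivity), le_div_iff₀ h3]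
    nlinarith [Real.exp_one_lt_d9, Real.exp_pos 1]
  have := hP.center_nonneg
  unfold depth; linarith

theorem Valid.floorCount_ge (hP : P.Valid) : 1 ≤ P.floorCount := by
  have h1 := hP.p_pos; have h2 := hP.p_lt; have h3 := hP.one_le_depth
  have : 1 ≤ 10 * P.depth / P.p := by rw [le_div_iff₀ h1]; linarith
  unfold floorCount; nlinarith

theorem Valid.one_le_budget (hP : P.Valid) : 1 ≤ P.budget := by
  have := hP.floorCount_ge
  have := Real.one_le_exp (x := 4 * P.center) (by linarith [hP.center_nonneg])
  unfold budget; nlinarith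

theorem Valid.numSamples_le (hP : P.Valid) : (P.numSamples : ℝ) ≤ 2 * P.budget := by
  have h := hP.one_le_budget
  have := Nat.ceil_lt_add_one (a := P.budget) (by linarith)
  unfold numSamples; linarith

/-- Union bound over three regions and `N` levels. The choice of `depth` makes the Chernoff exponent
exceed `log(budget * 24/δ)`, and `N` is at most twice the budget. -/
theorem Valid.sparse_tail (hP : P.Valid) :
    3 * (P.numSamples * Real.exp (-(P.p * P.floorCount / 3))) ≤ P.δ / 4 := by
  have h1 := hP.p_pos; have h2 := hP.p_lt; have h3 := hP.one_le_depth; have h4 := hP.δ_pos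
  have hr := hP.floorCount_ge
  set w := 10 * P.depth / P.p with hw
  have hwp : w * P.p = 10 * P.depth := by rw [hw]; field_simp
  have hw0 : 0 < w := by positivity
  have hr' : P.floorCount = w * w := rfl
  -- Since `floorCount` is the square of `w = 10 * depth / p`, the right side is `10 * depth * w /
  -- 3`, linear in `w`, and dominates `2 log w + depth`.
  have hmain : Real.log P.floorCount + P.depth ≤ P.p * P.floorCount / 3 := by
    rw [hr', Real.log_mul hw0.ne' hw0.ne']
    have hl := Real.log_le_sub_one_of_pos hw0
    have e : P.p * (w * w) = 10 * P.depth * w := by rw [← hwp]; ring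
    rw [e]
    have : P.depth ≤ w := by rw [hw, le_div_iff₀ h1]; nlinarith
    nlinarith
  have hexp : P.budget * (24 / P.δ) ≤ Real.exp (P.p * P.floorCount / 3) := by
    refine le_trans (le_of_eq ?_) (Real.exp_le_exp.2 hmain)
    rw [Real.exp_add, Real.exp_log (by linarith), depth, Real.exp_add,
      Real.exp_log (by positivity), budget]
    ring
  have hN := hP.numSamples_le
  rw [Real.exp_neg]
  have hE := Real.exp_pos (P.p * P.floorCount / 3)
  rw [← div_eq_mul_inv, mul_div_assoc', div_le_iff₀ hE]
  have : P.budget * (24 / P.δ) * (P.δ / 4) = 6 * P.budget := by field_simp; ring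
  nlinarith [mul_le_mul_of_nonneg_right hexp (show 0 ≤ P.δ / 4 by linarith)]

end Params

theorem measure_sparseBits_compl (𝒯 : Task d 𝒵) {P : Params} (hP : P.Valid) (Z : Fin n → 𝒵)
    (i : Fin n) : bitsMeasure n (sparseBits 𝒯 P Z i)ᶜ ≤ ENNReal.ofReal (P.δ / 4) := by
  classical
  set N := P.numSamples
  have hsub : (sparseBits 𝒯 P Z i)ᶜ ⊆ ⋃ j ∈ (Finset.univ : Finset SignType),
      ⋃ s₀ ∈ Finset.range N,
      {q | P.floorCount ≤
        countLE N (𝒯.recordedWithout P Z i q j) (𝒯.recordedWithout P Z i q j s₀) ∧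
      2 * P.p * countLE N (𝒯.recordedWithout P Z i q j) (𝒯.recordedWithout P Z i q j s₀) ≤
      (((Finset.range N).filter fun s => 𝒯.recordedWithout P Z i q j s ≤
        𝒯.recordedWithout P Z i q j s₀ ∧ s ∈ hitBy P i q).card : ℝ)} := by
    intro q hq
    simp only [Set.mem_compl_iff, sparseBits, Set.mem_ofPred_eq, not_forall, Sparse] at hq
    obtain ⟨j, s₀, hs₀, h1, h2⟩ := hq
    simp only [Set.mem_iUnion]
    refine ⟨j, Finset.mem_univ _, s₀, Finset.mem_range.2 hs₀, h1, ?_⟩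
    exact (not_le.1 h2).le
  refine (measure_mono hsub).trans ((measure_biUnion_finset_le _ _).trans
    ((Finset.sum_le_sum fun j _ => (measure_biUnion_finset_le _ _).trans
      (Finset.sum_le_sum fun s₀ _ => measure_dense_le 𝒯 hP Z i N P.floorCount j s₀)).trans ?_))
  simp only [Finset.sum_const, Finset.card_range, nsmul_eq_mul]
  have hc : (Finset.univ : Finset SignType).card = 3 := by decide
  rw [hc, ← ENNReal.ofReal_natCast N, ← ENNReal.ofReal_mul (by positivity),
    ← ENNReal.ofReal_natCast 3, ← ENNReal.ofReal_mul (by positivity)]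
  exact ENNReal.ofReal_le_ofReal (by exact_mod_cast hP.sparse_tail)

/-! ### Privacy -/

omit [NeZero d] in
theorem Task.lossAt_mono (𝒯 : Task d 𝒵) (θ : Fin d → ℝ) {S S' : Dataset n 𝒵}
    (h : ∀ k, S k = none ∨ S k = S' k) : 𝒯.lossAt θ S ≤ 𝒯.lossAt θ S' := by
  unfold Task.lossAt
  gcongr with k
  rcases h k with hk | hk <;> simp [hk]

theorem Task.constrainedLoss_mono (𝒯 : Task d 𝒵) (π : Set ℝ) {S S' : Dataset n 𝒵}
    (h : ∀ k, S k = none ∨ S k = S' k) : 𝒯.constrainedLoss π S ≤ 𝒯.constrainedLoss π S' :=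
  iInf₂_mono fun θ _ => by exact_mod_cast 𝒯.lossAt_mono θ h

theorem Task.clipped_mono (𝒯 : Task d 𝒵) (P : Params) (j : SignType) {S S' : Dataset n 𝒵}
    (h : ∀ k, S k = none ∨ S k = S' k) : 𝒯.clipped P j S ≤ 𝒯.clipped P j S' :=
  ENNReal.toReal_mono (ne_top_of_le_ne_top ENNReal.ofReal_ne_top (min_le_right _ _))
    (min_le_min_right _ (𝒯.constrainedLoss_mono _ h))

theorem remove_le (S : Dataset n 𝒵) (i : Fin n) (k : Fin n) :
    remove S i k = none ∨ remove S i k = S k := by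
  by_cases hk : k = i
  · subst hk; simp [remove]
  · right; simp [remove, hk]

theorem recordedWithout_le (𝒯 : Task d 𝒵) (P : Params) (Z : Fin n → 𝒵) (i : Fin n)
    (q : ℕ → Fin n → unitInterval) (j : SignType) (s : ℕ) :
    𝒯.recordedWithout P Z i q j s ≤ 𝒯.recorded P Z q j s :=
  𝒯.clipped_mono P j (remove_le _ i)

theorem recordedWithout_eq (𝒯 : Task d 𝒵) (P : Params) (Z : Fin n → 𝒵) (i : Fin n)
    (q : ℕ → Fin n → unitInterval) (j : SignType) {s : ℕ} (hs : s ∉ hitBy P i q) :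
    𝒯.recorded P Z q j s = 𝒯.recordedWithout P Z i q j s := by
  have : remove (thin Z P.p (q s)) i = thin Z P.p (q s) := by
    funext k
    by_cases hk : k = i
    · subst hk
      have : ¬ (q s k : ℝ) < P.p := hs
      simp [remove, thin, this]
    · simp [remove, hk]
  unfold Task.recordedWithout Task.recorded
  rw [this]

/-- Both neighbors share the same reference losses, so `Sparse` for one serves both directions of
the comparison. -/
theorem recordedWithout_congr (𝒯 : Task d 𝒵) (P : Params) {Z Z' : Fin n → 𝒵} {i : Fin n}
    (h : ∀ k, k ≠ i → Z k = Z' k) (q : ℕ → Fin n → unitInterval) :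
    𝒯.recordedWithout P Z i q = 𝒯.recordedWithout P Z' i q := by
  funext j s
  have : remove (thin Z P.p (q s)) i = remove (thin Z' P.p (q s)) i := by
    funext k
    by_cases hk : k = i
    · subst hk; simp [remove]
    · simp [remove, thin, hk, h k hk]
  unfold Task.recordedWithout
  rw [this]

/-- Privacy for fixed subsamples in which the differing point is sparse. -/
theorem volume_answer_le (𝒯 : Task d 𝒵) {P : Params} (hP : P.Valid) {Z Z' : Fin n → 𝒵} {i : Fin n}
    (h : ∀ k, k ≠ i → Z k = Z' k) {q : ℕ → Fin n → unitInterval} (hq : q ∈ sparseBits 𝒯 P Z i)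
    (E : Set SignType) :
    volume ({u : unitInterval | verdictAt P (𝒯.recorded P Z q) (P.noise u) ∈ E} ∩ goodNoise P) ≤
      ENNReal.ofReal (Real.exp P.ε) *
        volume {u : unitInterval | verdictAt P (𝒯.recorded P Z' q) (P.noise u) ∈ E} := by
  have hr : 0 < P.floorCount := by linarith [hP.floorCount_ge]
  have hp := hP.p_pos
  have hε := hP.ε_pos
  have hle := recordedWithout_le 𝒯 P Z i q
  have hle' : ∀ j s, 𝒯.recordedWithout P Z i q j s ≤ 𝒯.recorded P Z' q j s := by
    rw [recordedWithout_congr 𝒯 P h q]; exact recordedWithout_le 𝒯 P Z' i q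
  have heq := fun j s (hs : s ∉ hitBy P i q) => recordedWithout_eq 𝒯 P Z i q j hs
  have heq' : ∀ j, ∀ s ∉ hitBy P i q,
      𝒯.recorded P Z' q j s = 𝒯.recordedWithout P Z i q j s := by
    rw [recordedWithout_congr 𝒯 P h q]
    exact fun j s hs => recordedWithout_eq 𝒯 P Z' i q j hs
  set A := {u : unitInterval | verdictAt P (𝒯.recorded P Z q) (P.noise u) ∈ E} ∩ goodNoise P
  set A' := {u : unitInterval | verdictAt P (𝒯.recorded P Z' q) (P.noise u) ∈ E}
  have shift : ∀ c : ℝ, (c = 1 ∨ c = -1) → (∀ u ∈ A,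
      verdictAt P (𝒯.recorded P Z' q) (P.noise u + c * (4 * P.p)) ∈ E) →
      volume A ≤ ENNReal.ofReal (Real.exp P.ε) * volume A' := by
    intro c hc hA
    have hL : ((Real.exp P.ε).toNNReal : ℝ) = Real.exp P.ε :=
      Real.coe_toNNReal _ (Real.exp_pos _).le
    refine volume_le_of_oddsShift (κ := Real.exp (c * P.ε)) (L := (Real.exp P.ε).toNNReal)
      (Real.exp_pos _) ?_ ?_ fun u hu => ?_
    · rw [hL, Real.exp_le_exp]; rcases hc with rfl | rfl <;> linarith
    · rw [hL, ← Real.exp_neg, Real.exp_le_exp]; rcases hc with rfl | rfl <;> linarith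
    · refine ⟨⟨_, oddsShift_mem (Real.exp_pos (c * P.ε)) u.2.1 u.2.2⟩, ?_, rfl⟩
      have := hA u hu
      rw [← noise_oddsShift hP hu.2 c] at this
      exact this
  -- If `0 ∈ E`, raise the noise: a nonzero verdict for `Z'` at `x + 4p` comes down to `Z` at `x`,
  -- hence lies in `E`. Otherwise the verdict for `Z` is nonzero, and lowering the noise carries it
  -- to `Z'`.
  by_cases h0 : (0 : SignType) ∈ E
  · refine shift 1 (Or.inl rfl) fun u hu => ?_
    obtain ⟨hb1, hb2⟩ := noise_bounds hP hu.2
    by_cases hz : verdictAt P (𝒯.recorded P Z' q) (P.noise u + 1 * (4 * P.p)) = 0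
    · rwa [hz]
    · have := verdictAt_transfer hp hP.p_lt hr hq hle' hle heq' heq (by linarith) (by linarith) hz
      rw [one_mul, add_sub_cancel_right] at this
      rw [one_mul, ← this]
      exact hu.1
  · refine shift (-1) (Or.inr rfl) fun u hu => ?_
    obtain ⟨hb1, hb2⟩ := noise_bounds hP hu.2
    have hu1 : verdictAt P (𝒯.recorded P Z q) (P.noise u) ∈ E := hu.1
    have := verdictAt_transfer hp hP.p_lt hr hq hle hle' heq heq' (x := P.noise u) (by linarith)
      (by linarith) fun hz => h0 (hz ▸ hu1)
    rw [neg_one_mul, ← sub_eq_add_neg, this]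
    exact hu1

/-- The map that extracts from the tape what the mechanism uses. -/
def usedTape (n : ℕ) (r : Tape n) : unitInterval × (ℕ → Fin n → unitInterval) := (r.1 0, r.2)

theorem measurePreserving_usedTape (n : ℕ) :
    MeasurePreserving (usedTape n) (tapeMeasure n) (volume.prod (bitsMeasure n)) :=
  (measurePreserving_eval_infinitePi (fun _ : ℕ => (volume : Measure unitInterval)) 0).prod
    (MeasurePreserving.id _)

theorem isDP_mechanism (𝒯 : Task d 𝒵) {P : Params} (hP : P.Valid) (n : ℕ) :
    IsDP n mechanism 𝒯 P := by
  intro Z Z' hZ E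
  obtain ⟨i, -, hi⟩ := hZ
  have hZi : ∀ k, k ≠ i → Z k = Z' k := fun k hk => by
    by_contra hne; exact hk (hi k hne)
  rw [outputProb_eq, outputProb_eq]
  have hexp : 1 ≤ ENNReal.ofReal (Real.exp P.ε) := by
    rw [← ENNReal.ofReal_one]
    exact ENNReal.ofReal_le_ofReal (Real.one_le_exp hP.ε_pos.le)
  by_cases hδ : P.δ < 2 / 3
  swap
  · have : ∀ W : Fin n → 𝒵, {r | 𝒯.output P W r ∈ E} = {r : Tape n | coin (r.1 0) ∈ E} := by
      intro W; simp [Task.output, hδ]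
    rw [this, this]
    exact (le_mul_of_one_le_left (zero_le) hexp).trans le_self_add
  have hout : ∀ W : Fin n → 𝒵, tapeMeasure n {r | 𝒯.output P W r ∈ E} =
      ∫⁻ q, volume {u : unitInterval | verdictAt P (𝒯.recorded P W q) (P.noise u) ∈ E}
        ∂bitsMeasure n := by
    intro W
    have e : {r | 𝒯.output P W r ∈ E} = usedTape n ⁻¹'
        {r | verdictAt P (𝒯.recorded P W r.2) (P.noise r.1) ∈ E} := by
      ext r; simp only [Task.output, hδ, if_true]; rfl
    rw [e, (measurePreserving_usedTape n).measure_preimage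
      (𝒯.measurableSet_answer P W E).nullMeasurableSet,
      Measure.prod_apply_symm (𝒯.measurableSet_answer P W E)]
    rfl
  rw [hout, hout]
  set G := sparseBits 𝒯 P Z i
  set f : (Fin n → 𝒵) → (ℕ → Fin n → unitInterval) → ℝ≥0∞ := fun W q =>
    volume {u : unitInterval | verdictAt P (𝒯.recorded P W q) (P.noise u) ∈ E} with hf
  have hfm : ∀ W, Measurable (f W) := fun W =>
    measurable_measure_prodMk_right (𝒯.measurableSet_answer P W E)
  -- A measurable hull, so that the indicator of the bad bits can be integrated without proving `G`
  -- measurable.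
  set B := toMeasurable (bitsMeasure n) Gᶜ
  have hpt : ∀ q, f Z q ≤ ENNReal.ofReal (Real.exp P.ε) * f Z' q +
      (ENNReal.ofReal (P.δ / 4) + B.indicator 1 q) := by
    intro q
    by_cases hq : q ∈ B
    · refine le_trans (prob_le_one.trans ?_) le_add_self
      simp [hq]
    · have hqG : q ∈ G := by
        by_contra hcon; exact hq (subset_toMeasurable _ _ hcon)
      have h1 : f Z q ≤ volume ({u : unitInterval |
          verdictAt P (𝒯.recorded P Z q) (P.noise u) ∈ E} ∩ goodNoise P) +
          volume (goodNoise P)ᶜ := by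
        refine (measure_mono fun u hu => ?_).trans (measure_union_le _ _)
        by_cases hg : u ∈ goodNoise P
        · exact Or.inl ⟨hu, hg⟩
        · exact Or.inr hg
      refine h1.trans (add_le_add (volume_answer_le 𝒯 hP hZi hqG E)
        ((volume_goodNoise_compl hP).trans le_self_add))
  calc ∫⁻ q, f Z q ∂bitsMeasure n
      ≤ ∫⁻ q, (ENNReal.ofReal (Real.exp P.ε) * f Z' q +
        (ENNReal.ofReal (P.δ / 4) + B.indicator 1 q)) ∂bitsMeasure n := lintegral_mono hpt
    _ = ENNReal.ofReal (Real.exp P.ε) * ∫⁻ q, f Z' q ∂bitsMeasure n +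
        (ENNReal.ofReal (P.δ / 4) + bitsMeasure n B) := by
      rw [lintegral_add_left ((hfm Z').const_mul _), lintegral_const_mul _ (hfm Z'),
        lintegral_add_left measurable_const,
        lintegral_indicator_one (measurableSet_toMeasurable _ _), lintegral_const, measure_univ,
        mul_one]
    _ ≤ _ := by
      refine add_le_add le_rfl ?_
      rw [measure_toMeasurable]
      refine (add_le_add le_rfl (measure_sparseBits_compl 𝒯 hP Z i)).trans ?_
      have := hP.δ_pos
      rw [← ENNReal.ofReal_add (by linarith) (by linarith)]
      exact ENNReal.ofReal_le_ofReal (by linarith)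

end ParamTest

namespace ParamTest

/-! ### Running time -/

namespace Params

variable {P : Params}

theorem two_fifths_le_log {δ : ℝ} (h0 : 0 < δ) (h : δ < 2 / 3) : 2 / 5 ≤ Real.log (1 / δ) := by
  have h1 : Real.log (3 / 2) ≤ Real.log (1 / δ) :=
    Real.log_le_log (by norm_num) (by rw [le_div_iff₀ h0]; linarith)
  have h2 : 2 / 5 ≤ Real.log (3 / 2) := by
    rw [Real.le_log_iff_exp_le (by norm_num), show (2 / 5 : ℝ) = 2 * (1 / 5) by norm_num,
      ← Real.log_le_log_iff (Real.exp_pos _) (by norm_num), Real.log_exp]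
    have := Real.one_sub_inv_le_log_of_pos (show (0 : ℝ) < 3 / 2 by norm_num)
    have h5 : Real.log ((3 / 2) ^ 5) = 5 * Real.log (3 / 2) := by
      rw [Real.log_pow]; norm_num
    have h6 : 2 ≤ Real.log ((3 / 2) ^ 5) := by
      rw [Real.le_log_iff_exp_le (by norm_num), show (2 : ℝ) = 1 + 1 by norm_num, Real.exp_add]
      nlinarith [Real.exp_one_lt_d9, Real.exp_pos 1]
    linarith
  exact h2.trans h1

theorem log_const_div_le {c k δ : ℝ} (hc : 0 < c) (h0 : 0 < δ) (h : δ < 2 / 3)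
    (hk : Real.log c ≤ k * (2 / 5)) (hk0 : 0 ≤ k) :
    Real.log (c / δ) ≤ (k + 1) * Real.log (1 / δ) := by
  have := two_fifths_le_log h0 h
  rw [div_eq_mul_one_div, Real.log_mul hc.ne' (by positivity)]
  nlinarith

theorem log_le_of_le_exp_nat {c : ℝ} (hc : 0 < c) (k : ℕ) (h : c ≤ (27 / 10) ^ k) :
    Real.log c ≤ k := by
  rw [Real.log_le_iff_le_exp hc]
  refine h.trans ?_
  rw [← Real.exp_one_pow]
  exact pow_le_pow_left₀ (by norm_num) (by linarith [Real.exp_one_gt_d9]) _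

/-- With `l = log(1/δ) ≥ 2/5`, the bounds `log(8/δ) ≤ 7l` and `log(24/δ) ≤ 11l` absorb the
constants. The exponent `112 = 4·4·7` comes from `exp(4 * center)`, and a further `2` from the
factor `1 + p/ε` in `depth`, squared in `floorCount`. -/
theorem Valid.budget_le (hP : P.Valid) (hδ : P.δ < 2 / 3) :
    P.budget ≤ 2800 ^ 2 * 3 ^ 8 * (Real.log (1 / P.δ) / P.p) ^ 2 *
      Real.exp (P.p / P.ε * Real.log (1 / P.δ)) ^ 114 := by
  have hp := hP.p_pos; have hp' := hP.p_lt; have hε := hP.ε_pos; have h0 := hP.δ_pos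
  have hl := two_fifths_le_log h0 hδ
  have h8 : Real.log (8 / P.δ) ≤ 7 * Real.log (1 / P.δ) := by
    have h := log_const_div_le (c := 8) (k := 6) (by norm_num) h0 hδ (by
      rw [show (8 : ℝ) = 2 ^ 3 by norm_num, Real.log_pow]
      norm_num
      linarith [Real.log_two_lt_d9]) (by norm_num)
    linarith
  have h24 : Real.log (24 / P.δ) ≤ 11 * Real.log (1 / P.δ) := by
    have h := log_const_div_le (c := 24) (k := 10) (by norm_num) h0 hδ (by
      have := log_le_of_le_exp_nat (c := 24) (by norm_num) 4 (by norm_num)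
      push_cast at this; linarith) (by norm_num)
    linarith
  set l := Real.log (1 / P.δ)
  set x := P.p / P.ε with hx
  have hx0 : 0 < x := by positivity
  have hxl : 0 < x * l := by positivity
  have hc : 4 * P.center ≤ 8 + 112 * (x * l) := by
    have e : P.center = 8 * P.p + 4 * x * Real.log (8 / P.δ) := by
      rw [center, hx]; ring
    rw [e]
    have := mul_le_mul_of_nonneg_left h8 hx0.le
    nlinarith
  set E := Real.exp (x * l) with hE
  have hE1 : 1 + x * l ≤ E := by linarith [Real.add_one_le_exp (x * l)]
  -- A bare `p/ε` may not appear in the final bound; since `l ≥ 2/5`, it is at most `(5/2) x l` and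
  -- disappears into the exponential.
  have h1x : 1 + x ≤ 5 / 2 * E := by nlinarith
  have hexp : Real.exp (4 * P.center) ≤ 3 ^ 8 * E ^ 112 := by
    refine (Real.exp_le_exp.2 hc).trans ?_
    rw [Real.exp_add, hE, ← Real.exp_nat_mul, show (8 : ℝ) = (8 : ℕ) * 1 by norm_num,
      Real.exp_nat_mul]
    push_cast
    refine mul_le_mul_of_nonneg_right ?_ (Real.exp_pos _).le
    exact pow_le_pow_left₀ (Real.exp_pos _).le (by linarith [Real.exp_one_lt_d9]) 8
  have hdepth : 10 * P.depth / P.p ≤ 2800 * (l / P.p) * E := by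
    have h1 : P.depth ≤ 112 * l * (1 + x) := by unfold depth; nlinarith
    have h2 : P.depth ≤ 280 * l * E := by nlinarith
    rw [div_le_iff₀ hp]
    have : 2800 * (l / P.p) * E * P.p = 2800 * l * E := by field_simp
    linarith
  have hfl : P.floorCount ≤ (2800 * (l / P.p) * E) ^ 2 := by
    have h0 : 0 ≤ 10 * P.depth / P.p := by have := hP.one_le_depth; positivity
    unfold floorCount
    nlinarith
  calc P.budget ≤ (2800 * (l / P.p) * E) ^ 2 * (3 ^ 8 * E ^ 112) :=
        mul_le_mul hfl hexp (Real.exp_pos _).le (sq_nonneg _)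
    _ = _ := by ring

end Params

theorem haltsWithin_mechanism {d n : ℕ} [NeZero d] {𝒵 : Type*} (𝒯 : Task d 𝒵) {P : Params}
    (hP : P.Valid) (Z : Fin n → 𝒵) (r : Tape n) :
    HaltsWithin mechanism 𝒯 P Z r
      (10 ^ 30 * Real.exp (10 ^ 30 * (P.p / P.ε * Real.log (1 / P.δ))) *
        (1 + Real.log (1 / P.δ) / P.p) ^ 4) := by
  classical
  obtain ⟨T, s, e, hT, -⟩ := runs_mechanism 𝒯 P Z r
  refine ⟨T, s, e, le_trans (Nat.cast_le.2 hT) ?_⟩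
  have hp := hP.p_pos; have hε := hP.ε_pos; have h0 := hP.δ_pos
  have hl : 0 ≤ Real.log (1 / P.δ) :=
    Real.log_nonneg (by rw [le_div_iff₀ h0]; linarith [hP.δ_lt_one])
  have hq : 0 ≤ Real.log (1 / P.δ) / P.p := by positivity
  have hxl : 0 ≤ P.p / P.ε * Real.log (1 / P.δ) := by positivity
  split_ifs with hδ
  · have hb := hP.budget_le hδ
    have hb1 := hP.one_le_budget
    have hN := hP.numSamples_le
    set E := Real.exp (P.p / P.ε * Real.log (1 / P.δ)) with hE
    set w := Real.log (1 / P.δ) / P.p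
    have hE0 : 0 < E := Real.exp_pos _
    push_cast
    have h1 : ((P.numSamples : ℝ) + 1) ^ 2 ≤ (3 * P.budget) ^ 2 :=
      pow_le_pow_left₀ (by positivity) (by linarith) 2
    have h2 : P.budget ^ 2 ≤ (2800 ^ 2 * 3 ^ 8 * w ^ 2 * E ^ 114) ^ 2 :=
      pow_le_pow_left₀ (by linarith) hb 2
    have h3 : w ^ 4 ≤ (1 + w) ^ 4 := pow_le_pow_left₀ hq (by linarith) 4
    have h4 : E ^ 228 ≤ Real.exp (10 ^ 30 * (P.p / P.ε * Real.log (1 / P.δ))) := by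
      rw [hE, ← Real.exp_nat_mul]
      refine Real.exp_le_exp.2 (mul_le_mul_of_nonneg_right (by norm_num) hxl)
    calc 1100 * ((P.numSamples : ℝ) + 1) ^ 2
        ≤ 1100 * (9 * (2800 ^ 2 * 3 ^ 8 * w ^ 2 * E ^ 114) ^ 2) := by nlinarith
      _ = (1100 * 9 * (2800 ^ 2 * 3 ^ 8) ^ 2) * (E ^ 228 * w ^ 4) := by ring
      _ ≤ 10 ^ 30 * (Real.exp (10 ^ 30 * (P.p / P.ε * Real.log (1 / P.δ))) * (1 + w) ^ 4) := by
          refine mul_le_mul (by norm_num) (mul_le_mul h4 h3 (by positivity) (Real.exp_pos _).le)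
            (by positivity) (by positivity)
      _ = _ := by ring
  · have h1 : 1 ≤ Real.exp (10 ^ 30 * (P.p / P.ε * Real.log (1 / P.δ))) :=
      Real.one_le_exp (by positivity)
    have h2 : 1 ≤ (1 + Real.log (1 / P.δ) / P.p) ^ 4 := one_le_pow₀ (by linarith)
    have h3 := one_le_mul_of_one_le_of_one_le h1 h2
    rw [mul_assoc]
    push_cast
    linarith

end ParamTest

namespace ParamTest

/-! ### A Bernstein-type bounded differences inequality -/

section Concentration

theorem integrable_of_abs_le {Ω : Type*} [MeasurableSpace Ω] {μ : Measure Ω} [IsFiniteMeasure μ]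
    {f : Ω → ℝ} (hf : Measurable f) {B : ℝ} (hB : ∀ ω, |f ω| ≤ B) : Integrable f μ :=
  Integrable.of_bound hf.aestronglyMeasurable B (Filter.Eventually.of_forall hB)

/-- The moment generating function of a small variable supported on an unlikely event. -/
theorem integral_exp_centered_le {Y : Type*} [MeasurableSpace Y] (ν : Measure Y)
    [IsProbabilityMeasure ν] {A : Set Y} (hA : MeasurableSet A) {p c s : ℝ}
    (hAp : ν.real A ≤ p) {q : Y → ℝ} (hq : Measurable q) (h0 : ∀ x, 0 ≤ q x) (h1 : ∀ x, q x ≤ c)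
    (h2 : ∀ x, x ∉ A → q x = 0) (hs : |s| * c ≤ 1) :
    ∫ x, Real.exp (s * (q x - ∫ x, q x ∂ν)) ∂ν ≤ Real.exp (s ^ 2 * c ^ 2 * p) := by
  set m := ∫ x, q x ∂ν
  have hqi : Integrable q ν := integrable_of_abs_le hq fun x => by
    rw [abs_of_nonneg (h0 x)]; exact h1 x
  have hAi : Integrable (A.indicator (fun _ => (1 : ℝ))) ν :=
    (integrable_const 1).indicator hA
  -- From `exp z ≤ 1 + z + z²` for `|z| ≤ 1`. The quadratic term lives on `A`, which yields the
  -- factor `p` in the variance.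
  have hbd : ∀ x, Real.exp (s * q x) ≤ 1 + s * q x + s ^ 2 * c ^ 2 * A.indicator (fun _ => (1 : ℝ)) x := by
    intro x
    have hz : |s * q x| ≤ 1 := by
      rw [abs_mul, abs_of_nonneg (h0 x)]
      exact (mul_le_mul_of_nonneg_left (h1 x) (abs_nonneg s)).trans hs
    have hexp := (abs_le.1 (Real.abs_exp_sub_one_sub_id_le hz)).2
    have hsq : (s * q x) ^ 2 ≤ s ^ 2 * c ^ 2 * A.indicator (fun _ => (1 : ℝ)) x := by
      by_cases hx : x ∈ A
      · rw [Set.indicator_of_mem hx, mul_one, mul_pow]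
        exact mul_le_mul_of_nonneg_left (pow_le_pow_left₀ (h0 x) (h1 x) 2) (sq_nonneg s)
      · rw [Set.indicator_of_notMem hx, h2 x hx]; simp
    linarith
  have hint : ∫ x, Real.exp (s * q x) ∂ν ≤ 1 + s * m + s ^ 2 * c ^ 2 * p := by
    have hi2 : Integrable (fun x => 1 + s * q x + s ^ 2 * c ^ 2 * A.indicator (fun _ => (1 : ℝ)) x) ν :=
      ((integrable_const 1).add (hqi.const_mul s)).add (hAi.const_mul _)
    have hi1 : Integrable (fun x => Real.exp (s * q x)) ν :=
      integrable_of_abs_le (by fun_prop) (B := Real.exp 1) fun x => by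
        rw [abs_of_pos (Real.exp_pos _), Real.exp_le_exp]
        refine (le_abs_self _).trans ?_
        rw [abs_mul, abs_of_nonneg (h0 x)]
        exact (mul_le_mul_of_nonneg_left (h1 x) (abs_nonneg s)).trans hs
    refine (integral_mono hi1 hi2 hbd).trans ?_
    have hj : Integrable (fun x => 1 + s * q x) ν := (integrable_const 1).add (hqi.const_mul s)
    rw [integral_add hj (hAi.const_mul _),
      integral_add (integrable_const 1) (hqi.const_mul s), integral_const_mul, integral_const_mul,
      integral_indicator_const _ hA]
    simp only [integral_const, probReal_univ, smul_eq_mul, mul_one]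
    have := mul_le_mul_of_nonneg_left hAp (show 0 ≤ s ^ 2 * c ^ 2 by positivity)
    linarith
  have e : ∀ x, Real.exp (s * (q x - m)) = Real.exp (-(s * m)) * Real.exp (s * q x) := fun x => by
    rw [← Real.exp_add]; ring_nf
  simp only [e, integral_const_mul]
  calc Real.exp (-(s * m)) * ∫ x, Real.exp (s * q x) ∂ν
      ≤ Real.exp (-(s * m)) * Real.exp (s * m + s ^ 2 * c ^ 2 * p) := by
        refine mul_le_mul_of_nonneg_left (hint.trans ?_) (Real.exp_pos _).le
        linarith [Real.add_one_le_exp (s * m + s ^ 2 * c ^ 2 * p)]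
    _ = _ := by rw [← Real.exp_add]; ring_nf

universe u

variable {Y : Type u} [MeasurableSpace Y] (ν : Measure Y) [IsProbabilityMeasure ν]

theorem integral_pi_succ {n : ℕ} {f : (Fin (n + 1) → Y) → ℝ} (hf : Measurable f) {B : ℝ}
    (hB : ∀ y, |f y| ≤ B) :
    ∫ y, f y ∂(Measure.pi fun _ : Fin (n + 1) => ν) =
      ∫ x, ∫ y, f (Fin.cons x y) ∂(Measure.pi fun _ : Fin n => ν) ∂ν := by
  have hmp := (measurePreserving_piFinSuccAbove (fun _ : Fin (n + 1) => ν) 0).symm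
  rw [← hmp.integral_comp', integral_prod]
  · simp [MeasurableEquiv.piFinSuccAbove_symm_apply, Fin.consEquiv]
  · exact integrable_of_abs_le (hf.comp (MeasurableEquiv.measurable _)) fun _ => hB _

theorem measurable_fin_cons {n : ℕ} :
    Measurable fun q : Y × (Fin n → Y) => (Fin.cons q.1 q.2 : Fin (n + 1) → Y) := by
  refine measurable_pi_lambda _ fun i => ?_
  refine Fin.cases ?_ (fun i => ?_) i
  · simpa using measurable_fst
  · have : Measurable fun q : Y × (Fin n → Y) => q.2 i :=
      (measurable_pi_apply i).comp measurable_snd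
    simpa using this

/-- Truncated martingale approximation of a function of independent variables whose discrete
derivatives are small with high probability, uniformly in a parameter `ω`. -/
theorem exists_truncated_martingale {A : Set Y} (hA : MeasurableSet A) {p c R : ℝ} (hc : 0 ≤ c)
    (hR : 0 ≤ R) (hAp : ν.real A ≤ p) (n : ℕ) :
    ∀ {Ω : Type u} [MeasurableSpace Ω] (G : Ω → (Fin n → Y) → ℝ)
      (H : Fin n → Ω → (Fin n → Y) → ℝ),
      Measurable (Function.uncurry G) → (∀ i, Measurable (Function.uncurry (H i))) →
      (∀ ω y, |G ω y| ≤ R) → (∀ i ω y, |H i ω y| ≤ R) → (∀ i ω y, H i ω y ≤ G ω y) →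
      (∀ i ω y z, H i ω (Function.update y i z) = H i ω y) →
      (∀ i ω y, y i ∉ A → G ω y = H i ω y) →
      ∃ W : Ω → (Fin n → Y) → ℝ, Measurable (Function.uncurry W) ∧
        (∃ B, ∀ ω y, |W ω y| ≤ B) ∧
        ∀ ω, (∀ s : ℝ, |s| * c ≤ 1 → ∫ y, Real.exp (s * W ω y) ∂(Measure.pi fun _ => ν) ≤
            Real.exp (n * (s ^ 2 * c ^ 2 * p))) ∧
          ∫ y, |G ω y - ∫ y, G ω y ∂(Measure.pi fun _ => ν) - W ω y| ∂(Measure.pi fun _ => ν) ≤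
            2 * ∑ i, ∫ y, max (G ω y - H i ω y - c) 0 ∂(Measure.pi fun _ => ν) := by
  induction n with
  | zero =>
    intro Ω _ G H hG _ hGb _ _ _ _
    refine ⟨fun _ _ => 0, measurable_const, ⟨0, by simp⟩, fun ω => ⟨fun s _ => by simp, ?_⟩⟩
    have : ∀ y : Fin 0 → Y, G ω y = G ω (fun i => i.elim0) := fun y => by
      congr 1; exact Subsingleton.elim _ _
    simp [this]
  | succ n ih =>
    intro Ω _ G H hG hH hGb hHb hHG hupd hAeq
    set π := Measure.pi fun _ : Fin n => ν with hπ
    -- the parametrized functions of the remaining coordinates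
    have hcons : Measurable fun q : (Ω × Y) × (Fin n → Y) =>
        (q.1.1, (Fin.cons q.1.2 q.2 : Fin (n + 1) → Y)) :=
      (measurable_fst.comp measurable_fst).prodMk
        (measurable_fin_cons.comp ((measurable_snd.comp measurable_fst).prodMk measurable_snd))
    have hG' : Measurable (Function.uncurry fun (a : Ω × Y) (y : Fin n → Y) =>
        G a.1 (Fin.cons a.2 y)) := hG.comp hcons
    have hH' : ∀ i, Measurable (Function.uncurry fun (a : Ω × Y) (y : Fin n → Y) =>
        H i a.1 (Fin.cons a.2 y)) := fun i => (hH i).comp hcons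
    -- The first coordinate joins the parameter, so the approximation for the remaining coordinates
    -- is jointly measurable in it. This is why the statement carries `Ω`, in the universe of `Y`.
    obtain ⟨W, hW, ⟨B, hB⟩, hWω⟩ := ih (fun (a : Ω × Y) y => G a.1 (Fin.cons a.2 y))
      (fun i a y => H i.succ a.1 (Fin.cons a.2 y)) hG' (fun i => hH' i.succ)
      (fun _ _ => hGb _ _) (fun _ _ _ => hHb _ _ _) (fun _ _ _ => hHG _ _ _)
      (fun i a y z => by rw [Fin.cons_update]; exact hupd _ _ _ _)
      (fun i a y hy => hAeq _ _ _ (by simpa using hy))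
    set D : Ω → Y → (Fin n → Y) → ℝ := fun ω x y => G ω (Fin.cons x y) - H 0 ω (Fin.cons x y)
      with hD
    have hDm : Measurable fun a : (Ω × Y) × (Fin n → Y) => D a.1.1 a.1.2 a.2 := hG'.sub (hH' 0)
    have hD0 : ∀ ω x y, 0 ≤ D ω x y := fun ω x y => sub_nonneg.2 (hHG _ _ _)
    have hDR : ∀ ω x y, D ω x y ≤ 2 * R := fun ω x y => by
      have h1 := (abs_le.1 (hGb ω (Fin.cons x y))).2
      have h2 := (abs_le.1 (hHb 0 ω (Fin.cons x y))).1
      simp only [hD]; linarith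
    -- The first discrete derivative `D` is split at `c`: the truncated part `q`, once centred, is
    -- the bounded martingale increment; the excess `r` goes into the error.
    set q : Ω → Y → ℝ := fun ω x => ∫ y, min (D ω x y) c ∂π with hq
    set r : Ω → Y → ℝ := fun ω x => ∫ y, max (D ω x y - c) 0 ∂π with hr
    have hqm : Measurable (Function.uncurry q) :=
      ((hDm.min measurable_const).stronglyMeasurable.integral_prod_right (ν := π)).measurable
    have hrm : Measurable (Function.uncurry r) :=
      (((hDm.sub_const c).max measurable_const).stronglyMeasurable.integral_prod_right
        (ν := π)).measurable
    have sec : ∀ ω x, Measurable (D ω x) := fun ω x => hDm.comp (measurable_prodMk_left (x := (ω, x)))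
    have imin : ∀ ω x, Integrable (fun y => min (D ω x y) c) π := fun ω x =>
      integrable_of_abs_le ((sec ω x).min measurable_const) (B := c) fun y => by
        rw [abs_of_nonneg (le_min (hD0 ω x y) hc)]; exact min_le_right _ _
    have imax : ∀ ω x, Integrable (fun y => max (D ω x y - c) 0) π := fun ω x =>
      integrable_of_abs_le (((sec ω x).sub_const c).max measurable_const) (B := 2 * R) fun y => by
        rw [abs_of_nonneg (le_max_right _ _)]
        exact max_le (by linarith [hDR ω x y]) (by linarith)
    have q0 : ∀ ω x, 0 ≤ q ω x := fun ω x => integral_nonneg fun y => le_min (hD0 ω x y) hc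
    have qc : ∀ ω x, q ω x ≤ c := fun ω x => by
      refine (integral_mono (imin ω x) (integrable_const c) fun y => min_le_right _ _).trans ?_
      simp
    have r0 : ∀ ω x, 0 ≤ r ω x := fun ω x => integral_nonneg fun y => le_max_right _ _
    have rR : ∀ ω x, r ω x ≤ 2 * R := fun ω x => by
      refine (integral_mono (imax ω x) (integrable_const (2 * R)) fun y =>
        max_le (by linarith [hDR ω x y]) (by linarith)).trans ?_
      simp
    have qA : ∀ ω x, x ∉ A → q ω x = 0 := fun ω x hx => by
      have : ∀ y, D ω x y = 0 := fun y => sub_eq_zero.2 (hAeq 0 _ _ (by simpa using hx))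
      simp [hq, this, hc]
    have qsec : ∀ ω, Measurable (q ω) := fun ω => hqm.comp measurable_prodMk_left
    have rsec : ∀ ω, Measurable (r ω) := fun ω => hrm.comp measurable_prodMk_left
    have qint : ∀ ω, Integrable (q ω) ν := fun ω => integrable_of_abs_le (qsec ω) (B := c)
      fun x => by rw [abs_of_nonneg (q0 ω x)]; exact qc ω x
    have rint : ∀ ω, Integrable (r ω) ν := fun ω => integrable_of_abs_le (rsec ω) (B := 2 * R)
      fun x => by rw [abs_of_nonneg (r0 ω x)]; exact rR ω x
    set w : Ω → Y → ℝ := fun ω x => q ω x - ∫ x, q ω x ∂ν with hw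
    have hwm : Measurable (Function.uncurry w) := by
      refine hqm.sub ?_
      exact ((hqm.stronglyMeasurable.integral_prod_right (ν := ν)).measurable).comp measurable_fst
    have hwb : ∀ ω x, |w ω x| ≤ c := fun ω x => by
      have h1 : 0 ≤ ∫ x, q ω x ∂ν := integral_nonneg (q0 ω)
      have h2 : ∫ x, q ω x ∂ν ≤ c := by
        refine (integral_mono (qint ω) (integrable_const c) (qc ω)).trans ?_
        simp
      rw [abs_le]
      constructor <;> simp only [hw] <;> linarith [q0 ω x, qc ω x]
    set V : Ω → (Fin (n + 1) → Y) → ℝ := fun ω y => W (ω, y 0) (Fin.tail y) + w ω (y 0) with hV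
    have hVm : Measurable (Function.uncurry V) := by
      have htail : Measurable fun a : Ω × (Fin (n + 1) → Y) => (Fin.tail a.2 : Fin n → Y) :=
        measurable_pi_lambda _ fun i => (measurable_pi_apply i.succ).comp measurable_snd
      have hz : Measurable fun a : Ω × (Fin (n + 1) → Y) => (a.1, a.2 0) :=
        measurable_fst.prodMk ((measurable_pi_apply 0).comp measurable_snd)
      exact (hW.comp (hz.prodMk htail)).add (hwm.comp hz)
    have hVb : ∀ ω y, |V ω y| ≤ B + c := fun ω y =>
      (abs_add_le _ _).trans (add_le_add (hB _ _) (hwb _ _))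
    have Wsec : ∀ ω x, Measurable (W (ω, x)) := fun ω x => hW.comp measurable_prodMk_left
    have Gsec : ∀ ω, Measurable (G ω) := fun ω => hG.comp measurable_prodMk_left
    have Vsec : ∀ ω, Measurable (V ω) := fun ω => hVm.comp measurable_prodMk_left
    refine ⟨V, hVm, ⟨B + c, hVb⟩, fun ω => ⟨fun s hs => ?_, ?_⟩⟩
    · -- the moment generating function
      have hb : ∀ y, |Real.exp (s * V ω y)| ≤ Real.exp (|s| * (B + c)) := fun y => by
        rw [abs_of_pos (Real.exp_pos _), Real.exp_le_exp]
        refine (le_abs_self _).trans ?_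
        rw [abs_mul]
        exact mul_le_mul_of_nonneg_left (hVb ω y) (abs_nonneg s)
      rw [integral_pi_succ ν (by have := Vsec ω; fun_prop) hb]
      have e : ∀ x, ∫ y, Real.exp (s * V ω (Fin.cons x y)) ∂π =
          Real.exp (s * w ω x) * ∫ y, Real.exp (s * W (ω, x) y) ∂π := fun x => by
        rw [← integral_const_mul]
        congr 1; funext y
        rw [← Real.exp_add]
        simp only [hV, Fin.cons_zero, Fin.tail_cons]; ring_nf
      rw [integral_congr_ae (Filter.Eventually.of_forall e)]
      have hle : ∀ x, Real.exp (s * w ω x) * ∫ y, Real.exp (s * W (ω, x) y) ∂π ≤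
          Real.exp (s * w ω x) * Real.exp (n * (s ^ 2 * c ^ 2 * p)) := fun x =>
        mul_le_mul_of_nonneg_left ((hWω (ω, x)).1 s hs) (Real.exp_pos _).le
      have hwi : Integrable (fun x => Real.exp (s * w ω x)) ν :=
        integrable_of_abs_le (by have : Measurable (w ω) := hwm.comp measurable_prodMk_left
                                 fun_prop) (B := Real.exp (|s| * c)) fun x => by
          rw [abs_of_pos (Real.exp_pos _), Real.exp_le_exp]
          refine (le_abs_self _).trans ?_
          rw [abs_mul]
          exact mul_le_mul_of_nonneg_left (hwb ω x) (abs_nonneg s)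
      refine (integral_mono_of_nonneg (Filter.Eventually.of_forall fun x =>
        mul_nonneg (Real.exp_pos _).le (integral_nonneg fun y => (Real.exp_pos _).le))
        (hwi.mul_const _) (Filter.Eventually.of_forall hle)).trans ?_
      rw [integral_mul_const]
      have hstep := integral_exp_centered_le ν hA hAp (qsec ω) (q0 ω) (qc ω) (qA ω) hs
      refine (mul_le_mul_of_nonneg_right hstep (Real.exp_pos _).le).trans (le_of_eq ?_)
      rw [← Real.exp_add]; push_cast; ring_nf
    · -- the error term
      set m := ∫ y, G ω y ∂(Measure.pi fun _ : Fin (n + 1) => ν) with hm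
      have hmeq : m = ∫ x, ∫ y, G ω (Fin.cons x y) ∂π ∂ν := integral_pi_succ ν (Gsec ω) (hGb ω)
      have hmR : |m| ≤ R := by
        refine (abs_integral_le_integral_abs).trans ?_
        refine (integral_mono (integrable_of_abs_le (Gsec ω).abs (B := R) fun y => by
          rw [abs_abs]; exact hGb ω y) (integrable_const R) (hGb ω)).trans ?_
        simp
      have hb : ∀ y, |(|G ω y - m - V ω y|)| ≤ 2 * R + (B + c) := fun y => by
        rw [abs_abs]
        refine (abs_sub _ _).trans (add_le_add ((abs_sub _ _).trans ?_) (hVb ω y))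
        linarith [hGb ω y]
      rw [integral_pi_succ ν (by have := Vsec ω; have := Gsec ω; fun_prop) hb]
      set g : Y → ℝ := fun x => ∫ y, G ω (Fin.cons x y) ∂π with hg
      have consm : ∀ x : Y, Measurable fun y : Fin n → Y => (Fin.cons x y : Fin (n + 1) → Y) :=
        fun x => measurable_fin_cons.comp measurable_prodMk_left
      have Gc : ∀ x, Measurable fun y => G ω (Fin.cons x y) := fun x => (Gsec ω).comp (consm x)
      have Gi : ∀ x, Integrable (fun y => G ω (Fin.cons x y)) π := fun x =>
        integrable_of_abs_le (Gc x) fun y => hGb _ _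
      -- the removal of coordinate `0` does not depend on it
      have hg0 : ∀ x x', g x - (q ω x + r ω x) = g x' - (q ω x' + r ω x') := by
        have hh : ∀ x, g x - (q ω x + r ω x) = ∫ y, H 0 ω (Fin.cons x y) ∂π := fun x => by
          have isum : Integrable (fun y => min (D ω x y) c + max (D ω x y - c) 0) π :=
            (imin ω x).add (imax ω x)
          simp only [hg, hq, hr]
          rw [← integral_add (imin ω x) (imax ω x), ← integral_sub (Gi x) isum]
          congr 1; funext y
          have : min (D ω x y) c + max (D ω x y - c) 0 = D ω x y := by
            rcases le_total (D ω x y) c with h | h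
            · rw [min_eq_left h, max_eq_right (by linarith)]; ring
            · rw [min_eq_right h, max_eq_left (by linarith)]; ring
          rw [this]; simp only [hD]; ring
        intro x x'
        rw [hh, hh]
        congr 1; funext y
        rw [← hupd 0 ω (Fin.cons x' y) x, Fin.update_cons_zero]
      have gm : Measurable g := by
        have : Measurable fun a : Ω × Y => ∫ y, G a.1 (Fin.cons a.2 y) ∂π :=
          (hG'.stronglyMeasurable.integral_prod_right (ν := π)).measurable
        exact this.comp (measurable_prodMk_left (x := ω))
      have gR : ∀ x, |g x| ≤ R := fun x => by
        refine (abs_integral_le_integral_abs).trans ?_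
        refine (integral_mono (Gi x).abs (integrable_const R) fun y => hGb _ _).trans ?_
        simp
      have gi : Integrable g ν := integrable_of_abs_le gm gR
      -- Since `g - q - r` is constant, `g` minus its mean is the sum of the centred `q` and the
      -- centred `r`. The latter has `L¹` norm at most twice the mean of `r`, whence the factor `2`
      -- in the error bound.
      have hsecond : ∀ x, g x - m - w ω x = r ω x - ∫ x, r ω x ∂ν := fun x => by
        have h1 : ∀ x', g x' = (g x - (q ω x + r ω x)) + (q ω x' + r ω x') := fun x' => by
          linarith [hg0 x x']
        have h2 : m = (g x - (q ω x + r ω x)) + (∫ x, q ω x ∂ν + ∫ x, r ω x ∂ν) := by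
          rw [hmeq]
          change ∫ x', g x' ∂ν = _
          have iqr : Integrable (fun x => q ω x + r ω x) ν := (qint ω).add (rint ω)
          rw [integral_congr_ae (Filter.Eventually.of_forall h1), integral_add (integrable_const _) iqr]
          simp only [integral_const, probReal_univ, one_smul]
          congr 1
          exact integral_add (qint ω) (rint ω)
        rw [h2]; simp only [hw]; ring
      have hpt : ∀ x, ∫ y, |G ω (Fin.cons x y) - m - V ω (Fin.cons x y)| ∂π ≤
          2 * ∑ i : Fin n, ∫ y, max (G ω (Fin.cons x y) - H i.succ ω (Fin.cons x y) - c) 0 ∂π +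
            (r ω x + ∫ x, r ω x ∂ν) := fun x => by
        have hi1 : Integrable (fun y => |G ω (Fin.cons x y) - g x - W (ω, x) y|) π :=
          ((Gi x).sub (integrable_const _)).sub (integrable_of_abs_le (Wsec ω x) (hB _)) |>.abs
        have hle : ∀ y, |G ω (Fin.cons x y) - m - V ω (Fin.cons x y)| ≤
            |G ω (Fin.cons x y) - g x - W (ω, x) y| + (r ω x + ∫ x, r ω x ∂ν) := fun y => by
          have e : G ω (Fin.cons x y) - m - V ω (Fin.cons x y) =
              (G ω (Fin.cons x y) - g x - W (ω, x) y) + (g x - m - w ω x) := by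
            simp only [hV, Fin.cons_zero, Fin.tail_cons]; ring
          rw [e, hsecond]
          refine (abs_add_le _ _).trans (add_le_add le_rfl ((abs_sub _ _).trans ?_))
          rw [abs_of_nonneg (r0 ω x), abs_of_nonneg (integral_nonneg (r0 ω))]
        refine (integral_mono_of_nonneg (Filter.Eventually.of_forall fun y => abs_nonneg _)
          (hi1.add (integrable_const _)) (Filter.Eventually.of_forall hle)).trans ?_
        rw [integral_add' hi1 (integrable_const _)]
        refine add_le_add ((hWω (ω, x)).2) ?_
        simp
      have Dm : ∀ i : Fin n, Measurable fun x =>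
          ∫ y, max (G ω (Fin.cons x y) - H i.succ ω (Fin.cons x y) - c) 0 ∂π := fun i => by
        have : Measurable fun a : Ω × Y =>
            ∫ y, max (G a.1 (Fin.cons a.2 y) - H i.succ a.1 (Fin.cons a.2 y) - c) 0 ∂π :=
          (((((hG'.sub (hH' i.succ)).sub_const c).max
            measurable_const).stronglyMeasurable.integral_prod_right (ν := π)).measurable)
        exact this.comp (measurable_prodMk_left (x := ω))
      have bd : ∀ (i : Fin (n + 1)) y, |max (G ω y - H i ω y - c) 0| ≤ 2 * R := fun i y => by
        rw [abs_of_nonneg (le_max_right _ _)]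
        have h1 := (abs_le.1 (hGb ω y)).2
        have h2 := (abs_le.1 (hHb i ω y)).1
        exact max_le (by linarith) (by linarith)
      have bdm : ∀ i : Fin (n + 1), Measurable fun y => max (G ω y - H i ω y - c) 0 := fun i =>
        (((Gsec ω).sub ((hH i).comp measurable_prodMk_left)).sub_const c).max measurable_const
      have Di : ∀ i : Fin n, Integrable (fun x =>
          ∫ y, max (G ω (Fin.cons x y) - H i.succ ω (Fin.cons x y) - c) 0 ∂π) ν := fun i =>
        integrable_of_abs_le (Dm i) (B := 2 * R) fun x => by
          refine (abs_integral_le_integral_abs).trans ?_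
          refine (integral_mono (integrable_of_abs_le (((bdm i.succ).comp (consm x)).abs)
            (B := 2 * R) fun y => by rw [abs_abs]; exact bd _ _) (integrable_const (2 * R))
            fun y => bd _ _).trans ?_
          simp
      have hsumi : Integrable (fun x => ∑ i : Fin n,
          ∫ y, max (G ω (Fin.cons x y) - H i.succ ω (Fin.cons x y) - c) 0 ∂π) ν :=
        integrable_finsetSum _ fun i _ => Di i
      refine (integral_mono_of_nonneg (Filter.Eventually.of_forall fun x =>
        integral_nonneg fun y => abs_nonneg _) ((hsumi.const_mul 2).add
          ((rint ω).add (integrable_const _))) (Filter.Eventually.of_forall hpt)).trans ?_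
      rw [integral_add' (hsumi.const_mul 2) ((rint ω).add (integrable_const _)),
        integral_const_mul, integral_finsetSum _ fun i _ => Di i]
      have e2 : ∫ x, (r ω x + ∫ x, r ω x ∂ν) ∂ν = 2 * ∫ x, r ω x ∂ν := by
        rw [integral_add (rint ω) (integrable_const _)]; simp; ring
      have e3 : ∀ i : Fin (n + 1),
          ∫ y, max (G ω y - H i ω y - c) 0 ∂(Measure.pi fun _ : Fin (n + 1) => ν) =
          ∫ x, ∫ y, max (G ω (Fin.cons x y) - H i ω (Fin.cons x y) - c) 0 ∂π ∂ν := fun i =>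
        integral_pi_succ ν (bdm i) (bd i)
      have e4 : ∫ x, (r ω + (fun _ : Y => ∫ x, r ω x ∂ν)) x ∂ν = 2 * ∫ x, r ω x ∂ν := e2
      rw [Fin.sum_univ_succ]
      simp only [e3]
      have e5 : ∫ x, ∫ y, max (G ω (Fin.cons x y) - H 0 ω (Fin.cons x y) - c) 0 ∂π ∂ν =
        ∫ x, r ω x ∂ν := rfl
      rw [e5, e4]
      linarith

/-- Concentration of a function of independent variables that changes by more than `c` only with
small probability, and does not depend on the `i`-th variable unless that variable lies in `A`. -/
theorem measure_deviation_le {A : Set Y} (hA : MeasurableSet A) {p c R : ℝ} (hc : 0 ≤ c)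
    (hR : 0 ≤ R) (hAp : ν.real A ≤ p) {n : ℕ} {g : (Fin n → Y) → ℝ} {h : Fin n → (Fin n → Y) → ℝ}
    (hg : Measurable g) (hh : ∀ i, Measurable (h i)) (hgR : ∀ y, |g y| ≤ R)
    (hhR : ∀ i y, |h i y| ≤ R) (hle : ∀ i y, h i y ≤ g y)
    (hupd : ∀ i y z, h i (Function.update y i z) = h i y)
    (hAeq : ∀ i y, y i ∉ A → g y = h i y) {s x : ℝ} (hs : 0 ≤ s) (hsc : s * c ≤ 1) (hx : 0 < x) :
    (Measure.pi fun _ : Fin n => ν).real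
        {y | 2 * x ≤ |g y - ∫ y, g y ∂(Measure.pi fun _ : Fin n => ν)|} ≤
      2 * Real.exp (n * (s ^ 2 * c ^ 2 * p) - s * x) +
        2 * (∑ i, ∫ y, max (g y - h i y - c) 0 ∂(Measure.pi fun _ : Fin n => ν)) / x := by
  set π := Measure.pi fun _ : Fin n => ν
  obtain ⟨W, hW, ⟨B, hB⟩, hWω⟩ := exists_truncated_martingale ν hA hc hR hAp n
    (Ω := PUnit.{u+1}) (fun _ => g) (fun i _ => h i) (hg.comp measurable_snd)
    (fun i => (hh i).comp measurable_snd) (fun _ => hgR) (fun i _ => hhR i) (fun i _ => hle i)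
    (fun i _ => hupd i) (fun i _ => hAeq i)
  obtain ⟨hmgf, herr⟩ := hWω PUnit.unit
  set f := W PUnit.unit
  have hf : Measurable f := hW.comp measurable_prodMk_left
  set m := ∫ y, g y ∂π
  have tail : ∀ σ : ℝ, |σ| = s → π.real {y | s * x ≤ σ * f y} ≤
      Real.exp (n * (s ^ 2 * c ^ 2 * p) - s * x) := fun σ hσ => by
    have hi : Integrable (fun y => Real.exp (σ * f y)) π :=
      integrable_of_abs_le (by fun_prop) (B := Real.exp (|σ| * B)) fun y => by
        rw [abs_of_pos (Real.exp_pos _), Real.exp_le_exp]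
        refine (le_abs_self _).trans ?_
        rw [abs_mul]
        exact mul_le_mul_of_nonneg_left (hB _ y) (abs_nonneg σ)
    have hmk := mul_meas_ge_le_integral_of_nonneg (μ := π)
      (Filter.Eventually.of_forall fun y => (Real.exp_pos (σ * f y)).le) hi (Real.exp (s * x))
    have hset : {y | Real.exp (s * x) ≤ Real.exp (σ * f y)} = {y | s * x ≤ σ * f y} := by
      ext y; simp
    rw [hset] at hmk
    have h2 := hmgf σ (by rw [hσ]; exact hsc)
    rw [← sq_abs σ, hσ] at h2
    rw [Real.exp_sub, le_div_iff₀ (Real.exp_pos _), mul_comm]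
    exact hmk.trans h2
  have hei : Integrable (fun y => |g y - m - f y|) π :=
    ((integrable_of_abs_le hg hgR).sub (integrable_const m)).sub
      (integrable_of_abs_le hf (hB _)) |>.abs
  have herr' : π.real {y | x ≤ |g y - m - f y|} ≤
      2 * (∑ i, ∫ y, max (g y - h i y - c) 0 ∂π) / x := by
    rw [le_div_iff₀ hx, mul_comm]
    exact (mul_meas_ge_le_integral_of_nonneg
      (Filter.Eventually.of_forall fun y => abs_nonneg _) hei x).trans herr
  -- One `x` is charged to the martingale, through exponential moments at `s` and `-s`, the other to
  -- the approximation error, through Markov's inequality.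
  have hsub : {y | 2 * x ≤ |g y - m|} ⊆
      ({y | s * x ≤ s * f y} ∪ {y | s * x ≤ -s * f y}) ∪ {y | x ≤ |g y - m - f y|} := by
    intro y hy
    by_contra hcon
    simp only [Set.mem_union, Set.mem_ofPred_eq, not_or, not_le] at hcon hy
    obtain ⟨⟨h1, h2⟩, h3⟩ := hcon
    have h1' : f y < x := lt_of_mul_lt_mul_left h1 hs
    have h2' : -f y < x := lt_of_mul_lt_mul_left (by linarith) hs
    have h4 : |f y| < x := abs_lt.2 ⟨by linarith, h1'⟩
    have h5 : |g y - m| ≤ |g y - m - f y| + |f y| := by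
      have := abs_add_le (g y - m - f y) (f y)
      simpa using this
    linarith
  refine (measureReal_mono hsub).trans ((measureReal_union_le _ _).trans
    (add_le_add ((measureReal_union_le _ _).trans ?_) herr'))
  have t1 := tail s (abs_of_nonneg hs)
  have t2 := tail (-s) (by rw [abs_neg, abs_of_nonneg hs])
  linarith

end Concentration

end ParamTest

namespace ParamTest

/-! ### The verdict on separated losses -/

section Verdict

variable {P : Params} {a : SignType → ℕ → ℝ} {x v : ℝ} {j₀ : SignType}

theorem countLE_eq_zero {N : ℕ} {b : ℕ → ℝ} (h : ∀ s < N, v < b s) {w : ℝ} (hw : w ≤ v) :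
    countLE N b w = 0 := by
  classical
  refine Finset.card_eq_zero.2 (Finset.filter_eq_empty_iff.2 fun s hs => ?_)
  exact not_le.2 (hw.trans_lt (h s (Finset.mem_range.1 hs)))

theorem countLE_eq_self {N : ℕ} {b : ℕ → ℝ} {w : ℝ} (h : ∀ s < N, b s ≤ w) :
    countLE N b w = N := by
  classical
  refine Eq.trans ?_ (Finset.card_range N)
  exact congrArg Finset.card
    (Finset.filter_true_of_mem fun s hs => h s (Finset.mem_range.1 hs))

/-- The certificate is the largest loss recorded over `j₀`: its count is all of `N`, which reaches
`hi` as long as the noise is at most `2 * center`, and the rival counts vanish. -/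
theorem Wins.of_separated (hP : P.Valid) (hx : P.noise x ≤ 2 * P.center)
    (h₀ : ∀ s < P.numSamples, a j₀ s ≤ v)
    (h : ∀ j ≠ j₀, ∀ s < P.numSamples, v < a j s) {j₁ j₂ : SignType} (h1 : j₁ ≠ j₀)
    (h2 : j₂ ≠ j₀) : Wins P a (P.noise x) j₀ j₁ j₂ := by
  have hN : 0 < P.numSamples := Nat.ceil_pos.2 (zero_lt_one.trans_le hP.one_le_budget)
  obtain ⟨i, hi, hmax⟩ := Finset.exists_max_image (Finset.range P.numSamples) (a j₀)
    ⟨0, Finset.mem_range.2 hN⟩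
  rw [Finset.mem_range] at hi
  have hf : 0 ≤ P.floorCount := zero_le_one.trans hP.floorCount_ge
  have hlo : (0 : ℝ) ≤ P.lo (P.noise x) := mul_nonneg hf (Real.exp_pos _).le
  refine ⟨i, hi, ?_, ?_, ?_⟩
  · rw [countLE_eq_self fun s hs => hmax s (Finset.mem_range.2 hs)]
    refine le_trans ?_ (Nat.le_ceil _)
    exact mul_le_mul_of_nonneg_left (Real.exp_le_exp.2 (by linarith)) hf
  · rwa [countLE_eq_zero (h j₁ h1) (h₀ i hi), Nat.cast_zero]
  · rwa [countLE_eq_zero (h j₂ h2) (h₀ i hi), Nat.cast_zero]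

/-- Every value recorded over a wrong region lies above all `N` losses over `j₀`, and `lo` is below
`N` for positive noise. -/
theorem not_wins_of_separated (hP : P.Valid) (hx : 0 < P.noise x)
    (h₀ : ∀ s < P.numSamples, a j₀ s ≤ v)
    {j : SignType} (h : ∀ s < P.numSamples, v < a j s) {j₁ j₂ : SignType}
    (hj : j₁ = j₀ ∨ j₂ = j₀) : ¬ Wins P a (P.noise x) j j₁ j₂ := by
  rintro ⟨i, hi, -, h1, h2⟩
  have hf : 0 < P.floorCount := zero_lt_one.trans_le hP.floorCount_ge
  have hlt : P.lo (P.noise x) < P.numSamples := by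
    refine lt_of_lt_of_le ?_ (Nat.le_ceil P.budget)
    exact mul_lt_mul_of_pos_left (Real.exp_lt_exp.2 (by linarith [hP.center_nonneg])) hf
  have hc : countLE P.numSamples (a j₀) (a j i) = P.numSamples :=
    countLE_eq_self fun s hs => (h₀ s hs).trans (h i hi).le
  rcases hj with rfl | rfl
  · rw [hc] at h1; linarith
  · rw [hc] at h2; linarith

/-- If a level separates the losses recorded over one region from those recorded over the other
regions, then this region is the verdict. -/
theorem verdictAt_of_separated (hP : P.Valid) {u : unitInterval} (hu : u ∈ goodNoise P)
    (h₀ : ∀ s < P.numSamples, a j₀ s ≤ v)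
    (h : ∀ j ≠ j₀, ∀ s < P.numSamples, v < a j s) : verdictAt P a (P.noise u) = j₀ := by
  have hp := hP.p_pos
  obtain ⟨hx1, hx2⟩ := noise_bounds hP hu
  have hx1' : 0 < P.noise u := by linarith
  have hx2' : P.noise u ≤ 2 * P.center := by linarith
  have hr : 0 < P.floorCount := zero_lt_one.trans_le hP.floorCount_ge
  rcases j₀ with _ | _ | _
  · have n1 : verdictAt P a (P.noise u) ≠ 1 := by
      rw [Ne, verdictAt_eq_one_iff]
      exact not_wins_of_separated hP hx1' h₀ (h _ (by decide)) (Or.inl rfl)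
    have n2 : verdictAt P a (P.noise u) ≠ -1 := by
      rw [Ne, verdictAt_eq_neg_one_iff hr hx1']
      exact not_wins_of_separated hP hx1' h₀ (h _ (by decide)) (Or.inl rfl)
    revert n1 n2
    generalize verdictAt P a (P.noise u) = y
    cases y <;> simp
  · exact (verdictAt_eq_neg_one_iff hr hx1').2
      (Wins.of_separated hP hx2' h₀ h (by decide) (by decide))
  · exact verdictAt_eq_one_iff.2 (Wins.of_separated hP hx2' h₀ h (by decide) (by decide))

end Verdict

/-! ### Losses of subsamples -/

section Keep

variable {d n m : ℕ} {𝒵 : Type*}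

theorem Task.lossAt_comp (𝒯 : Task d 𝒵) (θ : Fin d → ℝ) {S : Dataset n 𝒵} {f : Fin m → Fin n}
    (hf : f.Injective) (hm : m ≠ 0) (hS : ∀ i, i ∉ Set.range f → S i = none) :
    𝒯.lossAt θ S = (m / n : ℝ≥0) * 𝒯.lossAt θ (S ∘ f) := by
  have hm' : (m : ℝ≥0) ≠ 0 := by exact_mod_cast hm
  have hsum : ∑ i, (S i).elim 0 (𝒯.loss θ) = ∑ k, ((S ∘ f) k).elim 0 (𝒯.loss θ) := by
    symm
    refine Finset.sum_of_injOn f hf.injOn (fun _ _ => Finset.mem_coe.2 (Finset.mem_univ _))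
      (fun i _ hi => ?_) fun _ _ => rfl
    rw [hS i (by simpa using hi)]; rfl
  rw [Task.lossAt, Task.lossAt, hsum]
  field_simp

/-- Blanks contribute no loss but count in the normalization, so dropping them rescales by `m / n`.
The factor is positive and finite and passes through the infimum, even when that is `∞`. -/
theorem Task.constrainedLoss_comp [NeZero d] (𝒯 : Task d 𝒵) (π : Set ℝ) {S : Dataset n 𝒵}
    {f : Fin m → Fin n} (hf : f.Injective) (hm : m ≠ 0)
    (hS : ∀ i, i ∉ Set.range f → S i = none) :
    𝒯.constrainedLoss π S = ((m / n : ℝ≥0) : ℝ≥0∞) * 𝒯.constrainedLoss π (S ∘ f) := by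
  have hn : n ≠ 0 := by
    rintro rfl
    exact (f ⟨0, Nat.pos_of_ne_zero hm⟩).elim0
  have h0 : ((m / n : ℝ≥0) : ℝ≥0∞) ≠ 0 := by
    rw [Ne, ENNReal.coe_eq_zero]
    have hm' : (m : ℝ≥0) ≠ 0 := by exact_mod_cast hm
    have hn' : (n : ℝ≥0) ≠ 0 := by exact_mod_cast hn
    exact div_ne_zero hm' hn'
  unfold Task.constrainedLoss
  rw [ENNReal.mul_iInf_of_ne h0 ENNReal.coe_ne_top]
  refine iInf_congr fun θ => ?_
  rw [ENNReal.mul_iInf_of_ne h0 ENNReal.coe_ne_top]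
  refine iInf_congr fun _ => ?_
  rw [𝒯.lossAt_comp θ hf hm hS, ENNReal.coe_mul]

open Classical in
/-- The dataset that keeps the entries in `I`. -/
noncomputable def keep (I : Finset (Fin n)) (Z : Fin n → 𝒵) : Dataset n 𝒵 :=
  fun i => if i ∈ I then some (Z i) else none

open Classical in
/-- The positions kept by the random bits `u`. -/
noncomputable def kept (p : ℝ) (u : Fin n → unitInterval) : Finset (Fin n) :=
  Finset.univ.filter fun i => (u i : ℝ) < p

/-- The positions of the entries in `I`, in increasing order. -/
noncomputable def position (I : Finset (Fin n)) : Fin I.card → Fin n := I.orderEmbOfFin rfl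

theorem position_injective (I : Finset (Fin n)) : (position I).Injective :=
  (I.orderEmbOfFin rfl).injective

theorem range_position (I : Finset (Fin n)) : Set.range (position I) = I :=
  I.range_orderEmbOfFin rfl

theorem mem_kept {p : ℝ} {u : Fin n → unitInterval} {i : Fin n} :
    i ∈ kept p u ↔ (u i : ℝ) < p := by
  simp [kept]

theorem thin_eq_keep (Z : Fin n → 𝒵) (p : ℝ) (u : Fin n → unitInterval) :
    thin Z p u = keep (kept p u) Z := by
  funext i
  simp only [thin, keep, mem_kept]

theorem keep_comp_position (I : Finset (Fin n)) (Z : Fin n → 𝒵) :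
    keep I Z ∘ position I = full (Z ∘ position I) := by
  funext k
  have : position I k ∈ I := by
    have : position I k ∈ Set.range (position I) := ⟨k, rfl⟩
    rwa [range_position] at this
  simp [keep, full, this]

theorem keep_eq_none {I : Finset (Fin n)} (Z : Fin n → 𝒵) {i : Fin n} (hi : i ∉ I) :
    keep I Z i = none := by
  simp [keep, hi]

theorem remove_keep_of_notMem {I : Finset (Fin n)} (Z : Fin n → 𝒵) {i : Fin n} (hi : i ∉ I) :
    remove (keep I Z) i = keep I Z := by
  unfold remove
  rw [← keep_eq_none Z hi]
  exact Function.update_eq_self _ _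

theorem remove_keep [DecidableEq (Fin n)] (I : Finset (Fin n)) (Z : Fin n → 𝒵) (i : Fin n) :
    remove (keep I Z) i = keep (I.erase i) Z := by
  funext k
  by_cases hk : k = i
  · subst hk; simp [remove, keep]
  · simp [remove, keep, hk]

theorem Task.constrainedLoss_keep [NeZero d] (𝒯 : Task d 𝒵) (π : Set ℝ) {I : Finset (Fin n)}
    (hI : I.card ≠ 0) (Z : Fin n → 𝒵) :
    𝒯.constrainedLoss π (keep I Z) =
      ((I.card / n : ℝ≥0) : ℝ≥0∞) * 𝒯.constrainedLoss π (full (Z ∘ position I)) := by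
  rw [𝒯.constrainedLoss_comp π (position_injective I) hI, keep_comp_position]
  intro i hi
  rw [range_position] at hi
  exact keep_eq_none Z hi

theorem Task.constrainedLoss_remove_keep [NeZero d] (𝒯 : Task d 𝒵) (π : Set ℝ)
    {I : Finset (Fin n)} (Z : Fin n → 𝒵) (k : Fin I.card) :
    𝒯.constrainedLoss π (remove (keep I Z) (position I k)) =
      ((I.card / n : ℝ≥0) : ℝ≥0∞) *
        𝒯.constrainedLoss π (remove (full (Z ∘ position I)) k) := by
  rw [𝒯.constrainedLoss_comp π (position_injective I) (Nat.ne_of_gt k.pos), remove,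
    Function.update_comp_eq_of_injective _ (position_injective I), keep_comp_position]
  · rfl
  · intro i hi
    have hne : i ≠ position I k := fun h => hi ⟨k, h.symm⟩
    rw [range_position] at hi
    rw [remove, Function.update_of_ne hne, keep_eq_none Z hi]

/-! ### Laws of sub-tuples of an independent sample. -/

variable [MeasurableSpace 𝒵] (D : Measure 𝒵)

theorem map_pi_comp [IsProbabilityMeasure D] {f : Fin m → Fin n} (hf : f.Injective) :
    (Measure.pi fun _ : Fin n => D).map (fun Z => Z ∘ f) = Measure.pi fun _ : Fin m => D := by
  have hi := (ProbabilityTheory.iIndepFun_pi (μ := fun _ : Fin n => D)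
    (X := fun _ z => z) fun _ => aemeasurable_id).precomp hf
  have := (ProbabilityTheory.iIndepFun_iff_map_fun_eq_pi_map
    fun i => (measurable_pi_apply (f i)).aemeasurable).1 hi
  refine this.trans ?_
  congr 1
  funext i
  exact (measurePreserving_eval (fun _ : Fin n => D) (f i)).map_eq

/-- An inequality of outer measures suffices and avoids measurability of the bad events, some of
which involve the argmin selection. -/
theorem measure_comp_le [IsProbabilityMeasure D] {f : Fin m → Fin n} (hf : f.Injective)
    (B : Set (Fin m → 𝒵)) :
    Measure.pi (fun _ : Fin n => D) {Z | Z ∘ f ∈ B} ≤ Measure.pi (fun _ : Fin m => D) B := by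
  rw [← map_pi_comp D hf]
  have : Measurable fun Z : Fin n → 𝒵 => Z ∘ f :=
    measurable_pi_lambda _ fun k => measurable_pi_apply (f k)
  exact Measure.le_map_apply this.aemeasurable B

theorem measurableSet_kept_eq (p : ℝ) (I : Finset (Fin n)) :
    MeasurableSet {u : Fin n → unitInterval | kept p u = I} := by
  have : {u : Fin n → unitInterval | kept p u = I} =
      ⋂ i, {u | (u i : ℝ) < p ↔ i ∈ I} := by
    ext u
    simp [Finset.ext_iff, mem_kept]
  rw [this]
  refine MeasurableSet.iInter fun i => ?_
  have hm : MeasurableSet {u : Fin n → unitInterval | (u i : ℝ) < p} :=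
    measurableSet_lt (measurable_subtype_coe.comp (measurable_pi_apply i)) measurable_const
  by_cases hi : i ∈ I
  · simpa [hi] using hm
  · simpa [hi, Set.compl_def] using hm.compl

/-- A bad event that is unlikely for each fixed set of kept positions is unlikely. -/
theorem measure_kept_le (p : ℝ) (B : Finset (Fin n) → Set (Fin n → 𝒵)) {q : ℝ≥0∞}
    (h : ∀ I, Measure.pi (fun _ : Fin n => D) (B I) ≤ q) :
    ((Measure.pi fun _ : Fin n => D).prod
      (Measure.pi fun _ : Fin n => (volume : Measure unitInterval)))
      {x | x.1 ∈ B (kept p x.2)} ≤ q := by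
  have hsub : {x : (Fin n → 𝒵) × (Fin n → unitInterval) | x.1 ∈ B (kept p x.2)} ⊆
      ⋃ I ∈ (Finset.univ : Finset (Finset (Fin n))), B I ×ˢ {u | kept p u = I} := by
    rintro x hx
    simp only [Finset.mem_univ, Set.iUnion_true, Set.mem_iUnion]
    exact ⟨_, hx, rfl⟩
  refine (measure_mono hsub).trans ((measure_biUnion_finset_le _ _).trans ?_)
  simp only [Measure.prod_prod]
  refine (Finset.sum_le_sum fun I _ => mul_le_mul_left (h I) _).trans ?_
  rw [← Finset.mul_sum, ← measure_biUnion_finset]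
  · exact mul_le_of_le_one_right' prob_le_one
  · intro I _ J _ hIJ
    refine Set.disjoint_left.2 fun u (h1 : _ = _) (h2 : _ = _) => hIJ (h1.symm.trans h2)
  · exact fun I _ => measurableSet_kept_eq p I

end Keep

end ParamTest

namespace ParamTest

/-! ### The gap between the regions -/

section Gap

variable {d n : ℕ} [NeZero d] {𝒵 : Type*}

theorem le_toReal_min {X : ℝ≥0∞} {r ρ : ℝ} (h : ENNReal.ofReal r ≤ X) (hr : r ≤ ρ) :
    r ≤ (min X (ENNReal.ofReal ρ)).toReal := by
  have h1 := le_min h (ENNReal.ofReal_le_ofReal hr)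
  exact (ENNReal.ofReal_le_iff_le_toReal (ne_top_of_le_ne_top ENNReal.ofReal_ne_top
    (min_le_right _ _))).1 h1

theorem toReal_min_eq {X : ℝ≥0∞} {r ρ : ℝ} (h : X = ENNReal.ofReal r) (hr0 : 0 ≤ r)
    (hr : r ≤ ρ) : (min X (ENNReal.ofReal ρ)).toReal = r := by
  rw [h, min_eq_left (ENNReal.ofReal_le_ofReal hr), ENNReal.toReal_ofReal hr0]

theorem Task.minLoss_ne_top {𝒯 : Task d 𝒵} (h𝒯 : 𝒯.Θ.Nonempty) (S : Dataset n 𝒵) :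
    𝒯.minLoss S ≠ ⊤ := by
  obtain ⟨θ, hθ⟩ := h𝒯
  exact ne_top_of_le_ne_top ENNReal.coe_ne_top (iInf₂_le θ ⟨hθ, Set.mem_univ _⟩)

theorem exists_mem_region (t w : ℝ) : ∃ j, w ∈ region t j := by
  rcases lt_or_ge w t with h | h
  · rcases lt_or_ge (-t) w with h' | h'
    · exact ⟨.zero, h', h⟩
    · exact ⟨.neg, h'⟩
  · exact ⟨.pos, h⟩

/-- If the first coordinate `b` of the empirical minimizer is close to `a`, and `a` is far from all
regions but one, then this region attains the least loss, and the others do not by a margin. -/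
theorem Task.gap_of_close {𝒯 : Task d 𝒵} (h𝒯 : 𝒯.Θ.Nonempty) {S : Dataset n 𝒵} {μ α t a b : ℝ}
    (hμ : 0 < μ) (hα : 0 < α) (ht : 20 * α / √μ < t) {j₀ : SignType}
    (hsep : ∀ j ≠ j₀, ∀ w ∈ region t j, t / 2 ≤ |w - a|) (hab : |b - a| < α / 2 / √μ)
    (hconv : ∀ w ∈ (fun θ : Fin d → ℝ => θ 0) '' 𝒯.Θ,
      𝒯.minLoss S + ENNReal.ofReal (μ * (w - b) ^ 2 / 2) ≤ 𝒯.constrainedLoss {w} S) :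
    𝒯.constrainedLoss (region t j₀) S = 𝒯.minLoss S ∧
      ∀ j ≠ j₀, 𝒯.minLoss S + ENNReal.ofReal (45 * α ^ 2) ≤ 𝒯.constrainedLoss (region t j) S := by
  have key : ∀ j ≠ j₀, ∀ θ ∈ 𝒯.Θ, θ 0 ∈ region t j →
      𝒯.minLoss S + ENNReal.ofReal (45 * α ^ 2) ≤ 𝒯.lossAt θ S := by
    intro j hj θ hθ hθj
    have h1 := hconv (θ 0) ⟨θ, hθ, rfl⟩
    have h2 : 𝒯.constrainedLoss {θ 0} S ≤ 𝒯.lossAt θ S := iInf₂_le θ ⟨hθ, rfl⟩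
    refine le_trans (add_le_add_right (ENNReal.ofReal_le_ofReal ?_) _) (h1.trans h2)
    have hs : 0 < √μ := Real.sqrt_pos.2 hμ
    have hsq : √μ ^ 2 = μ := Real.sq_sqrt hμ.le
    have h3 := hsep j hj _ hθj
    have h4 : |θ 0 - a| ≤ |θ 0 - b| + |b - a| := abs_sub_le _ _ _
    -- Distance more than `10 α/√μ` from `a`, less the error `α/(2√μ)` of `b`. Then `(19/2)²/2 =
    -- 361/8` exceeds `45`.
    have h5 : 19 / 2 * (α / √μ) ≤ |θ 0 - b| := by
      have e1 : 20 * α / √μ = 20 * (α / √μ) := by ring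
      have e2 : α / 2 / √μ = α / √μ / 2 := by ring
      rw [e1] at ht; rw [e2] at hab
      linarith
    have h6 : (19 / 2 * (α / √μ)) ^ 2 ≤ (θ 0 - b) ^ 2 := by
      rw [← sq_abs (θ 0 - b)]
      exact pow_le_pow_left₀ (by positivity) h5 2
    have h7 : μ * (19 / 2 * (α / √μ)) ^ 2 = 361 / 4 * α ^ 2 := by
      rw [mul_pow, div_pow α, hsq]; field_simp; ring
    have h8 := mul_le_mul_of_nonneg_left h6 hμ.le
    nlinarith [sq_nonneg α]
  have hgap : ∀ j ≠ j₀,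
      𝒯.minLoss S + ENNReal.ofReal (45 * α ^ 2) ≤ 𝒯.constrainedLoss (region t j) S :=
    fun j hj => le_iInf₂ fun θ hθ => key j hj θ hθ.1 hθ.2
  refine ⟨le_antisymm ?_ ?_, hgap⟩
  -- Otherwise all three regions would stay strictly above the least loss, although together they
  -- cover the line.
  · by_contra! hlt
    have h1 : min (𝒯.constrainedLoss (region t j₀) S)
        (𝒯.minLoss S + ENNReal.ofReal (45 * α ^ 2)) ≤ 𝒯.minLoss S := by
      refine le_iInf₂ fun θ hθ => ?_
      obtain ⟨j, hj⟩ := exists_mem_region t (θ 0)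
      by_cases hjj : j = j₀
      · subst hjj
        exact (min_le_left _ _).trans (iInf₂_le θ ⟨hθ.1, hj⟩)
      · exact (min_le_right _ _).trans (key j hjj θ hθ.1 hj)
    refine absurd h1 (not_le.2 (lt_min hlt ?_))
    exact ENNReal.lt_add_right (Task.minLoss_ne_top h𝒯 S)
      (by rw [Ne, ENNReal.ofReal_eq_zero, not_le]; positivity)
  · exact le_iInf₂ fun θ hθ => iInf₂_le θ ⟨hθ.1, Set.mem_univ _⟩

/-- The least loss, clipped at `ρ`. -/
noncomputable def Task.minClipped (𝒯 : Task d 𝒵) (ρ : ℝ) (S : Dataset n 𝒵) : ℝ :=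
  (min (𝒯.minLoss S) (ENNReal.ofReal ρ)).toReal

/-- The level `v` separates the clipped loss over the region `j₀` from those over the others. -/
def Task.Separates (𝒯 : Task d 𝒵) (P : Params) (j₀ : SignType) (v : ℝ) (S : Dataset n 𝒵) : Prop :=
  𝒯.clipped P j₀ S ≤ v ∧ ∀ j ≠ j₀, v < 𝒯.clipped P j S

/-- Blanks scale all losses by `κ ≥ p/2`, leaving a gap of at least `4pα²`. The least loss is within
`2pα²` of `c`, so the midpoint of the gap can be replaced by the fixed level `c + 2pα²`. -/
theorem Task.separates_keep {𝒯 : Task d 𝒵} (h𝒯 : 𝒯.Θ.Nonempty) {P : Params} (hP : P.Valid)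
    {I : Finset (Fin n)} (hI : P.p * n / 2 ≤ I.card) (hI0 : 0 < I.card) {Z : Fin n → 𝒵}
    {j₀ : SignType}
    (h₀ : 𝒯.constrainedLoss (region P.t j₀) (full (Z ∘ position I)) =
      𝒯.minLoss (full (Z ∘ position I)))
    (h : ∀ j ≠ j₀, 𝒯.minLoss (full (Z ∘ position I)) + ENNReal.ofReal (45 * P.α ^ 2) ≤
      𝒯.constrainedLoss (region P.t j) (full (Z ∘ position I)))
    {σ τ : ℝ} (hτ : τ ≤ n) (hρ : 2 * σ ^ 2 + P.α ^ 2 ≤ P.ρ)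
    (htail : (𝒯.minLoss (full (Z ∘ position I))).toReal < σ ^ 2 * (1 + τ / I.card)) {c : ℝ}
    (hc : |𝒯.minClipped P.ρ (keep I Z) - c| < 2 * (P.p * P.α ^ 2)) :
    𝒯.Separates P j₀ (c + 2 * (P.p * P.α ^ 2)) (keep I Z) := by
  have aux : ∀ {a b : ℝ}, a ≠ 0 → b ≠ 0 →
      a / b * (σ ^ 2 * (1 + τ / a)) = σ ^ 2 * (a / b + τ / b) := fun ha hb => by field_simp
  have hp := hP.p_pos
  have hp' := hP.p_lt
  have hα : 0 < P.α ^ 2 := pow_pos hP.α_pos 2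
  have hm : (0 : ℝ) < I.card := by exact_mod_cast hI0
  have hmn : (I.card : ℝ) ≤ n := by exact_mod_cast I.card_le_univ.trans_eq (Fintype.card_fin n)
  have hn : (0 : ℝ) < n := hm.trans_le hmn
  set κ : ℝ := I.card / n with hκ
  have hκ0 : 0 < κ := div_pos hm hn
  have hκ1 : κ ≤ 1 := (div_le_one hn).2 hmn
  have hκp : P.p / 2 ≤ κ := by rw [hκ, le_div_iff₀ hn]; linarith
  set ℓ := (𝒯.minLoss (full (Z ∘ position I))).toReal with hℓ
  have hℓ0 : 0 ≤ ℓ := ENNReal.toReal_nonneg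
  have hκℓ : 0 ≤ κ * ℓ := mul_nonneg hκ0.le hℓ0
  have hL : 𝒯.minLoss (full (Z ∘ position I)) = ENNReal.ofReal ℓ :=
    (ENNReal.ofReal_toReal (Task.minLoss_ne_top h𝒯 _)).symm
  clear_value ℓ
  have hcoe : ((I.card / n : ℝ≥0) : ℝ≥0∞) = ENNReal.ofReal κ := by
    rw [hκ, ← ENNReal.ofReal_coe_nnreal]; simp
  have hmin : 𝒯.minLoss (keep I Z) = ENNReal.ofReal (κ * ℓ) := by
    rw [Task.minLoss, 𝒯.constrainedLoss_keep _ hI0.ne', hcoe, ← Task.minLoss, hL,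
      ENNReal.ofReal_mul hκ0.le]
  -- Scaling by `κ` turns the tail bound into `σ²(κ + τ/n) ≤ 2σ²`. The clipping therefore leaves
  -- headroom `α²`, more than the gap `4pα²` because `p < 1/4`.
  have hsmall : κ * ℓ + P.α ^ 2 ≤ P.ρ := by
    have h1 : κ * ℓ ≤ κ * (σ ^ 2 * (1 + τ / I.card)) := mul_le_mul_of_nonneg_left htail.le hκ0.le
    have h2 : κ * (σ ^ 2 * (1 + τ / I.card)) = σ ^ 2 * (κ + τ / n) := by
      rw [hκ, aux hm.ne' hn.ne']
    have h3 : τ / n ≤ 1 := (div_le_one hn).2 hτ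
    have h4 : σ ^ 2 * (κ + τ / n) ≤ σ ^ 2 * 2 :=
      mul_le_mul_of_nonneg_left (by linarith) (sq_nonneg σ)
    linarith
  have hg : 𝒯.minClipped P.ρ (keep I Z) = κ * ℓ :=
    toReal_min_eq hmin hκℓ (by linarith)
  rw [hg, abs_lt] at hc
  refine ⟨?_, fun j hj => ?_⟩
  · have : 𝒯.clipped P j₀ (keep I Z) = κ * ℓ := by
      refine toReal_min_eq ?_ hκℓ (by linarith)
      rw [𝒯.constrainedLoss_keep _ hI0.ne', h₀, hcoe, hL, ENNReal.ofReal_mul hκ0.le]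
    rw [this]; linarith
  · have hr : κ * ℓ + 4 * (P.p * P.α ^ 2) ≤ 𝒯.clipped P j (keep I Z) := by
      refine le_toReal_min ?_ ?_
      · rw [𝒯.constrainedLoss_keep _ hI0.ne', hcoe]
        refine le_trans ?_ (mul_le_mul_right (h j hj) _)
        rw [hL, ← ENNReal.ofReal_add hℓ0 (by positivity), ← ENNReal.ofReal_mul hκ0.le]
        refine ENNReal.ofReal_le_ofReal ?_
        have := mul_le_mul_of_nonneg_right hκp hα.le
        nlinarith
      · nlinarith
    linarith

end Gap

/-! ### Concentration of the least loss of a subsample -/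

section Deviation

variable {d n : ℕ} [NeZero d] {𝒵 : Type*}

theorem Task.minClipped_nonneg (𝒯 : Task d 𝒵) (ρ : ℝ) (S : Dataset n 𝒵) : 0 ≤ 𝒯.minClipped ρ S :=
  ENNReal.toReal_nonneg

theorem Task.minClipped_le (𝒯 : Task d 𝒵) {ρ : ℝ} (hρ : 0 ≤ ρ) (S : Dataset n 𝒵) :
    𝒯.minClipped ρ S ≤ ρ :=
  (ENNReal.toReal_mono ENNReal.ofReal_ne_top (min_le_right _ _)).trans_eq
    (ENNReal.toReal_ofReal hρ)

theorem Task.minClipped_mono (𝒯 : Task d 𝒵) (ρ : ℝ) {S S' : Dataset n 𝒵}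
    (h : ∀ k, S k = none ∨ S k = S' k) : 𝒯.minClipped ρ S ≤ 𝒯.minClipped ρ S' :=
  ENNReal.toReal_mono (ne_top_of_le_ne_top ENNReal.ofReal_ne_top (min_le_right _ _))
    (min_le_min_right _ (𝒯.constrainedLoss_mono _ h))

theorem abs_toReal_min_sub_le {X Y : ℝ≥0∞} (hX : X ≠ ⊤) (hY : Y ≠ ⊤) (ρ : ℝ) :
    |(min X (ENNReal.ofReal ρ)).toReal - (min Y (ENNReal.ofReal ρ)).toReal| ≤
      |X.toReal - Y.toReal| := by
  rw [ENNReal.toReal_min hX ENNReal.ofReal_ne_top, ENNReal.toReal_min hY ENNReal.ofReal_ne_top]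
  exact abs_inf_sub_inf_le_abs _ _ _

variable [MeasurableSpace 𝒵]

/-- Measurability is assumed for datasets without blanks, so the blanks are first compressed away.
-/
theorem Task.measurable_minClipped_keep {𝒯 : Task d 𝒵} (hm : 𝒯.IsMeasurable) (ρ : ℝ)
    (I : Finset (Fin n)) : Measurable fun Z : Fin n → 𝒵 => 𝒯.minClipped ρ (keep I Z) := by
  refine ENNReal.measurable_toReal.comp (Measurable.min ?_ measurable_const)
  by_cases hI : I.card = 0
  · have : (fun Z : Fin n → 𝒵 => 𝒯.minLoss (keep I Z)) = fun _ => 𝒯.minLoss (n := n) fun _ => none := by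
      funext Z
      rw [Finset.card_eq_zero] at hI
      congr 1
      funext i
      simp [keep, hI]
    rw [this]
    exact measurable_const
  · have : (fun Z : Fin n → 𝒵 => 𝒯.minLoss (keep I Z)) = fun Z =>
        ((I.card / n : ℝ≥0) : ℝ≥0∞) * 𝒯.minLoss (full (Z ∘ position I)) := by
      funext Z
      exact 𝒯.constrainedLoss_keep _ hI Z
    rw [this]
    refine Measurable.const_mul ?_ _
    exact (hm.constrainedLoss _ _ Set.ordConnected_univ).comp
      (measurable_pi_lambda _ fun k => measurable_pi_apply (position I k))

theorem measurable_of_kept {F : Finset (Fin n) → (Fin n → 𝒵) → ℝ} (hF : ∀ I, Measurable (F I))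
    (p : ℝ) : Measurable fun y : Fin n → 𝒵 × unitInterval =>
      F (kept p fun i => (y i).2) fun i => (y i).1 := by
  let _ : MeasurableSpace (Finset (Fin n)) := ⊤
  have h1 : Measurable fun q : Finset (Fin n) × (Fin n → 𝒵) => F q.1 q.2 :=
    measurable_from_prod_countable_right hF
  have h2 : Measurable fun u : Fin n → unitInterval => kept p u :=
    measurable_to_countable' fun I => measurableSet_kept_eq p I
  have h3 : Measurable fun y : Fin n → 𝒵 × unitInterval => fun i => (y i).2 :=
    measurable_pi_lambda _ fun i => measurable_snd.comp (measurable_pi_apply i)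
  have h4 : Measurable fun y : Fin n → 𝒵 × unitInterval => fun i => (y i).1 :=
    measurable_pi_lambda _ fun i => measurable_fst.comp (measurable_pi_apply i)
  exact h1.comp ((h2.comp h3).prodMk h4)

variable (D : Measure 𝒵) [IsProbabilityMeasure D]

/-- If the least loss is stable on all samples of at least `m₀` points, then the least loss of a
random subsample concentrates. -/
theorem measure_minClipped_deviation_le {𝒯 : Task d 𝒵} (hm : 𝒯.IsMeasurable)
    (h𝒯 : 𝒯.Θ.Nonempty) {p ρ b β β₀ m₀ : ℝ} (hp : 0 ≤ p) (hp' : p ≤ 1) (hρ : 0 ≤ ρ)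
    (hb : 0 ≤ b) (hβ : 0 ≤ β) (hβ₀ : 0 ≤ β₀)
    (hst : ∀ m : ℕ, m₀ < m → ∀ k : Fin m, Measure.pi (fun _ : Fin m => D)
      {Z | b / m ≤ |(𝒯.minLoss (full Z)).toReal - (𝒯.minLoss (remove (full Z) k)).toReal|} ≤
        ENNReal.ofReal β)
    (hcard : Measure.pi (fun _ : Fin n => (volume : Measure unitInterval))
      {u | ((kept p u).card : ℝ) ≤ m₀} ≤ ENNReal.ofReal β₀)
    {s x : ℝ} (hs : 0 ≤ s) (hsb : s * (b / n) ≤ 1) (hx : 0 < x) :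
    ∃ c, ((Measure.pi fun _ : Fin n => D).prod
      (Measure.pi fun _ : Fin n => (volume : Measure unitInterval)))
        {y | 2 * x ≤ |𝒯.minClipped ρ (thin y.1 p y.2) - c|} ≤
      ENNReal.ofReal (2 * Real.exp (n * (s ^ 2 * (b / n) ^ 2 * p) - s * x) +
        2 * (n * (ρ * (β + β₀))) / x) := by
  classical
  set c := b / n with hc
  have hc0 : 0 ≤ c := by positivity
  -- Each data point is paired with its own bit: the loss becomes a function of `n` independent
  -- pairs, insensitive to a pair whose bit is at least `p`.
  set ν : Measure (𝒵 × unitInterval) := D.prod volume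
  set G : (Fin n → 𝒵 × unitInterval) → ℝ := fun y =>
    𝒯.minClipped ρ (thin (fun i => (y i).1) p fun i => (y i).2) with hG
  set H : Fin n → (Fin n → 𝒵 × unitInterval) → ℝ := fun i y =>
    𝒯.minClipped ρ (remove (thin (fun i => (y i).1) p fun i => (y i).2) i) with hH
  set A : Set (𝒵 × unitInterval) := {z | (z.2 : ℝ) < p}
  have hA : MeasurableSet A :=
    measurableSet_lt (measurable_subtype_coe.comp measurable_snd) measurable_const
  have hAp : ν.real A ≤ p := by
    have : A = Set.univ ×ˢ {u : unitInterval | (u : ℝ) < p} := by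
      ext z; simp [A]
    rw [measureReal_def, this, Measure.prod_prod, measure_univ, one_mul, volume_lt p hp',
      ENNReal.toReal_ofReal hp]
  have hGm : Measurable G := by
    simp only [hG, thin_eq_keep]
    exact measurable_of_kept (𝒯.measurable_minClipped_keep hm ρ) p
  have hHm : ∀ i, Measurable (H i) := fun i => by
    simp only [hH, thin_eq_keep, remove_keep]
    exact measurable_of_kept (F := fun I Z => 𝒯.minClipped ρ (keep (I.erase i) Z))
      (fun I => 𝒯.measurable_minClipped_keep hm ρ _) p
  have habs : ∀ S : Dataset n 𝒵, |𝒯.minClipped ρ S| ≤ ρ := fun S => by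
    rw [abs_of_nonneg (𝒯.minClipped_nonneg ρ S)]; exact 𝒯.minClipped_le hρ S
  have hle : ∀ i y, H i y ≤ G y := fun i y => 𝒯.minClipped_mono ρ (remove_le _ i)
  set e := MeasurableEquiv.arrowProdEquivProdArrow 𝒵 unitInterval (Fin n)
  have he := measurePreserving_arrowProdEquivProdArrow 𝒵 unitInterval (Fin n) (fun _ => D)
    (fun _ => (volume : Measure unitInterval))
  have key := measure_deviation_le ν hA hc0 hρ hAp hGm hHm (fun y => habs _)
    (fun i y => habs _) hle (fun i y z => by
      change 𝒯.minClipped ρ _ = 𝒯.minClipped ρ _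
      congr 1
      funext k
      by_cases hk : k = i
      · subst hk; simp [remove]
      · simp [remove, thin, hk])
    (fun i y hi => by
      change 𝒯.minClipped ρ _ = 𝒯.minClipped ρ _
      rw [thin_eq_keep, remove_keep_of_notMem]
      rwa [mem_kept]) hs hsb hx
  set π := Measure.pi fun _ : Fin n => ν with hπ
  -- Condition on the set of kept positions. If it has more than `m₀` elements, the stability
  -- assumption applies to the kept data; smaller sets are charged to `β₀`.
  have hbad : ∀ i, π.real {y | c < G y - H i y} ≤ β + β₀ := by
    intro i
    set Bc : Finset (Fin n) → Set (Fin n → 𝒵) := fun I =>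
      {Z | m₀ < I.card ∧ c < 𝒯.minClipped ρ (keep I Z) - 𝒯.minClipped ρ (remove (keep I Z) i)}
      with hBc
    have h1 : ∀ I, Measure.pi (fun _ : Fin n => D) (Bc I) ≤ ENNReal.ofReal β := by
      intro I
      by_cases hI : m₀ < I.card
      swap
      · have : Bc I = ∅ := Set.eq_empty_of_forall_notMem fun Z hZ => hI hZ.1
        rw [this, measure_empty]; exact bot_le
      by_cases hi : i ∈ I
      swap
      · have : Bc I = ∅ := Set.eq_empty_of_forall_notMem fun Z hZ => by
          have h2 := hZ.2
          rw [remove_keep_of_notMem Z hi, sub_self] at h2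
          linarith
        rw [this, measure_empty]; exact bot_le
      obtain ⟨k, rfl⟩ : i ∈ Set.range (position I) := by rwa [range_position]
      refine le_trans (measure_mono ?_) ((measure_comp_le D (position_injective I) _).trans
        (hst I.card hI k))
      rintro Z ⟨-, hZ⟩
      simp only [Set.mem_ofPred_eq]
      by_contra! hcon
      have hI0 : (0 : ℝ) < I.card := by exact_mod_cast k.pos
      have hn0 : (0 : ℝ) < n := by exact_mod_cast (position I k).pos
      have h2 := abs_toReal_min_sub_le (Task.minLoss_ne_top h𝒯 (keep I Z))
        (Task.minLoss_ne_top h𝒯 (remove (keep I Z) (position I k))) ρ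
      have e1 : (𝒯.minLoss (keep I Z)).toReal =
          I.card / n * (𝒯.minLoss (full (Z ∘ position I))).toReal := by
        rw [Task.minLoss, 𝒯.constrainedLoss_keep _ (Nat.ne_of_gt k.pos), ENNReal.toReal_mul]
        simp [Task.minLoss]
      have e2 : (𝒯.minLoss (remove (keep I Z) (position I k))).toReal =
          I.card / n * (𝒯.minLoss (remove (full (Z ∘ position I)) k)).toReal := by
        rw [Task.minLoss, 𝒯.constrainedLoss_remove_keep, ENNReal.toReal_mul]
        simp [Task.minLoss]
      rw [e1, e2, ← mul_sub, abs_mul, abs_of_pos (div_pos hI0 hn0)] at h2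
      change |𝒯.minClipped ρ _ - 𝒯.minClipped ρ _| ≤ _ at h2
      have h3 : (I.card : ℝ) / n * |(𝒯.minLoss (full (Z ∘ position I))).toReal -
          (𝒯.minLoss (remove (full (Z ∘ position I)) k)).toReal| ≤ I.card / n * (b / I.card) :=
        mul_le_mul_of_nonneg_left hcon.le (by positivity)
      -- The stability bound `b / m` and the normalization `m / n` cancel, so one `c` works for kept
      -- sets of every size.
      have h4 : (I.card : ℝ) / n * (b / I.card) = c := by rw [hc]; field_simp
      exact absurd (hZ.trans_le ((le_abs_self _).trans (h2.trans (h3.trans_eq h4)))) (lt_irrefl _)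
    have h2 := measure_kept_le D p Bc h1
    have h3 : π {y | c < G y - H i y} ≤ ENNReal.ofReal (β + β₀) := by
      rw [ENNReal.ofReal_add hβ hβ₀]
      have hsub : {y | c < G y - H i y} ⊆ e ⁻¹' ({x | x.1 ∈ Bc (kept p x.2)} ∪
          Set.univ ×ˢ {u | ((kept p u).card : ℝ) ≤ m₀}) := by
        intro y hy
        by_cases hcy : ((kept p fun i => (y i).2).card : ℝ) ≤ m₀
        · exact Or.inr ⟨Set.mem_univ _, hcy⟩
        · refine Or.inl ⟨not_le.1 hcy, ?_⟩
          have hy' : c < G y - H i y := hy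
          simp only [hG, hH, thin_eq_keep] at hy'
          exact hy'
      refine (measure_mono hsub).trans ((he.measure_preimage_le _).trans
        ((measure_union_le _ _).trans (add_le_add h2 ?_)))
      rw [Measure.prod_prod, measure_univ, one_mul]
      exact hcard
    exact ENNReal.toReal_le_of_le_ofReal (by positivity) h3
  have hint : ∀ i, ∫ y, max (G y - H i y - c) 0 ∂π ≤ ρ * (β + β₀) := by
    intro i
    have hset : MeasurableSet {y | c < G y - H i y} :=
      measurableSet_lt measurable_const (hGm.sub (hHm i))
    calc ∫ y, max (G y - H i y - c) 0 ∂π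
        ≤ ∫ y, Set.indicator {y | c < G y - H i y} (fun _ => ρ) y ∂π := by
          refine integral_mono_of_nonneg (Filter.Eventually.of_forall fun y => le_max_right _ _)
            ((integrable_const ρ).indicator hset) (Filter.Eventually.of_forall fun y => ?_)
          by_cases hy : c < G y - H i y
          · have h1 : G y ≤ ρ := 𝒯.minClipped_le hρ _
            have h2 : 0 ≤ H i y := 𝒯.minClipped_nonneg ρ _
            rw [Set.indicator_of_mem (show y ∈ {y | c < G y - H i y} from hy)]
            exact max_le (by linarith) hρ
          · rw [Set.indicator_of_notMem (show y ∉ {y | c < G y - H i y} from hy)]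
            exact max_le (by linarith) le_rfl
      _ = π.real {y | c < G y - H i y} * ρ := by
          rw [integral_indicator_const _ hset, smul_eq_mul]
      _ ≤ ρ * (β + β₀) := by
          rw [mul_comm]; exact mul_le_mul_of_nonneg_left (hbad i) hρ
  refine ⟨∫ y, G y ∂π, ?_⟩
  set c' := ∫ y, G y ∂π
  have hsum : ∑ i, ∫ y, max (G y - H i y - c) 0 ∂π ≤ n * (ρ * (β + β₀)) := by
    refine (Finset.sum_le_sum fun i _ => hint i).trans_eq ?_
    simp
  have hfin : π.real {y | 2 * x ≤ |G y - c'|} ≤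
      2 * Real.exp (n * (s ^ 2 * c ^ 2 * p) - s * x) + 2 * (n * (ρ * (β + β₀))) / x := by
    refine key.trans (add_le_add_right ?_ _)
    gcongr
  have hpre : {y | 2 * x ≤ |G y - c'|} = e ⁻¹'
      {y | 2 * x ≤ |𝒯.minClipped ρ (thin y.1 p y.2) - c'|} := rfl
  rw [← he.measure_preimage_equiv, ← hpre, ← ofReal_measureReal]
  exact ENNReal.ofReal_le_ofReal hfin

end Deviation

end ParamTest

namespace ParamTest

/-! ### Separation on a single subsample -/

section Separation

variable {d n : ℕ} [NeZero d] {𝒵 : Type*} [MeasurableSpace 𝒵]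

theorem measure_card_kept_le {p : ℝ} (hp : 0 ≤ p) (hp' : p ≤ 1) :
    Measure.pi (fun _ : Fin n => (volume : Measure unitInterval))
      {u | ((kept p u).card : ℝ) ≤ p * n / 2} ≤ ENNReal.ofReal (Real.exp (-(p * n / 8))) := by
  have := measure_binomial_lower (Finset.univ : Finset (Fin n)) hp hp'
  rw [Measure.infinitePi_eq_pi, Finset.card_univ, Fintype.card_fin] at this
  refine le_trans (measure_mono fun u hu => ?_) this
  have hu' : ((kept p u).card : ℝ) ≤ p * n / 2 := hu
  refine le_trans (le_of_eq ?_) hu'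
  simp only [kept]

/-- Except with small probability, a random subsample separates the true region from the others
at a level that does not depend on the subsample. -/
theorem Task.exists_measure_not_separates_le {𝒯 : Task d 𝒵} {P : Params} (hP : P.Valid)
    {D : Measure 𝒵} [IsProbabilityMeasure D] {θhat : ∀ n : ℕ, (Fin n → 𝒵) → Fin d → ℝ}
    {θD : Fin d → ℝ} {N : ℝ → ℝ} {M K lam μ σ : ℝ} (hm : 𝒯.IsMeasurable) (h𝒯 : 𝒯.Θ.Nonempty)
    (hS : 𝒯.IdConcStable D θhat θD N M K lam μ σ) (hρ : 2 * σ ^ 2 + P.α ^ 2 ≤ P.ρ)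
    (ht : 20 * P.α / √μ < P.t) {j₀ : SignType}
    (hsep : ∀ j ≠ j₀, ∀ w ∈ region P.t j, P.t / 2 ≤ |w - θD 0|) {τ : ℝ} (hτ : 0 < τ)
    (h1 : N (P.α / 2) + K * τ / (P.α / 2) ^ 2 ≤ P.p * n / 2) (h2 : M + K * τ ≤ P.p * n / 2)
    (h3 : 8 * τ ≤ P.p * n)
    (h4 : 2 * τ / (P.p * P.α ^ 2) * (lam * (Real.log 2 + τ) / n) ≤ 1)
    (h5 : n * ((2 * τ / (P.p * P.α ^ 2)) ^ 2 * (lam * (Real.log 2 + τ) / n) ^ 2 * P.p) ≤ τ) :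
    ∃ v, ((Measure.pi fun _ : Fin n => D).prod
      (Measure.pi fun _ : Fin n => (volume : Measure unitInterval)))
        {y | ¬ 𝒯.Separates P j₀ v (thin y.1 P.p y.2)} ≤
      ENNReal.ofReal ((6 + 4 * (n * P.ρ) / (P.p * P.α ^ 2)) * Real.exp (-τ)) := by
  have hp := hP.p_pos
  have hα := hP.α_pos
  have hρ0 := hP.ρ_pos
  have hp1 : P.p ≤ 1 := by linarith [hP.p_lt]
  set β := Real.exp (-τ) with hβ
  have hβ0 : 0 < β := Real.exp_pos _
  have hlog : Real.log (1 / β) = τ := by rw [hβ, one_div, ← Real.exp_neg, Real.log_exp, neg_neg]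
  have hlog2 : Real.log (2 / β) = Real.log 2 + τ := by
    rw [Real.log_div two_ne_zero hβ0.ne', hβ, Real.log_exp, sub_neg_eq_add]
  have hl2 : 0 < Real.log 2 := Real.log_pos one_lt_two
  have hx : 0 < P.p * P.α ^ 2 := by positivity
  have hτn : τ ≤ n := by
    have : P.p * n ≤ 1 * n := mul_le_mul_of_nonneg_right hp1 (Nat.cast_nonneg n)
    linarith
  have hpos : ∀ {m : ℕ}, P.p * n / 2 < m → 1 ≤ m := fun {m} hm => by
    have : (0 : ℝ) < m := lt_of_le_of_lt (by positivity) hm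
    exact_mod_cast this
  have hcard : Measure.pi (fun _ : Fin n => (volume : Measure unitInterval))
      {u | ((kept P.p u).card : ℝ) ≤ P.p * n / 2} ≤ ENNReal.ofReal β :=
    (measure_card_kept_le hp.le hp1).trans
      (ENNReal.ofReal_le_ofReal (Real.exp_le_exp.2 (by linarith)))
  -- With this `s` and `x` one has `s * x = 2τ`, while the variance term is at most `τ` by `h5`; the
  -- exponential tail is thus at most `exp(-τ)`.
  obtain ⟨c, hdev⟩ := measure_minClipped_deviation_le (n := n) D hm h𝒯 hp.le hp1 hρ0.le
    (b := lam * (Real.log 2 + τ)) (mul_nonneg hS.lam_pos.le (by positivity)) hβ0.le hβ0.le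
    (m₀ := P.p * n / 2)
    (fun m hm k => by
      have := hS.leave_one_out β hβ0 m (hpos hm) (by rw [hlog]; linarith) k
      rwa [hlog2] at this) hcard
    (s := 2 * τ / (P.p * P.α ^ 2)) (x := P.p * P.α ^ 2) (by positivity) h4 hx
  refine ⟨c + 2 * (P.p * P.α ^ 2), ?_⟩
  -- Failure of parameter concentration, of convexity, or of the tail bound on the kept data, each
  -- of probability at most `exp(-τ)`.
  set B : Finset (Fin n) → Set (Fin n → 𝒵) := fun I => {Z | P.p * n / 2 < I.card ∧
    Z ∘ position I ∈ ({Z | P.α / 2 / √μ ≤ |θhat _ Z 0 - θD 0|} ∪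
      {Z | ¬ ∀ w ∈ (fun θ : Fin d → ℝ => θ 0) '' 𝒯.Θ,
        𝒯.minLoss (full Z) + ENNReal.ofReal (μ * (w - θhat _ Z 0) ^ 2 / 2)
            ≤ 𝒯.constrainedLoss {w} (full Z) ∧
        𝒯.constrainedLoss {w} (full Z)
            ≤ 𝒯.minLoss (full Z) + ENNReal.ofReal (2 * μ * (w - θhat _ Z 0) ^ 2)} ∪
      {Z | σ ^ 2 * (1 + τ / I.card) ≤ (𝒯.minLoss (full Z)).toReal})} with hB
  have hBle : ∀ I, Measure.pi (fun _ : Fin n => D) (B I) ≤ ENNReal.ofReal (3 * β) := by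
    intro I
    by_cases hI : P.p * n / 2 < I.card
    swap
    · have : B I = ∅ := Set.eq_empty_of_forall_notMem fun Z hZ => hI hZ.1
      rw [this, measure_empty]; exact bot_le
    refine (measure_mono fun Z hZ => hZ.2).trans
      ((measure_comp_le D (position_injective I) _).trans ?_)
    have e : 3 * β = β + β + β := by ring
    rw [e, ENNReal.ofReal_add (by positivity) hβ0.le, ENNReal.ofReal_add hβ0.le hβ0.le]
    refine (measure_union_le _ _).trans (add_le_add ((measure_union_le _ _).trans
      (add_le_add ?_ ?_)) ?_)
    · exact hS.param_concentration (P.α / 2) β (by positivity) hβ0 _ (hpos hI)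
        (by rw [hlog]; linarith)
    · exact hS.smooth_convex β hβ0 _ (hpos hI) (by rw [hlog]; linarith)
    · have := hS.tail_bound β hβ0 _ (hpos hI)
      rwa [hlog] at this
  have hsub : {y : (Fin n → 𝒵) × (Fin n → unitInterval) |
      ¬ 𝒯.Separates P j₀ (c + 2 * (P.p * P.α ^ 2)) (thin y.1 P.p y.2)} ⊆
      ({y | 2 * (P.p * P.α ^ 2) ≤ |𝒯.minClipped P.ρ (thin y.1 P.p y.2) - c|} ∪
        Set.univ ×ˢ {u | ((kept P.p u).card : ℝ) ≤ P.p * n / 2}) ∪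
        {y | y.1 ∈ B (kept P.p y.2)} := by
    rintro ⟨Z, u⟩ hy
    by_contra hcon
    rw [Set.mem_union, Set.mem_union, not_or, not_or] at hcon
    obtain ⟨⟨g1, g2⟩, g3⟩ := hcon
    have g2' : P.p * n / 2 < (kept P.p u).card := not_le.1 fun h => g2 ⟨Set.mem_univ _, h⟩
    have g1' : |𝒯.minClipped P.ρ (thin Z P.p u) - c| < 2 * (P.p * P.α ^ 2) := not_le.1 g1
    have g4 := not_and.1 g3 g2'
    rw [Set.mem_union, Set.mem_union, not_or, not_or] at g4
    obtain ⟨⟨g5, g6⟩, g7⟩ := g4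
    obtain ⟨f1, f2⟩ := Task.gap_of_close h𝒯 hS.μ_pos hα ht hsep (not_le.1 g5)
      fun w hw => (not_not.1 g6 w hw).1
    refine hy ?_
    change 𝒯.Separates P j₀ _ (thin Z P.p u)
    rw [thin_eq_keep] at g1' ⊢
    exact Task.separates_keep h𝒯 hP g2'.le (hpos g2') f1 f2 hτn hρ (not_le.1 g7) g1'
  have hu : ((Measure.pi fun _ : Fin n => D).prod
      (Measure.pi fun _ : Fin n => (volume : Measure unitInterval)))
      (Set.univ ×ˢ {u | ((kept P.p u).card : ℝ) ≤ P.p * n / 2}) ≤ ENNReal.ofReal β := by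
    rw [Measure.prod_prod, measure_univ, one_mul]; exact hcard
  refine (measure_mono hsub).trans ((measure_union_le _ _).trans
    ((add_le_add ((measure_union_le _ _).trans (add_le_add hdev hu))
      (measure_kept_le D P.p B hBle)).trans ?_))
  rw [← ENNReal.ofReal_add (by positivity) hβ0.le,
    ← ENNReal.ofReal_add (by positivity) (by positivity)]
  refine ENNReal.ofReal_le_ofReal ?_
  have hexp : Real.exp (n * ((2 * τ / (P.p * P.α ^ 2)) ^ 2 *
      (lam * (Real.log 2 + τ) / n) ^ 2 * P.p) - 2 * τ / (P.p * P.α ^ 2) * (P.p * P.α ^ 2)) ≤ β := by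
    rw [div_mul_cancel₀ _ hx.ne']
    exact Real.exp_le_exp.2 (by linarith)
  have e : 2 * (n * (P.ρ * (β + β))) / (P.p * P.α ^ 2) =
      4 * (n * P.ρ) / (P.p * P.α ^ 2) * β := by ring
  rw [e]
  linarith

end Separation

/-! ### The choice of the failure probability -/

section Choice

/-- The sample size supplies `1 + (p/ε)³`, whereas the requirements contain powers of `1 + p/ε` up
to the third; this bound and the next one convert. -/
theorem one_add_le {x : ℝ} (hx : 0 ≤ x) : 1 + x ≤ 2 * (1 + x ^ 3) := by
  nlinarith [mul_nonneg hx (sq_nonneg (x - 1)), sq_nonneg (x - 1), pow_nonneg hx 3]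

theorem one_add_pow_three_le {x : ℝ} (hx : 0 ≤ x) : (1 + x) ^ 3 ≤ 4 * (1 + x ^ 3) := by
  nlinarith [mul_nonneg hx (sq_nonneg (x - 1)), sq_nonneg (x - 1)]

/-- The logarithmic factor in the sample complexity. -/
noncomputable def Params.logFactor (P : Params) (n : ℕ) : ℝ :=
  Real.log (n * max 1 (P.ρ / P.α) * max 1 (1 / P.ε) / P.δ)

theorem Params.Valid.log_div_le_logFactor {P : Params} (hP : P.Valid) {n : ℕ} {b : ℝ} (hb : 0 < b)
    (hbn : b ≤ n) : Real.log (b / P.δ) ≤ P.logFactor n := by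
  have hδ := hP.δ_pos
  refine Real.log_le_log (by positivity) (div_le_div_of_nonneg_right ?_ hδ.le)
  refine hbn.trans ?_
  rw [mul_assoc]
  exact le_mul_of_one_le_right (Nat.cast_nonneg n)
    (one_le_mul_of_one_le_of_one_le (le_max_left _ _) (le_max_left _ _))

theorem three_le_log : (3 : ℝ) ≤ Real.log 24 := by
  rw [Real.le_log_iff_exp_le (by norm_num)]
  have h := Real.exp_one_lt_d9
  have e : Real.exp 3 = Real.exp 1 ^ 3 := by rw [← Real.exp_nat_mul]; norm_num
  rw [e]
  calc Real.exp 1 ^ 3 ≤ 2.7182818286 ^ 3 := pow_le_pow_left₀ (Real.exp_pos _).le h.le 3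
    _ ≤ 24 := by norm_num

/-- After multiplication by `p`, the factor `1/p + p²/ε³` becomes `1 + (p/ε)³`. The logarithm
contains `n` itself, so its size is bootstrapped: `n ≥ 1` gives `Λ ≥ 2/5`, hence `n ≥ 24`, hence `Λ
≥ 3`. -/
theorem Params.Valid.logFactor_bounds {P : Params} (hP : P.Valid) (hδ : P.δ < 2 / 3)
    (hρ : P.α ^ 2 ≤ P.ρ) {N₀ M K lam : ℝ} (hN : 0 ≤ N₀) (hM : 0 < M) (hK : 0 < K) {n : ℕ}
    (hn : 10 ^ 30 * ((N₀ + M) / P.p +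
      (K * (1 + P.α ^ 2) / P.α ^ 2 + (P.ρ ^ 2 + lam ^ 2) / P.α ^ 4) *
        (1 / P.p + P.p ^ 2 / P.ε ^ 3) * P.logFactor n ^ 3) ≤ n) :
    24 ≤ (n : ℝ) ∧ 3 ≤ P.logFactor n ∧
    10 ^ 30 * (N₀ + M) ≤ P.p * n ∧
    10 ^ 30 * (K * ((1 + (P.p / P.ε) ^ 3) * P.logFactor n ^ 3)) ≤ P.p * n ∧
    10 ^ 30 * (K / P.α ^ 2 * ((1 + (P.p / P.ε) ^ 3) * P.logFactor n ^ 3)) ≤ P.p * n ∧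
    10 ^ 30 * ((P.ρ / P.α ^ 2) ^ 2 * ((1 + (P.p / P.ε) ^ 3) * P.logFactor n ^ 3)) ≤ P.p * n ∧
    10 ^ 30 * ((lam / P.α ^ 2) ^ 2 * ((1 + (P.p / P.ε) ^ 3) * P.logFactor n ^ 3)) ≤ P.p * n := by
  have hp := hP.p_pos
  have hp' := hP.p_lt
  have hε := hP.ε_pos
  have hα := hP.α_pos
  have hδ0 := hP.δ_pos
  have hρ0 := hP.ρ_pos
  set Λ := P.logFactor n with hΛ
  set Q := 1 + (P.p / P.ε) ^ 3 with hQ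
  have hQ1 : 1 ≤ Q := by have : 0 ≤ (P.p / P.ε) ^ 3 := by positivity
                         linarith
  have hn' : 10 ^ 30 * (N₀ + M + (K + K / P.α ^ 2 + (P.ρ / P.α ^ 2) ^ 2 + (lam / P.α ^ 2) ^ 2) *
      (Q * Λ ^ 3)) ≤ P.p * n := by
    have h := mul_le_mul_of_nonneg_left hn hp.le
    refine le_trans (le_of_eq ?_) h
    rw [hQ]
    field_simp
    ring
  clear_value Q
  have hn0 : 1 ≤ n := by
    by_contra! h
    obtain rfl : n = 0 := by omega
    -- For `n = 0` the logarithm takes its default value `log 0 = 0`, and `M > 0` alone contradicts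
    -- the hypothesis.
    have : Λ = 0 := by rw [hΛ, Params.logFactor]; simp
    rw [this] at hn'
    norm_num at hn'
    linarith
  have hΛ0 : 2 / 5 ≤ Λ := (Params.two_fifths_le_log hδ0 hδ).trans
    (hP.log_div_le_logFactor one_pos (by exact_mod_cast hn0))
  have hQΛ : 0 ≤ Q * Λ ^ 3 := by positivity
  have hr1 : 1 ≤ P.ρ / P.α ^ 2 := (one_le_div (by positivity)).2 hρ
  have t1 : 0 ≤ K * (Q * Λ ^ 3) := by positivity
  have t2 : 0 ≤ K / P.α ^ 2 * (Q * Λ ^ 3) := by positivity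
  have t3 : 0 ≤ (P.ρ / P.α ^ 2) ^ 2 * (Q * Λ ^ 3) := by positivity
  have t4 : 0 ≤ (lam / P.α ^ 2) ^ 2 * (Q * Λ ^ 3) := by positivity
  have t5 : 0 ≤ N₀ + M := by positivity
  have a3 : 10 ^ 30 * ((P.ρ / P.α ^ 2) ^ 2 * (Q * Λ ^ 3)) ≤ P.p * n := by linarith
  have hn24 : 24 ≤ (n : ℝ) := by
    have h1 : (2 / 5 : ℝ) ^ 3 ≤ Λ ^ 3 := pow_le_pow_left₀ (by norm_num) hΛ0 3
    have h2 : Λ ^ 3 ≤ Q * Λ ^ 3 := le_mul_of_one_le_left (by positivity) hQ1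
    have h3 : Q * Λ ^ 3 ≤ (P.ρ / P.α ^ 2) ^ 2 * (Q * Λ ^ 3) :=
      le_mul_of_one_le_left hQΛ (one_le_pow₀ hr1)
    have h4 : P.p * n ≤ 1 * n := mul_le_mul_of_nonneg_right (by linarith) (Nat.cast_nonneg n)
    norm_num at h1 a3
    linarith
  have hΛ3 : 3 ≤ Λ := by
    refine three_le_log.trans (le_trans ?_ (hP.log_div_le_logFactor (by norm_num) hn24))
    exact Real.log_le_log (by norm_num) ((le_div_iff₀ hδ0).2 (by linarith))
  exact ⟨hn24, hΛ3, by linarith, by linarith, by linarith, a3, by linarith⟩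

/-- The hypothesis on `n` gives `10 * depth / p ≤ n ≤ exp Λ`, so `floorCount` costs `2Λ`. The rest
is `4 * center ≤ 8 + 16 (p/ε) Λ` with `8 ≤ 3Λ`. -/
theorem Params.Valid.budget_le_exp {P : Params} (hP : P.Valid) {n : ℕ} (hn : 24 ≤ (n : ℝ))
    (hΛ : 3 ≤ P.logFactor n) (h : 160 * ((1 + P.p / P.ε) * P.logFactor n) ≤ P.p * n) :
    P.budget ≤ Real.exp (5 * P.logFactor n + 16 * (P.p / P.ε * P.logFactor n)) := by
  have hp := hP.p_pos
  have hp' := hP.p_lt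
  have hδ0 := hP.δ_pos
  have hε := hP.ε_pos
  have h24 : Real.log (24 / P.δ) ≤ P.logFactor n := hP.log_div_le_logFactor (by norm_num) hn
  have h8 : Real.log (8 / P.δ) ≤ P.logFactor n :=
    hP.log_div_le_logFactor (by norm_num) (by linarith)
  have hnΛ : (n : ℝ) ≤ Real.exp (P.logFactor n) := by
    rw [← Real.log_le_iff_le_exp (by linarith)]
    refine le_trans ?_ (hP.log_div_le_logFactor (by linarith) le_rfl)
    exact Real.log_le_log (by linarith) (le_div_self (by linarith) hδ0 hP.δ_lt_one.le)
  set Λ := P.logFactor n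
  set x := P.p / P.ε with hx
  have hx0 : 0 ≤ x := by positivity
  have hc : P.center ≤ 2 + 4 * (x * Λ) := by
    have h1 := mul_le_mul_of_nonneg_left h8 hx0
    have e : P.center = 8 * P.p + 4 * (x * Real.log (8 / P.δ)) := by
      rw [Params.center, hx]; ring
    rw [e]; linarith
  have hd : P.depth ≤ 16 * ((1 + x) * Λ) := by
    have e : P.depth = 4 * P.center + Real.log (24 / P.δ) := rfl
    nlinarith
  have hf : P.floorCount ≤ Real.exp Λ * Real.exp Λ := by
    have h0 : 0 ≤ 10 * P.depth / P.p := by have := hP.one_le_depth; positivity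
    have h1 : 10 * P.depth / P.p ≤ Real.exp Λ := by
      refine le_trans ?_ hnΛ
      rw [div_le_iff₀ hp]; linarith
    exact mul_le_mul h1 h1 h0 (Real.exp_pos _).le
  calc P.budget ≤ (Real.exp Λ * Real.exp Λ) * Real.exp (4 * P.center) :=
        mul_le_mul_of_nonneg_right hf (Real.exp_pos _).le
    _ = Real.exp (Λ + Λ + 4 * P.center) := by rw [Real.exp_add, Real.exp_add]
    _ ≤ _ := Real.exp_le_exp.2 (by linarith)

set_option maxHeartbeats 1000000 in
/-- A sample size as in the theorem admits a suitable failure probability `exp (-τ)`. -/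
theorem Params.Valid.exists_failure_exponent {P : Params} (hP : P.Valid) (hδ : P.δ < 2 / 3)
    (hρ : P.α ^ 2 ≤ P.ρ) {N₀ M K lam : ℝ} (hN : 0 ≤ N₀) (hM : 0 < M) (hK : 0 < K)
    (hlam : 0 < lam) {n : ℕ}
    (hn : 10 ^ 30 * ((N₀ + M) / P.p +
      (K * (1 + P.α ^ 2) / P.α ^ 2 + (P.ρ ^ 2 + lam ^ 2) / P.α ^ 4) *
        (1 / P.p + P.p ^ 2 / P.ε ^ 3) * P.logFactor n ^ 3) ≤ n) :
    ∃ τ : ℝ, 0 < τ ∧ N₀ + K * τ / (P.α / 2) ^ 2 ≤ P.p * n / 2 ∧ M + K * τ ≤ P.p * n / 2 ∧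
      8 * τ ≤ P.p * n ∧
      2 * τ / (P.p * P.α ^ 2) * (lam * (Real.log 2 + τ) / n) ≤ 1 ∧
      n * ((2 * τ / (P.p * P.α ^ 2)) ^ 2 * (lam * (Real.log 2 + τ) / n) ^ 2 * P.p) ≤ τ ∧
      P.numSamples * ((6 + 4 * (n * P.ρ) / (P.p * P.α ^ 2)) * Real.exp (-τ)) ≤ 3 * P.δ / 4 := by
  obtain ⟨hn24, hΛ3, a1, a2, a3, a4, a5⟩ := hP.logFactor_bounds hδ hρ hN hM hK hn
  have hp := hP.p_pos
  have hp' := hP.p_lt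
  have hε := hP.ε_pos
  have hα := hP.α_pos
  have hδ0 := hP.δ_pos
  have hρ0 := hP.ρ_pos
  have hbud := hP.budget_le_exp hn24 hΛ3
  have hnΛ : (n : ℝ) / P.δ ≤ Real.exp (P.logFactor n) := by
    rw [← Real.log_le_iff_le_exp (by positivity)]
    exact hP.log_div_le_logFactor (by linarith) le_rfl
  have hr1 : 1 ≤ P.ρ / P.α ^ 2 := (one_le_div (by positivity)).2 hρ
  set Λ := P.logFactor n
  set x := P.p / P.ε
  have hx0 : 0 ≤ x := by positivity
  set r := P.ρ / P.α ^ 2 with hr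
  set y := lam / P.α ^ 2 with hy
  set w := (1 + x ^ 3) * Λ ^ 3 with hw
  have hy0 : 0 < y := by positivity
  have hw0 : 0 ≤ w := by positivity
  have hΛΛ : Λ ≤ Λ ^ 3 := by nlinarith [mul_self_nonneg Λ]
  have hu1 : (1 + x) * Λ ≤ 2 * w := by
    have := mul_le_mul (one_add_le hx0) hΛΛ (by linarith) (by positivity)
    linarith
  have hu3 : ((1 + x) * Λ) ^ 3 ≤ 4 * w := by
    have := mul_le_mul_of_nonneg_right (one_add_pow_three_le hx0) (pow_nonneg (by linarith : 0 ≤ Λ) 3)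
    rw [mul_pow]; linarith
  have hu : 3 ≤ (1 + x) * Λ := by nlinarith
  set u := (1 + x) * Λ with hudef
  have hu2 : u ^ 2 ≤ 4 * w := (pow_le_pow_right₀ (by linarith) (by norm_num)).trans hu3
  have hwp : 10 ^ 30 * w ≤ P.p * n := by
    refine le_trans ?_ a4
    have := le_mul_of_one_le_left hw0 (one_le_pow₀ hr1 (n := 2))
    linarith
  have hbud' := hbud (by linarith)
  have hpn : 0 < P.p * n := by positivity
  have hrpn : r ≤ P.p * n := by
    refine le_trans ?_ a4
    have h1 : r * 1 ≤ r ^ 2 * w := by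
      refine mul_le_mul (by nlinarith) ?_ zero_le_one (sq_nonneg r)
      linarith
    linarith
  clear_value w
  -- `τ = 40 (1 + p/ε) Λ` beats the exponent `5Λ + 16 (p/ε) Λ` of the number of subsamples and the
  -- `2Λ` of the polynomial prefactor.
  refine ⟨40 * u, by linarith, ?_, ?_, ?_, ?_, ?_, ?_⟩
  · have e : K * (40 * u) / (P.α / 2) ^ 2 = 160 * (K / P.α ^ 2 * u) := by
      field_simp; ring
    have h1 : K / P.α ^ 2 * u ≤ K / P.α ^ 2 * (2 * w) :=
      mul_le_mul_of_nonneg_left hu1 (by positivity)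
    rw [e]
    linarith
  · have h1 : K * u ≤ K * (2 * w) := mul_le_mul_of_nonneg_left hu1 hK.le
    linarith
  · linarith
  · have hl2 : Real.log 2 ≤ 40 * u := by linarith [Real.log_two_lt_d9]
    have e : 2 * (40 * u) / (P.p * P.α ^ 2) * (lam * (Real.log 2 + 40 * u) / n) =
        80 * (u * (Real.log 2 + 40 * u)) * y / (P.p * n) := by
      rw [hy]; field_simp; ring
    rw [e, div_le_one hpn]
    have h0 : u * (Real.log 2 + 40 * u) ≤ u * (80 * u) :=
      mul_le_mul_of_nonneg_left (by linarith) (by linarith)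
    have h1 : u * (Real.log 2 + 40 * u) ≤ 80 * (4 * w) := by linarith
    have h2 : 80 * (u * (Real.log 2 + 40 * u)) * y ≤ 80 * (80 * (4 * w)) * y := by gcongr
    have h3 : y * w ≤ (1 + y ^ 2) * w := mul_le_mul_of_nonneg_right
      (by linarith [sq_nonneg (y - 1), sq_nonneg y]) hw0
    linarith
  · have hl2 : Real.log 2 ≤ 40 * u := by linarith [Real.log_two_lt_d9]
    have hl0 : 0 ≤ Real.log 2 := Real.log_nonneg one_le_two
    -- Up to constants the condition reads `u³ (lam/α²)² ≤ p n`. This is the highest power of `u`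
    -- required, and the origin of both `(p/ε)³` and the cubed logarithm.
    have e : n * ((2 * (40 * u) / (P.p * P.α ^ 2)) ^ 2 *
        (lam * (Real.log 2 + 40 * u) / n) ^ 2 * P.p) =
        6400 * (u ^ 2 * (Real.log 2 + 40 * u) ^ 2) * y ^ 2 / (P.p * n) := by
      rw [hy]; field_simp; ring
    rw [e, div_le_iff₀ hpn]
    have h1 : (Real.log 2 + 40 * u) ^ 2 ≤ (80 * u) ^ 2 :=
      pow_le_pow_left₀ (by positivity) (by linarith) 2
    calc 6400 * (u ^ 2 * (Real.log 2 + 40 * u) ^ 2) * y ^ 2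
        ≤ 6400 * (u ^ 2 * (80 * u) ^ 2) * y ^ 2 := by gcongr
      _ = 40 * u * (1024000 * (u ^ 3 * y ^ 2)) := by ring
      _ ≤ 40 * u * (1024000 * (4 * w * y ^ 2)) := by gcongr
      _ ≤ 40 * u * (P.p * n) := by
          refine mul_le_mul_of_nonneg_left ?_ (by linarith)
          have : 0 ≤ y ^ 2 * w := by positivity
          linarith
  · have hn0 : (0 : ℝ) ≤ n := by linarith
    have e : 4 * (n * P.ρ) / (P.p * P.α ^ 2) = 4 * (n * (r / P.p)) := by
      rw [hr]; field_simp
    have h1 : r / P.p ≤ n := by rw [div_le_iff₀ hp]; linarith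
    -- The prefactor is made polynomial in `n` alone. With `n ≤ exp Λ * δ` it brings `δ²`, one
    -- factor of which supplies the `δ` of the target.
    have h2 : 6 + 4 * (n * P.ρ) / (P.p * P.α ^ 2) ≤ 5 * n ^ 2 := by
      rw [e]
      have g1 := mul_le_mul_of_nonneg_left h1 hn0
      have g2 := mul_le_mul hn24 hn24 (by norm_num) hn0
      rw [sq]
      linarith
    have h3 : (n : ℝ) ≤ Real.exp Λ * P.δ := by rwa [div_le_iff₀ hδ0] at hnΛ
    have h4 : (n : ℝ) ^ 2 ≤ Real.exp Λ * P.δ * (Real.exp Λ * P.δ) := by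
      rw [sq]; exact mul_le_mul h3 h3 hn0 (by positivity)
    have h5 : 24 ≤ Real.exp Λ := by
      refine le_trans ?_ hnΛ
      rw [le_div_iff₀ hδ0]; linarith [hP.δ_lt_one]
    have h6 : (P.numSamples : ℝ) ≤ 2 * Real.exp (5 * Λ + 16 * (x * Λ)) := by
      linarith [hP.numSamples_le]
    have h7 : P.δ * P.δ ≤ P.δ * 1 := mul_le_mul_of_nonneg_left hP.δ_lt_one.le hδ0.le
    calc P.numSamples * ((6 + 4 * (n * P.ρ) / (P.p * P.α ^ 2)) * Real.exp (-(40 * u)))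
        ≤ 2 * Real.exp (5 * Λ + 16 * (x * Λ)) *
          (5 * (Real.exp Λ * P.δ * (Real.exp Λ * P.δ)) * Real.exp (-(40 * u))) := by
          refine mul_le_mul h6 ?_ (by positivity) (by positivity)
          exact mul_le_mul_of_nonneg_right (by linarith) (Real.exp_pos _).le
      _ = 10 * Real.exp (5 * Λ + 16 * (x * Λ) + Λ + Λ + -(40 * u)) * (P.δ * P.δ) := by
          simp only [Real.exp_add]; ring
      _ ≤ 10 * Real.exp (-Λ) * (P.δ * 1) := by
          have : 0 ≤ x * Λ := by positivity
          gcongr 10 * Real.exp ?_ * ?_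
          rw [hudef]; linarith
      _ ≤ 3 * P.δ / 4 := by
          have : Real.exp (-Λ) ≤ 1 / 24 := by
            rw [Real.exp_neg, ← one_div]
            exact one_div_le_one_div_of_le (by norm_num) h5
          have := mul_le_mul_of_nonneg_right this hδ0.le
          linarith

end Choice

end ParamTest

namespace ParamTest

/-! ### Accuracy -/

section Accuracy

variable {d n : ℕ} [NeZero d] {𝒵 : Type*}

theorem volume_coin_ne (y : SignType) :
    volume {u : unitInterval | coin u ≠ y} ≤ ENNReal.ofReal (2 / 3) := by
  have hge : ∀ c : ℝ, 0 ≤ c → c ≤ 1 →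
      volume {u : unitInterval | (u : ℝ) < c}ᶜ = ENNReal.ofReal (1 - c) := fun c h0 h1 => by
    rw [measure_compl (measurableSet_lt measurable_subtype_coe measurable_const)
      (measure_ne_top _ _), volume_lt c h1, measure_univ, ENNReal.ofReal_sub _ h0,
      ENNReal.ofReal_one]
  rcases y with _ | _ | _
  · have hsub : {u : unitInterval | coin u ≠ .zero} ⊆
        {u | (u : ℝ) < 1 / 3} ∪ {u : unitInterval | (u : ℝ) < 2 / 3}ᶜ := by
      intro u hu
      by_contra hcon
      rw [Set.mem_union, not_or, Set.notMem_compl_iff] at hcon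
      have h1 : ¬ (u : ℝ) < 1 / 3 := hcon.1
      have h2 : (u : ℝ) < 2 / 3 := hcon.2
      exact hu (by rw [coin, if_neg h1, if_pos h2]; rfl)
    refine (measure_mono hsub).trans ((measure_union_le _ _).trans ?_)
    rw [volume_lt _ (by norm_num), hge _ (by norm_num) (by norm_num),
      ← ENNReal.ofReal_add (by norm_num) (by norm_num)]
    exact ENNReal.ofReal_le_ofReal (by norm_num)
  · have hsub : {u : unitInterval | coin u ≠ .neg} ⊆ {u : unitInterval | (u : ℝ) < 1 / 3}ᶜ := by
      intro u hu h1
      have h1' : (u : ℝ) < 1 / 3 := h1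
      exact hu (by rw [coin, if_pos h1']; rfl)
    refine (measure_mono hsub).trans ?_
    rw [hge _ (by norm_num) (by norm_num)]
    exact ENNReal.ofReal_le_ofReal (by norm_num)
  · have hsub : {u : unitInterval | coin u ≠ .pos} ⊆ {u : unitInterval | (u : ℝ) < 2 / 3} := by
      intro u hu
      by_contra h2
      have h2' : ¬ (u : ℝ) < 2 / 3 := h2
      exact hu (by rw [coin, if_neg (fun h => h2' (h.trans (by norm_num))), if_neg h2']; rfl)
    refine (measure_mono hsub).trans ?_
    rw [volume_lt _ (by norm_num)]

theorem measurePreserving_firstDraw (n : ℕ) :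
    MeasurePreserving (fun r : Tape n => r.1 0) (tapeMeasure n) volume :=
  (measurePreserving_eval_infinitePi (fun _ : ℕ => (volume : Measure unitInterval)) 0).comp
    measurePreserving_fst

theorem measurePreserving_subsampleBits (n s : ℕ) :
    MeasurePreserving (fun r : Tape n => r.2 s) (tapeMeasure n)
      (Measure.pi fun _ : Fin n => (volume : Measure unitInterval)) :=
  (measurePreserving_eval_infinitePi
    (fun _ : ℕ => Measure.pi fun _ : Fin n => (volume : Measure unitInterval)) s).comp
    measurePreserving_snd

variable [MeasurableSpace 𝒵] (D : Measure 𝒵) [IsProbabilityMeasure D]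

theorem errorProb_le_of_coin (𝒯 : Task d 𝒵) {P : Params} (hδ : ¬ P.δ < 2 / 3) (y : SignType) :
    errorProb n mechanism 𝒯 P D y ≤ ENNReal.ofReal P.δ := by
  have hsub : {x : (Fin n → 𝒵) × Tape n | ¬ Outputs mechanism 𝒯 P x.1 x.2 y} ⊆
      (fun x => x.2.1 0) ⁻¹' {u : unitInterval | coin u ≠ y} := by
    intro x hx
    have hx' : ¬ Outputs mechanism 𝒯 P x.1 x.2 y := hx
    rw [outputs_iff, Task.output, if_neg hδ] at hx'
    exact hx'
  have hφ : MeasurePreserving (fun x : (Fin n → 𝒵) × Tape n => x.2.1 0)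
      ((Measure.pi fun _ : Fin n => D).prod (tapeMeasure n)) volume :=
    (measurePreserving_firstDraw n).comp measurePreserving_snd
  exact (measure_mono hsub).trans ((hφ.measure_preimage_le _).trans ((volume_coin_ne y).trans
    (ENNReal.ofReal_le_ofReal (not_lt.1 hδ))))

/-- The union bound over the subsamples. -/
theorem errorProb_le_of_separates (𝒯 : Task d 𝒵) {P : Params} (hP : P.Valid)
    (hδ : P.δ < 2 / 3) {y : SignType} {v q : ℝ}
    (h : ((Measure.pi fun _ : Fin n => D).prod
      (Measure.pi fun _ : Fin n => (volume : Measure unitInterval)))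
        {x | ¬ 𝒯.Separates P y v (thin x.1 P.p x.2)} ≤ ENNReal.ofReal q)
    (hq : P.numSamples * q ≤ 3 * P.δ / 4) :
    errorProb n mechanism 𝒯 P D y ≤ ENNReal.ofReal P.δ := by
  have hδ0 := hP.δ_pos
  set B := {x : (Fin n → 𝒵) × (Fin n → unitInterval) | ¬ 𝒯.Separates P y v (thin x.1 P.p x.2)}
  have hφ : MeasurePreserving (fun x : (Fin n → 𝒵) × Tape n => x.2.1 0)
      ((Measure.pi fun _ : Fin n => D).prod (tapeMeasure n)) volume :=
    (measurePreserving_firstDraw n).comp measurePreserving_snd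
  have hψ : ∀ s, MeasurePreserving (Prod.map id fun r : Tape n => r.2 s)
      ((Measure.pi fun _ : Fin n => D).prod (tapeMeasure n))
      ((Measure.pi fun _ : Fin n => D).prod
        (Measure.pi fun _ : Fin n => (volume : Measure unitInterval))) := fun s =>
    (MeasurePreserving.id _).prod (measurePreserving_subsampleBits n s)
  have hsub : {x : (Fin n → 𝒵) × Tape n | ¬ Outputs mechanism 𝒯 P x.1 x.2 y} ⊆
      (fun x => x.2.1 0) ⁻¹' (goodNoise P)ᶜ ∪
        ⋃ s ∈ Finset.range P.numSamples, Prod.map id (fun r : Tape n => r.2 s) ⁻¹' B := by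
    rintro ⟨Z, r⟩ hx
    have hx' : ¬ Outputs mechanism 𝒯 P Z r y := hx
    by_contra hcon
    rw [Set.mem_union, not_or] at hcon
    obtain ⟨h1, h2⟩ := hcon
    have h1' : r.1 0 ∈ goodNoise P := not_not.1 h1
    have h2' : ∀ s < P.numSamples, 𝒯.Separates P y v (thin Z P.p (r.2 s)) := by
      intro s hs
      by_contra hcon
      exact h2 (Set.mem_biUnion (Finset.mem_coe.2 (Finset.mem_range.2 hs)) hcon)
    refine hx' ?_
    rw [outputs_iff, Task.output, if_pos hδ]
    exact verdictAt_of_separated (a := fun j i => 𝒯.clipped P j (thin Z P.p (r.2 i))) hP h1'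
      (fun s hs => (h2' s hs).1) fun j hj s hs => (h2' s hs).2 j hj
  refine (measure_mono hsub).trans ((measure_union_le _ _).trans
    ((add_le_add ((hφ.measure_preimage_le _).trans (volume_goodNoise_compl hP))
      ((measure_biUnion_finset_le _ _).trans
        (Finset.sum_le_sum fun s _ => ((hψ s).measure_preimage_le B).trans h))).trans ?_))
  rw [Finset.sum_const, Finset.card_range, nsmul_eq_mul, ← ENNReal.ofReal_natCast,
    ← ENNReal.ofReal_mul (Nat.cast_nonneg _)]
  calc ENNReal.ofReal (P.δ / 4) + ENNReal.ofReal (P.numSamples * q)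
      ≤ ENNReal.ofReal (P.δ / 4) + ENNReal.ofReal (3 * P.δ / 4) :=
        add_le_add_right (ENNReal.ofReal_le_ofReal hq) _
    _ = ENNReal.ofReal P.δ := by
        rw [← ENNReal.ofReal_add (by positivity) (by positivity)]; congr 1; ring

/-- The mechanism is accurate if the first coordinate of the population minimizer is far from all
regions but one. -/
theorem errorProb_mechanism_le {𝒯 : Task d 𝒵} {P : Params} (hP : P.Valid)
    {θhat : ∀ n : ℕ, (Fin n → 𝒵) → Fin d → ℝ} {θD : Fin d → ℝ} {N : ℝ → ℝ}
    {M K lam μ σ : ℝ} (hm : 𝒯.IsMeasurable) (hθD : 𝒯.IsPopulationMinimizer D θD)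
    (hS : 𝒯.IdConcStable D θhat θD N M K lam μ σ) (hρ : 2 * σ ^ 2 + P.α ^ 2 ≤ P.ρ)
    (ht : 20 * P.α / √μ < P.t)
    (hn : 10 ^ 30 * ((N (P.α / 2) + M) / P.p +
      (K * (1 + P.α ^ 2) / P.α ^ 2 + (P.ρ ^ 2 + lam ^ 2) / P.α ^ 4) *
        (1 / P.p + P.p ^ 2 / P.ε ^ 3) * P.logFactor n ^ 3) ≤ n) {j₀ : SignType}
    (hsep : ∀ j ≠ j₀, ∀ w ∈ region P.t j, P.t / 2 ≤ |w - θD 0|) :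
    errorProb n mechanism 𝒯 P D j₀ ≤ ENNReal.ofReal P.δ := by
  by_cases hδ : P.δ < 2 / 3
  · obtain ⟨τ, hτ, h1, h2, h3, h4, h5, hq⟩ := hP.exists_failure_exponent hδ
      (by linarith [sq_nonneg σ]) (hS.N_nonneg _ (half_pos hP.α_pos)) hS.M_pos hS.K_pos
      hS.lam_pos hn
    obtain ⟨v, hv⟩ := Task.exists_measure_not_separates_le hP hm ⟨θD, hθD.1⟩ hS hρ ht hsep hτ
      h1 h2 h3 h4 h5
    exact errorProb_le_of_separates D 𝒯 hP hδ hv hq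
  · exact errorProb_le_of_coin D 𝒯 hδ j₀

end Accuracy

/-- Regions other than that of the sign of `a` stay on the far side of `t` or `-t`, hence even at
distance `t`; `t / 2` is what the case of a small `a` also provides. -/
theorem le_abs_sub_of_two_mul_lt {t a : ℝ} (ht : 0 < t) (ha : 2 * t < |a|) :
    ∀ j ≠ SignType.sign a, ∀ w ∈ region t j, t / 2 ≤ |w - a| := by
  intro j hj w hw
  rcases lt_abs.1 ha with h | h
  · rw [sign_pos (by linarith)] at hj
    have hwt : w ≤ t := by
      rcases j with _ | _ | _
      · exact hw.2.le
      · exact (show w ≤ -t from hw).trans (by linarith)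
      · exact absurd rfl hj
    rw [abs_sub_comm]
    exact le_trans (by linarith) (le_abs_self _)
  · rw [sign_neg (by linarith)] at hj
    have hwt : -t ≤ w := by
      rcases j with _ | _ | _
      · exact hw.1.le
      · exact absurd rfl hj
      · exact le_trans (by linarith) (show t ≤ w from hw)
    exact le_trans (by linarith) (le_abs_self _)

theorem le_abs_sub_of_lt_half {t a : ℝ} (ha : |a| < t / 2) :
    ∀ j ≠ (0 : SignType), ∀ w ∈ region t j, t / 2 ≤ |w - a| := by
  intro j hj w hw
  obtain ⟨h1, h2⟩ := abs_lt.1 ha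
  rcases j with _ | _ | _
  · exact absurd rfl hj
  · have : w ≤ -t := hw
    rw [abs_sub_comm]
    exact le_trans (by linarith) (le_abs_self _)
  · have : t ≤ w := hw
    exact le_trans (by linarith) (le_abs_self _)

end ParamTest
theorem theorem5p3 :
    ∃ (c : ParamTest.Cmd) (C : ℝ) (k m : ℕ), 0 < C ∧
      ∀ (d : ℕ) [NeZero d] (𝒵 : Type*) (𝒯 : ParamTest.Task d 𝒵) (P : ParamTest.Params),
        P.Valid →
        -- privacy, for every task and every size of the dataset
        (∀ n : ℕ, ParamTest.IsDP n c 𝒯 P) ∧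
        -- running time, for every dataset and every outcome of the random draws
        (∀ (n : ℕ) (Z : Fin n → 𝒵) (r : ParamTest.Tape n),
          ParamTest.HaltsWithin c 𝒯 P Z r
            (C * Real.exp (C * (P.p / P.ε * Real.log (1 / P.δ))) *
              (1 + Real.log (1 / P.δ) / P.p) ^ m)) ∧
        -- accuracy
        (∀ [MeasurableSpace 𝒵] (D : Measure 𝒵) [IsProbabilityMeasure D]
          (θhat : ∀ n : ℕ, (Fin n → 𝒵) → Fin d → ℝ) (θD : Fin d → ℝ)
          (N : ℝ → ℝ) (M K lam μ σ : ℝ),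
          𝒯.IsMeasurable → 𝒯.IsArgminSelection θhat → 𝒯.IsPopulationMinimizer D θD →
          𝒯.IdConcStable D θhat θD N M K lam μ σ →
          2 * σ ^ 2 + P.α ^ 2 ≤ P.ρ → 20 * P.α / √μ < P.t →
          ∀ n : ℕ,
            C * ((N (P.α / 2) + M) / P.p +
                (K * (1 + P.α ^ 2) / P.α ^ 2 + (P.ρ ^ 2 + lam ^ 2) / P.α ^ 4) *
                  (1 / P.p + P.p ^ 2 / P.ε ^ 3) *
                  Real.log (n * max 1 (P.ρ / P.α) * max 1 (1 / P.ε) / P.δ) ^ k) ≤ n →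
            (2 * P.t < |θD 0| →
              ParamTest.errorProb n c 𝒯 P D (SignType.sign (θD 0)) ≤ ENNReal.ofReal P.δ) ∧
            (|θD 0| < P.t / 2 →
              ParamTest.errorProb n c 𝒯 P D 0 ≤ ENNReal.ofReal P.δ)) := by
  -- The exponent `3` is that of `u³` in the variance condition; `4` arises because time is
  -- quadratic in `N`, and `N` is quadratic in `log(1/δ)/p` up to the exponential factor.
  refine ⟨ParamTest.mechanism, 10 ^ 30, 3, 4, by positivity, fun d _ 𝒵 𝒯 P hP =>
    ⟨fun n => ParamTest.isDP_mechanism 𝒯 hP n,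
      fun n Z r => ParamTest.haltsWithin_mechanism 𝒯 hP Z r, ?_⟩⟩
  intro _ D _ θhat θD N M K lam μ σ hm _ hθD hS hρ ht n hn
  exact ⟨fun h => ParamTest.errorProb_mechanism_le D hP hm hθD hS hρ ht hn
      (ParamTest.le_abs_sub_of_two_mul_lt hP.t_pos h),
    fun h => ParamTest.errorProb_mechanism_le D hP hm hθD hS hρ ht hn
      (ParamTest.le_abs_sub_of_lt_half h)⟩
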